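/- **Setting.** Let $d\ge 0$ be an integer, $\mathbb M=\mathbb R^d$, and let $\mathcal P_2(\mathbb M)$ be the set of Borel probability measures on $\mathbb M$ with finite second moment, with the quadratic Wasserstein distance $W_2$; $\Gamma_0(m,\nu)$ is the set of optimal plans between $m$ and $\nu$. For $k\ge 1$, $\xi\in\mathbb M^k$ and $m\in\mathcal P_2(\mathbb M)$ put $$F^k_\xi[m]=\frac1k\int_{\mathbb M^k}\frac1{k!}\sum_{\sigma\in P_k}e^{-2\pi i\sum_j\langle \xi_{\sigma(j)},x_j\rangle}\,m(dx_1)\cdots m(dx_k),\qquad \lambda^2_{k,\epsilon}(\xi)=4\pi^2\Big(\Big|\sum_{j=1}^k\xi_j\Big|^2+\epsilon\sum_{j=1}^k|\xi_j|^2\Big),\qquad \lambda_k^2=\lambda_{k,0}^2 .$$ *Spaces.* $\mathcal A^s$ ($s\ge0$) is the set of sequences $(a_k)_{k\ge1}$ of Borel functions $a_k:\mathbb M^k\to\mathbb C$, invariant under permutations of the $k$ variables, with $\sum_{k\ge1}\frac1{k!}\int_{\mathbb M^k}|a_k|^2(1+\lambda_k^2)^s\,d\xi<\infty$. $H^s(\mathcal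 P_2(\mathbb M))$ is the set of functions $G:\mathcal P_2(\mathbb M)\to\mathbb C$ for which there is $(a_k)\in\mathcal A^s$ such that, for every $m$, the integrals $\int_{\mathbb M^k} a_kF^k_\xi[m]\,d\xi$ converge absolutely and $\sum_{k\ge1}\frac1{k!}\int_{\mathbb M^k} a_k(\xi)F^k_\xi[m]\,d\xi=G[m]$. *Differentiation.* For $U:\mathcal P_2(\mathbb M)\to\mathbb R$, the subdifferential $\partial_\cdot U[m]$ is the set of $\zeta\in L^2(m;\mathbb M)$ with $U[\nu]-U[m]\ge\inf_{\gamma\in\Gamma_0(m,\nu)}\int\zeta(x)\cdot(y-x)\,\gamma(dx,dy)+o(W_2(m,\nu))$, and the superdifferential is $-\partial_\cdot(-U)[m]$; $U$ is differentiable at $m$ if both are nonempty, and then $\nabla_wU[m]$ is the element of minimal norm of $\partial_\cdot U[m]$. Write $\zeta\cdot(U[m])=\langle\nabla_wU[m],\zeta\rangle_{L^2(m)}$, and let $T_m$ be the closure of $\nabla C_c^\infty(\mathbb M)$ in $L^2(m)$. The Hessian of $U$ at $m$ is the bounded bilinear form on $T_m$ with $\mathrm{Hess}\,U[m](\zeta_1,\zeta_2)=\zeta_1\cdot(\zeta_2\cdot(U[m]))-(\nabla\zeta_2\,\zeta_1)\cdot(U[m])$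 for $\zeta_1,\zeta_2\in\nabla C_c^\infty(\mathbb M)$. $U$ is twice differentiable if it is differentiable everywhere, with gradients $\nabla_wU[m](x)$ that are continuous in $x$ and satisfy, for each $m$, $|\nabla_wU[\nu](x)|\le C_m(1+|x|)$ for all $x$ and all $\nu$ near $m$, and if for each $m$ there are bounded Borel matrix fields $\tilde A[m](x)$ and $\nabla_w^2U[m](x,a)$, the rows of $\nabla_w^2U[m](x,\cdot)$ lying in $T_m$, a concave modulus $\rho$ and a function $\epsilon_2\ge0$ with $\epsilon_2(0^+)=0$, such that for all $\nu$, all $\gamma\in\Gamma_0(m,\nu)$ and all $x,y\in\mathbb M$ $$\Big|\nabla_wU[\nu](y)-\nabla_wU[m](x)-\tilde A[m](x)(y-x)-\int\nabla_w^2U[m](x,a)(b-a)\,\gamma(da,db)\Big|\le|x-y|\rho(|x-y|)+W_2(m,\nu)\,\epsilon_2(W_2(m,\nu)).$$ It is twice continuously differentiable if moreover $\tilde A[m](x)$ and $\nabla_w^2U[m](x,a)$ are jointly continuous in all their arguments, $m$ included. Finally $$\triangle_{w,\epsilon}U[m]=\sum_{i=1}^d\Big(\mathrm{Hess}\,U[m](\zeta_i,\zeta_i)+\epsilon\int\langle\tilde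 A[m]\zeta_i,\zeta_i\rangle\,dm\Big),$$ where $\zeta_i$ is the Wasserstein gradient of $m\mapsto\int x_i\,m(dx)$. For complex-valued functions these notions are applied to the real and imaginary parts. *Flow.* $(W_t)_{t\ge0}$ is a standard $d$-dimensional Brownian motion started at $0$, and for $t>0$, $\sigma^\epsilon_t[m]=(\mathrm{id}+\sqrt{2\beta}\,W_t)_\#(G^\epsilon_t*m)$ with $G^\epsilon_t(z)=(4\pi\epsilon t)^{-d/2}e^{-|z|^2/(4\epsilon t)}$ if $\epsilon>0$, and $G^0_t*m=m$. **Theorem (superposition).** Let $s,\delta,C,\beta>0$, $\epsilon\ge0$, and let $(a_k)\in\mathcal A^s$ satisfy $\int_{\mathbb M^k}|a_k|\,d\xi\le Ck!/k^{\delta}$ for all $k\ge1$. Put $$b_k(t,\xi)=a_k(\xi)e^{-\beta\lambda^2_{k,\epsilon/\beta}(\xi)t},\qquad V(t,m)=\sum_{k=1}^\infty\frac1{k!}\int_{\mathbb M^k} b_k(t,\xi)F^k_\xi[m]\,d\xi\quad(t\ge0),\qquad U_0[m]=\sum_{k=1}^\infty\frac1{k!}\int_{\mathbb M^k} a_k(\xi)F^k_\xi[m]\,d\xi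 .$$ Then: (i) For every $t>0$ the series defining $V(t,\cdot)$ converges uniformly on $\mathcal P_2(\mathbb M)$, and $V(t,\cdot)\in H^l(\mathcal P_2(\mathbb M))$ for every real $l\ge0$. (ii) For every $t>0$ and $m\in\mathcal P_2(\mathbb M)$, $U_0(\sigma^\epsilon_t[m])$ is integrable and $V(t,m)=\mathbb E\,U_0(\sigma^\epsilon_t[m])$. (iii) Suppose that $\epsilon=0$ and that $$\int|a_k||\xi_1|^p\,d\xi\le\frac{Ck!}{k^{1+\delta}}\ (p=1,2,3,\ k\ge1),\qquad \int|a_k||\xi_1||\xi_2|\,d\xi\le\frac{Ck!}{k^{2+\delta}},\quad \int|a_k||\xi_1|^2|\xi_2|\,d\xi\le\frac{Ck!}{k^{3+\delta}}\ (k\ge2).$$ Then for every $t>0$, $V(t,\cdot)$ is twice continuously differentiable and, for every $m$, $$\beta\triangle_{w,\epsilon/\beta}V(t,m)=\sum_{k=1}^\infty\frac1{k!}\int_{\mathbb M^k} b_k(t,\xi)\,\beta\triangle_{w,\epsilon/\beta}F^k_\xi[m]\,d\xi ,$$ where the Laplacians of all the $F^k_\xi$ exist, the integrals and the series converging absolutely.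 Moreover $V$ solves the heat equation: $\partial_tV(t,m)=\beta\triangle_{w,\epsilon/\beta}V(t,m)$ for all $t>0$ and $m$, and $V(0,m)=U_0[m]=\lim_{t\to0^+}V(t,m)$ for all $m$. (iv) The conclusions of (iii) also hold if $\epsilon>0$ and $\int_{\mathbb M^k}|a_k|\,d\xi\le Ck!/k^{3+\delta}$ for all $k\ge1$. -/

import Mathlib

open MeasureTheory ProbabilityTheory Filter Topology Set
open scoped ENNReal NNReal

namespace WassersteinHeat

noncomputable section

/-- The base space `ℝ^d` with its Euclidean norm. -/
abbrev E (d : ℕ) : Type := EuclideanSpace ℝ (Fin d)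

/-! ### The Wasserstein space -/

/-- Borel probability measures on `ℝ^d` with finite second moment. -/
def P2 (d : ℕ) : Type :=
  {m : Measure (E d) // IsProbabilityMeasure m ∧ ∫⁻ x, ‖x‖ₑ ^ 2 ∂m < ⊤}

instance instIsProbabilityMeasureP2 {d : ℕ} (m : P2 d) : IsProbabilityMeasure m.1 := m.2.1

/-- Borel measures on `ℝ^d × ℝ^d` with marginals `m` and `ν`. -/
def couplings {d : ℕ} (m ν : P2 d) : Set (Measure (E d × E d)) :=
  {γ | γ.map Prod.fst = m.1 ∧ γ.map Prod.snd = ν.1}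

/-- The quadratic Wasserstein distance. -/
def W2 {d : ℕ} (m ν : P2 d) : ℝ :=
  Real.sqrt (sInf ((fun γ : Measure (E d × E d) => ∫ z, ‖z.1 - z.2‖ ^ 2 ∂γ) '' couplings m ν))

/-- The optimal plans between `m` and `ν`. -/
def optimalPlans {d : ℕ} (m ν : P2 d) : Set (Measure (E d × E d)) :=
  {γ | γ ∈ couplings m ν ∧ W2 m ν ^ 2 = ∫ z, ‖z.1 - z.2‖ ^ 2 ∂γ}

/-- The neighbourhood filter of `m` for the Wasserstein distance. -/
def wNhds {d : ℕ} (m : P2 d) : Filter (P2 d) := (𝓝 (0 : ℝ)).comap (W2 m)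

/-! ### First order calculus -/

/-- The Hilbert space `L²(m)` of vector fields. -/
abbrev L2 {d : ℕ} (m : P2 d) := Lp (E d) 2 m.1

/-- The Wasserstein subdifferential:
`U[ν] - U[m] ≥ inf_{γ optimal} ∫ ζ(x)·(y-x) dγ + o(W₂(m,ν))`.
(The infimum is over a nonempty family of reals bounded by `‖ζ‖ W₂(m,ν)`.) -/
def subdifferential {d : ℕ} (U : P2 d → ℝ) (m : P2 d) : Set (L2 m) :=
  {ζ | ∀ η : ℝ, 0 < η → ∀ᶠ ν in wNhds m,
    (⨅ γ : optimalPlans m ν, ∫ z, inner ℝ (ζ z.1) (z.2 - z.1) ∂(γ : Measure (E d × E d)))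
      - η * W2 m ν ≤ U ν - U m}

/-- The Wasserstein superdifferential. -/
def superdifferential {d : ℕ} (U : P2 d → ℝ) (m : P2 d) : Set (L2 m) :=
  {ζ | -ζ ∈ subdifferential (fun ν => -U ν) m}

/-- `g` is the element of minimal norm of the subdifferential. -/
def IsWGradient {d : ℕ} (U : P2 d → ℝ) (m : P2 d) (g : L2 m) : Prop :=
  g ∈ subdifferential U m ∧ ∀ η ∈ subdifferential U m, ‖g‖ ≤ ‖η‖

/-- Differentiability: the sub- and superdifferential are both nonempty (and the element of
minimal norm, the Wasserstein gradient, exists). -/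
def WDifferentiableAt {d : ℕ} (U : P2 d → ℝ) (m : P2 d) : Prop :=
  (subdifferential U m).Nonempty ∧ (superdifferential U m).Nonempty ∧ ∃ g, IsWGradient U m g

/-- The Wasserstein gradient `∇_w U[m]`. -/
def wGrad {d : ℕ} (U : P2 d → ℝ) (m : P2 d) : L2 m :=
  Classical.epsilon (fun g => IsWGradient U m g)

/-- The derivative `ζ · (U[m]) = ⟨∇_w U[m], ζ⟩_m` of `U` at `m` along the vector field `ζ`. -/
def dirDeriv {d : ℕ} (U : P2 d → ℝ) (m : P2 d) (ζ : E d → E d) : ℝ :=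
  ∫ x, inner ℝ (wGrad U m x) (ζ x) ∂m.1

/-! ### Second order calculus -/

/-- Smooth functions of compact support. -/
def IsTest {d : ℕ} {F : Type} [NormedAddCommGroup F] [NormedSpace ℝ F] (f : E d → F) : Prop :=
  ContDiff ℝ ((⊤ : ℕ∞) : WithTop ℕ∞) f ∧ HasCompactSupport f

/-- The tangent space at `m`: the closure in `L²(m)` of the gradients of test functions. -/
def tangent {d : ℕ} (m : P2 d) : Submodule ℝ (L2 m) :=
  (Submodule.span ℝ
    {f : L2 m | ∃ φ : E d → ℝ, IsTest φ ∧ f =ᵐ[m.1] gradient φ}).topologicalClosure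

/-- `ζ₁·(ζ₂·(U[m])) - (∇ζ₂ ζ₁)·(U[m])`. -/
def barHess {d : ℕ} (U : P2 d → ℝ) (m : P2 d) (ζ₁ ζ₂ : E d → E d) : ℝ :=
  dirDeriv (fun ν => dirDeriv U ν ζ₂) m ζ₁ - dirDeriv U m (fun x => fderiv ℝ ζ₂ x (ζ₁ x))

/-- `U` has the Hessian `B` at `m`: `U` is differentiable near `m`, `ν ↦ ζ·(U[ν])` is
differentiable at `m` for every test field `ζ`, and the bounded bilinear form `B` on the tangent
space extends `barHess`. -/
def HasHessian {d : ℕ} (U : P2 d → ℝ) (m : P2 d)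
    (B : tangent m →L[ℝ] tangent m →L[ℝ] ℝ) : Prop :=
  (∀ᶠ ν in wNhds m, WDifferentiableAt U ν) ∧
  (∀ ζ : E d → E d, IsTest ζ → WDifferentiableAt (fun ν => dirDeriv U ν ζ) m) ∧
  ∀ φ ψ : E d → ℝ, IsTest φ → IsTest ψ → ∀ u v : tangent m,
    (u : L2 m) =ᵐ[m.1] gradient φ → (v : L2 m) =ᵐ[m.1] gradient ψ →
      B u v = barHess U m (gradient φ) (gradient ψ)

/-- Concave moduli on `[0,∞)`. -/
def IsConcaveModulus (ρ : ℝ → ℝ) : Prop :=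
  ρ 0 = 0 ∧ ContinuousOn ρ (Ici 0) ∧ MonotoneOn ρ (Ici 0) ∧ ConcaveOn ℝ (Ici 0) ρ ∧
    ∀ s t : ℝ, 0 ≤ s → 0 ≤ t → ρ (s + t) ≤ ρ s + ρ t

/-- `U` is twice differentiable at every point of the Wasserstein space, with first derivative
`A m x = ∇_w U[m](x)`, and second derivatives `D m x = ∇(∇_w U[m])(x)` and
`H m x y = ∇_w² U[m](x, y)`. -/
structure IsTwiceDifferentiable {d : ℕ} (U : P2 d → ℝ) (A : P2 d → E d → E d)
    (D : P2 d → E d → E d →L[ℝ] E d) (H : P2 d → E d → E d → E d →L[ℝ] E d) : Prop where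
  differentiable : ∀ m, WDifferentiableAt U m
  gradient : ∀ m, ∃ h : MemLp (A m) 2 m.1, IsWGradient U m (h.toLp (A m))
  continuous : ∀ m, Continuous (A m)
  growth : ∀ m, ∃ C : ℝ, ∀ᶠ ν in wNhds m, ∀ x, ‖A ν x‖ ≤ C * (1 + ‖x‖)
  measurable_D : ∀ m, Measurable (D m)
  bounded_D : ∀ m, ∃ C : ℝ, ∀ x, ‖D m x‖ ≤ C
  measurable_H : ∀ m, Measurable (fun p : E d × E d => H m p.1 p.2)
  bounded_H : ∀ m, ∃ C : ℝ, ∀ x y, ‖H m x y‖ ≤ C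
  /-- The rows of `H m x ·` are tangent vectors. -/
  tangent_H : ∀ m x, ∀ e : E d, ∃ f ∈ tangent m,
    f =ᵐ[m.1] fun y => ContinuousLinearMap.adjoint (H m x y) e
  expansion : ∀ m, ∃ ρ ε₂ : ℝ → ℝ, IsConcaveModulus ρ ∧ (∀ t, 0 ≤ ε₂ t) ∧
    Tendsto ε₂ (𝓝[>] 0) (𝓝 0) ∧
    ∀ ν : P2 d, ∀ γ ∈ optimalPlans m ν, ∀ x y : E d,
      ‖A ν y - A m x - (D m x (y - x) + ∫ z, H m x z.1 (z.2 - z.1) ∂γ)‖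
        ≤ ‖x - y‖ * ρ ‖x - y‖ + W2 m ν * ε₂ (W2 m ν)

/-- Twice continuously differentiable real functions on the Wasserstein space. -/
def IsC2Real {d : ℕ} (U : P2 d → ℝ) : Prop :=
  ∃ A D H, IsTwiceDifferentiable U A D H ∧
    (∀ m x, Tendsto (fun p : E d × P2 d => D p.2 p.1) (𝓝 x ×ˢ wNhds m) (𝓝 (D m x))) ∧
    (∀ m x y, Tendsto (fun p : (E d × E d) × P2 d => H p.2 p.1.1 p.1.2)
      ((𝓝 x ×ˢ 𝓝 y) ×ˢ wNhds m) (𝓝 (H m x y)))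

/-- `L` is the value at `m` of the `ε`-perturbed Wasserstein Laplacian of the twice differentiable
function `U`: `L = ∑ᵢ (Hess U[m](ζᵢ, ζᵢ) + ε ∫ ⟨∇(∇_w U[m]) ζᵢ, ζᵢ⟩ dm)`, where `ζᵢ` is the
Wasserstein gradient of the `i`-th moment. -/
def HasWLaplacianReal {d : ℕ} (ε : ℝ) (U : P2 d → ℝ) (m : P2 d) (L : ℝ) : Prop :=
  ∃ A D H, IsTwiceDifferentiable U A D H ∧
  ∃ B : tangent m →L[ℝ] tangent m →L[ℝ] ℝ, HasHessian U m B ∧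
  ∃ ζ : Fin d → tangent m,
    (∀ i, (ζ i : L2 m) = wGrad (fun ν : P2 d => ∫ x, x i ∂ν.1) m) ∧
    L = ∑ i, (B (ζ i) (ζ i) +
      ε * ∫ x, inner ℝ (D m x ((ζ i : L2 m) x)) ((ζ i : L2 m) x) ∂m.1)

/-- Twice continuous differentiability of complex functions: real and imaginary parts. -/
def IsC2 {d : ℕ} (U : P2 d → ℂ) : Prop :=
  IsC2Real (fun m => (U m).re) ∧ IsC2Real (fun m => (U m).im)

/-- The Laplacian of complex functions: real and imaginary parts. -/
def HasWLaplacian {d : ℕ} (ε : ℝ) (U : P2 d → ℂ) (m : P2 d) (L : ℂ) : Prop :=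
  HasWLaplacianReal ε (fun ν => (U ν).re) m L.re ∧ HasWLaplacianReal ε (fun ν => (U ν).im) m L.im

/-! ### Fourier series on the Wasserstein space -/

/-- `Φ^k_ξ(x) = (1/k!) ∑_σ exp(-2πi ∑_j ⟨ξ_{σ(j)}, x_j⟩)`. -/
def Phi {d : ℕ} (k : ℕ) (ξ x : Fin k → E d) : ℂ :=
  (1 / (k.factorial : ℂ)) * ∑ σ : Equiv.Perm (Fin k),
    Complex.exp (-(2 * Real.pi * Complex.I * ((∑ j, inner ℝ (ξ (σ j)) (x j) : ℝ) : ℂ)))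

/-- `F^k_ξ[m] = (1/k) ∫ Φ^k_ξ(x) m(dx₁)⋯m(dx_k)`. -/
def F {d : ℕ} (k : ℕ) (ξ : Fin k → E d) (m : P2 d) : ℂ :=
  (1 / (k : ℂ)) * ∫ x, Phi k ξ x ∂(Measure.pi fun _ : Fin k => m.1)

/-- `λ²_{k,ε}(ξ) = 4π² (|∑ ξ_j|² + ε ∑ |ξ_j|²)`; `λ²_k = λ²_{k,0}`. -/
def lamSq {d : ℕ} (k : ℕ) (ε : ℝ) (ξ : Fin k → E d) : ℝ :=
  4 * Real.pi ^ 2 * (‖∑ j, ξ j‖ ^ 2 + ε * ∑ j, ‖ξ j‖ ^ 2)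

/-- Sequences `(a_k)` of functions on `(ℝ^d)^k`. Only the entries with `k ≥ 1` are ever used. -/
abbrev Coeff (d : ℕ) : Type := ∀ k : ℕ, (Fin k → E d) → ℂ

/-- The class `𝒜^s`: symmetric Borel functions with
`∑_{k ≥ 1} (1/k!) ∫ |a_k|² (1 + λ_k²)^s dξ < ∞`. -/
def MemA {d : ℕ} (s : ℝ) (a : Coeff d) : Prop :=
  (∀ k, 1 ≤ k → Measurable (a k) ∧
    ∀ (σ : Equiv.Perm (Fin k)) (ξ : Fin k → E d), a k (fun j => ξ (σ j)) = a k ξ) ∧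
  ∑' n : ℕ, ENNReal.ofReal (1 / ((n + 1).factorial : ℝ)) *
    ∫⁻ ξ, ‖a (n + 1) ξ‖ₑ ^ 2 * ENNReal.ofReal ((1 + lamSq (n + 1) 0 ξ) ^ s) < ⊤

/-- The term `(1/k!) ∫ a_k(ξ) F^k_ξ[m] dξ`. -/
def term {d : ℕ} (a : Coeff d) (k : ℕ) (m : P2 d) : ℂ :=
  (1 / (k.factorial : ℂ)) * ∫ ξ, a k ξ * F k ξ m

/-- The partial sum over `1 ≤ k ≤ N`. -/
def partialSum {d : ℕ} (a : Coeff d) (N : ℕ) (m : P2 d) : ℂ :=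
  ∑ k ∈ Finset.Icc 1 N, term a k m

/-- The sum over all `k ≥ 1`. -/
def series {d : ℕ} (a : Coeff d) (m : P2 d) : ℂ := ∑' n : ℕ, term a (n + 1) m

/-- The space `H^s` of functions on the Wasserstein space. -/
def MemH {d : ℕ} (s : ℝ) (G : P2 d → ℂ) : Prop :=
  ∃ a : Coeff d, MemA s a ∧
    (∀ k, 1 ≤ k → ∀ m : P2 d, Integrable (fun ξ => a k ξ * F k ξ m)) ∧
    ∀ m, Tendsto (fun N => partialSum a N m) atTop (𝓝 (G m))

/-- `∫ |a_k| dξ ≤ C k! / k^p` for all `k ≥ 1`. -/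
def L1Bound {d : ℕ} (a : Coeff d) (C p : ℝ) : Prop :=
  ∀ k : ℕ, 1 ≤ k → ∫⁻ ξ, ‖a k ξ‖ₑ ≤ ENNReal.ofReal (C * k.factorial / (k : ℝ) ^ p)

/-- The moment bounds: those on `|a_k||ξ₁|`, `|a_k||ξ₁|²`, `|a_k||ξ₁|³` for `k ≥ 1`, and those on
`|a_k||ξ₁||ξ₂|`, `|a_k||ξ₁|²|ξ₂|` for `k ≥ 2`. -/
def MomentBounds {d : ℕ} (a : Coeff d) (C δ : ℝ) : Prop :=
  (∀ (k : ℕ) (i : Fin k), (i : ℕ) = 0 →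
    ∫⁻ ξ, ‖a k ξ‖ₑ * ‖ξ i‖ₑ ≤ ENNReal.ofReal (C * k.factorial / (k : ℝ) ^ (1 + δ)) ∧
    ∫⁻ ξ, ‖a k ξ‖ₑ * ‖ξ i‖ₑ ^ 2 ≤ ENNReal.ofReal (C * k.factorial / (k : ℝ) ^ (1 + δ)) ∧
    ∫⁻ ξ, ‖a k ξ‖ₑ * ‖ξ i‖ₑ ^ 3 ≤ ENNReal.ofReal (C * k.factorial / (k : ℝ) ^ (1 + δ))) ∧
  (∀ (k : ℕ) (i j : Fin k), (i : ℕ) = 0 → (j : ℕ) = 1 →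
    ∫⁻ ξ, ‖a k ξ‖ₑ * ‖ξ i‖ₑ * ‖ξ j‖ₑ ≤ ENNReal.ofReal (C * k.factorial / (k : ℝ) ^ (2 + δ)) ∧
    ∫⁻ ξ, ‖a k ξ‖ₑ * ‖ξ i‖ₑ ^ 2 * ‖ξ j‖ₑ
      ≤ ENNReal.ofReal (C * k.factorial / (k : ℝ) ^ (3 + δ)))

/-- `b_k(t, ξ) = a_k(ξ) exp(-β λ²_{k,ε/β}(ξ) t)`. -/
def evolve {d : ℕ} (a : Coeff d) (β ε t : ℝ) : Coeff d :=
  fun k ξ => a k ξ * (Real.exp (-(β * lamSq k (ε / β) ξ * t)) : ℂ)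

/-! ### The stochastic flow -/

/-- Standard `d`-dimensional Brownian motion starting at the origin. -/
def IsStandardBrownian {d : ℕ} {Ω : Type*} [MeasurableSpace Ω] (W : ℝ≥0 → Ω → E d)
    (P : Measure Ω) : Prop :=
  (∀ i, IsBrownianReal (fun t ω => W t ω i) P) ∧
  iIndepFun (fun (i : Fin d) (ω : Ω) (t : ℝ≥0) => W t ω i) P

/-- The heat kernel of `∂_t u = ε Δ u`. -/
def heatKernel (d : ℕ) (ε t : ℝ) (z : E d) : ℝ :=
  1 / Real.sqrt (4 * Real.pi * ε * t) ^ d * Real.exp (-(‖z‖ ^ 2 / (4 * ε * t)))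

lemma heatKernel_eq (d : ℕ) (ε t : ℝ) (z : E d) :
    heatKernel d ε t z = 1 / Real.sqrt (4 * Real.pi * ε * t) ^ d *
      Real.exp (-(1 / (4 * ε * t)) * ‖z‖ ^ 2) := by
  unfold heatKernel
  congr 2
  ring

lemma integrable_exp_neg_sq (d : ℕ) {b : ℝ} (hb : 0 < b) :
    Integrable (fun z : E d => Real.exp (-b * ‖z‖ ^ 2)) := by
  have h := (GaussianFourier.integrable_cexp_neg_mul_sq_norm_add (V := E d) (b := (b : ℂ))
    (by simpa using hb) 0 0).re
  refine h.congr (Filter.Eventually.of_forall fun z => ?_)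
  have : (-(b : ℂ) * (‖z‖ : ℂ) ^ 2 + 0 * (inner ℝ (0 : E d) z : ℂ)) =
      ((-b * ‖z‖ ^ 2 : ℝ) : ℂ) := by push_cast; ring
  simp only [this]
  exact Complex.exp_ofReal_re _

lemma heatKernel_isProb (d : ℕ) {ε t : ℝ} (h : 0 < ε ∧ 0 < t) :
    IsProbabilityMeasure
      ((volume : Measure (E d)).withDensity fun z => ENNReal.ofReal (heatKernel d ε t z)) := by
  obtain ⟨hε, ht⟩ := h
  have hb : 0 < 1 / (4 * ε * t) := by positivity
  refine ⟨?_⟩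
  rw [withDensity_apply _ MeasurableSet.univ, Measure.restrict_univ]
  simp_rw [heatKernel_eq]
  rw [← ofReal_integral_eq_lintegral_ofReal ((integrable_exp_neg_sq d hb).const_mul _)
    (Filter.Eventually.of_forall fun z => by positivity), integral_const_mul,
    GaussianFourier.integral_rexp_neg_mul_sq_norm hb, ENNReal.ofReal_eq_one]
  have hx : Real.pi / (1 / (4 * ε * t)) = 4 * Real.pi * ε * t := by field_simp
  have hp : 0 < 4 * Real.pi * ε * t := by positivity
  rw [hx, finrank_euclideanSpace_fin, Real.sqrt_eq_rpow, ← Real.rpow_natCast,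
    ← Real.rpow_mul hp.le, show (1 / 2 * (d : ℝ)) = (d : ℝ) / 2 by ring]
  exact one_div_mul_cancel (Real.rpow_pos_of_pos hp _).ne'

lemma heatKernel_moment (d : ℕ) {ε t : ℝ} (h : 0 < ε ∧ 0 < t) :
    ∫⁻ x, ‖x‖ₑ ^ 2
      ∂((volume : Measure (E d)).withDensity fun z => ENNReal.ofReal (heatKernel d ε t z)) < ⊤ := by
  obtain ⟨hε, ht⟩ := h
  set b : ℝ := 1 / (4 * ε * t) with hb'
  have hb : 0 < b := by positivity
  set c : ℝ := 1 / Real.sqrt (4 * Real.pi * ε * t) ^ d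
  have hc : 0 ≤ c := by positivity
  have hm : Measurable fun z : E d => ENNReal.ofReal (heatKernel d ε t z) := by
    unfold heatKernel; fun_prop
  rw [lintegral_withDensity_eq_lintegral_mul _ hm (by fun_prop)]
  have hi := ((integrable_exp_neg_sq d (half_pos hb)).const_mul (c * (2 / b))).lintegral_lt_top
  refine lt_of_le_of_lt (lintegral_mono fun z => ?_) hi
  simp only [Pi.mul_apply]
  rw [← ofReal_norm, ← ENNReal.ofReal_pow (norm_nonneg _),
    ← ENNReal.ofReal_mul (by unfold heatKernel; positivity)]
  apply ENNReal.ofReal_le_ofReal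
  rw [heatKernel_eq]
  have h1 : b / 2 * ‖z‖ ^ 2 ≤ Real.exp (b / 2 * ‖z‖ ^ 2) :=
    (by linarith [Real.add_one_le_exp (b / 2 * ‖z‖ ^ 2)])
  have h2 : Real.exp (-b * ‖z‖ ^ 2) * Real.exp (b / 2 * ‖z‖ ^ 2) =
      Real.exp (-(b / 2) * ‖z‖ ^ 2) := by
    rw [← Real.exp_add]; congr 1; ring
  calc c * Real.exp (-b * ‖z‖ ^ 2) * ‖z‖ ^ 2
      = c * (2 / b) * (Real.exp (-b * ‖z‖ ^ 2) * (b / 2 * ‖z‖ ^ 2)) := by field_simp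
    _ ≤ c * (2 / b) * (Real.exp (-b * ‖z‖ ^ 2) * Real.exp (b / 2 * ‖z‖ ^ 2)) := by gcongr
    _ = c * (2 / b) * Real.exp (-(b / 2) * ‖z‖ ^ 2) := by rw [h2]

/-- The law `G^ε_t(z) dz`, which for `ε = 0` is the Dirac mass at the origin. -/
def heatLaw (d : ℕ) (ε t : ℝ) : P2 d :=
  if h : 0 < ε ∧ 0 < t then
    ⟨volume.withDensity fun z => ENNReal.ofReal (heatKernel d ε t z),
      heatKernel_isProb d h, heatKernel_moment d h⟩
  else ⟨Measure.dirac 0, inferInstance, by simp⟩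

lemma enorm_add_sq_le {d : ℕ} (x y : E d) : ‖x + y‖ₑ ^ 2 ≤ 2 * ‖x‖ₑ ^ 2 + 2 * ‖y‖ₑ ^ 2 := by
  simp only [← ofReal_norm, ← ENNReal.ofReal_pow (norm_nonneg _)]
  have h2 : ∀ r : ℝ, 2 * ENNReal.ofReal r = ENNReal.ofReal (2 * r) := fun r => by
    rw [ENNReal.ofReal_mul (by norm_num)]; simp
  rw [h2, h2, ← ENNReal.ofReal_add (by positivity) (by positivity)]
  apply ENNReal.ofReal_le_ofReal
  have h := norm_add_le x y
  nlinarith [sq_nonneg (‖x‖ - ‖y‖), norm_nonneg (x + y), norm_nonneg x, norm_nonneg y]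

lemma conv_moment {d : ℕ} (μ ν : P2 d) : ∫⁻ x, ‖x‖ₑ ^ 2 ∂(μ.1.conv ν.1) < ⊤ := by
  rw [Measure.lintegral_conv (by fun_prop)]
  have h : ∀ x : E d, ∫⁻ y, ‖x + y‖ₑ ^ 2 ∂ν.1 ≤ 2 * ‖x‖ₑ ^ 2 + 2 * ∫⁻ y, ‖y‖ₑ ^ 2 ∂ν.1 := by
    intro x
    refine (lintegral_mono fun y => enorm_add_sq_le x y).trans ?_
    rw [lintegral_add_left (by fun_prop)]
    simp only [lintegral_const, measure_univ, mul_one]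
    rw [lintegral_const_mul 2 (by fun_prop)]
  refine (lintegral_mono h).trans_lt ?_
  rw [lintegral_add_left (by fun_prop), lintegral_const_mul _ (by fun_prop)]
  simp only [lintegral_const, measure_univ, mul_one]
  exact ENNReal.add_lt_top.2 ⟨ENNReal.mul_lt_top (by simp) μ.2.2, ENNReal.mul_lt_top (by simp) ν.2.2⟩

/-- The convolution of two elements of the Wasserstein space. -/
def P2.conv {d : ℕ} (μ ν : P2 d) : P2 d :=
  ⟨μ.1.conv ν.1, inferInstance, conv_moment μ ν⟩

lemma translate_moment {d : ℕ} (m : P2 d) (w : E d) :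
    ∫⁻ x, ‖x‖ₑ ^ 2 ∂(m.1.map fun x => x + w) < ⊤ := by
  rw [lintegral_map (by fun_prop) (by fun_prop)]
  refine (lintegral_mono fun x => enorm_add_sq_le x w).trans_lt ?_
  rw [lintegral_add_left (by fun_prop), lintegral_const_mul _ (by fun_prop)]
  simp only [lintegral_const, measure_univ, mul_one]
  exact ENNReal.add_lt_top.2 ⟨ENNReal.mul_lt_top (by simp) m.2.2,
    ENNReal.mul_lt_top (by simp) (by simp)⟩

/-- The push-forward `(id + w)_# m`. -/
def P2.translate {d : ℕ} (m : P2 d) (w : E d) : P2 d :=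
  ⟨m.1.map fun x => x + w, Measure.isProbabilityMeasure_map (by fun_prop), translate_moment m w⟩

/-- `σ^{ε,β}_t[m] = (id + √(2β) W_t)_# (G^ε_t * m)`, as a function of the value `w` of `W_t`. -/
def sigma {d : ℕ} (β ε t : ℝ) (m : P2 d) (w : E d) : P2 d :=
  ((heatLaw d ε t).conv m).translate (Real.sqrt (2 * β) • w)

end

end WassersteinHeat

open WassersteinHeat

/-! With η_j = 2πξ_j (`freq`), the function F^k_ξ[m] is 1/k times the product of the Fourier
transforms of m at η_1, …, η_k, because a product measure with equal factors is invariant under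
permutations (`F_eq`). Two properties of such products carry the theorem.

Flow. Convolution with the heat kernel multiplies the j-th factor by exp(-εt|η_j|²). The random
translation is common to all factors, so it multiplies the whole product by one plane wave of
frequency √(2β)Ση_j, whose Gaussian mean is exp(-βt|Ση_j|²). The total factor is exp(-βλ²t) with λ²
= `lamSq k (ε / β) ξ` (`IsStandardBrownian.integral_ftProd_sigma`). Since |F^k_ξ| ≤ 1/k, the L¹
bound on a_k dominates the terms by C/k^{1+δ}; this gives uniform convergence and justifies Fubini
in `IsStandardBrownian.integral_series_sigma`. The exponential absorbs every power of 1 + λ_k²,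
hence membership in all spaces H^l (`MemA.evolve`).

Derivatives. A product of Fourier transforms is an eigenfunction of the perturbed Laplacian with
eigenvalue -λ² (`traceLaplacian_prod`), so the Laplacian and the time derivative agree term by term.
What remains is to differentiate the superposition in the required strong sense. `HasUniformDerivs`
collects first and second derivatives with bounds, Lipschitz constants and second order errors
controlled by one number M. Its conditions are linear inequalities and tangency statements, so they
survive superposition as soon as M is integrable (`HasUniformDerivs.integral`); this is applied to
Lebesgue measure in ξ and to counting measure in k. A single product has M = 3|c|(1+Σ|η_j|)³, so the
series is twice continuously differentiable if the integrals of |a_k|(1+Σ|η_j|)³/(k·k!) are summable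
in k (`IsSmoothCoeff`). Under the moment bounds this follows by expanding the cube and using
symmetry; if ε > 0, the Gaussian factor at a positive time beats the cube.

Wasserstein calculus. An expansion with quadratic error along all couplings puts the candidate
gradient g in the subdifferential. That g is the element of minimal norm follows from testing along
ν_t = (id + t∇φ)_# m: for small t the optimal plan is unique, so the infimum over plans disappears,
and every other subgradient differs from g by a field orthogonal to the tangent space
(`HasQuadExpansion.inner_sub_eq_zero`). As g is tangent, Pythagoras concludes. The same criterion
applied to ν ↦ ζ·(U[ν]) yields the Hessian (`HasUniformDerivs.barHess_eq`), whose values on the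
constant fields e_i add up to traces. -/

namespace WassersteinHeat

noncomputable section

/-! ### Couplings and optimal plans -/

/-- The quadratic transport cost of a plan. -/
def cost {d : ℕ} (γ : Measure (E d × E d)) : ℝ := ∫ z, ‖z.1 - z.2‖ ^ 2 ∂γ

lemma cost_nonneg {d : ℕ} (γ : Measure (E d × E d)) : 0 ≤ cost γ :=
  integral_nonneg fun _ => by positivity

lemma memLp_id {d : ℕ} (m : P2 d) : MemLp (fun x : E d => x) 2 m.1 := by
  refine ⟨aestronglyMeasurable_id, ?_⟩
  rw [eLpNorm_lt_top_iff_lintegral_rpow_enorm_lt_top (by norm_num) (by norm_num)]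
  simpa using m.2.2

section Coupling

variable {d : ℕ} {m ν : P2 d} {γ : Measure (E d × E d)}

lemma isProbabilityMeasure_of_mem_couplings (h : γ ∈ couplings m ν) :
    IsProbabilityMeasure γ := by
  refine ⟨?_⟩
  have h1 : (γ.map Prod.fst) univ = 1 := by rw [h.1]; exact measure_univ
  rwa [Measure.map_apply measurable_fst MeasurableSet.univ, preimage_univ] at h1

lemma measurePreserving_fst_of_mem_couplings (h : γ ∈ couplings m ν) :
    MeasurePreserving Prod.fst γ m.1 := ⟨measurable_fst, h.1⟩

lemma measurePreserving_snd_of_mem_couplings (h : γ ∈ couplings m ν) :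
    MeasurePreserving Prod.snd γ ν.1 := ⟨measurable_snd, h.2⟩

lemma memLp_sub_of_mem_couplings (h : γ ∈ couplings m ν) :
    MemLp (fun z : E d × E d => z.2 - z.1) 2 γ :=
  ((memLp_id ν).comp_measurePreserving (measurePreserving_snd_of_mem_couplings h)).sub
    ((memLp_id m).comp_measurePreserving (measurePreserving_fst_of_mem_couplings h))

lemma integrable_normSq_of_mem_couplings (h : γ ∈ couplings m ν) :
    Integrable (fun z : E d × E d => ‖z.2 - z.1‖ ^ 2) γ :=
  (memLp_sub_of_mem_couplings h).integrable_norm_pow (by norm_num)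

lemma integrable_sub_of_mem_couplings (h : γ ∈ couplings m ν) :
    Integrable (fun z : E d × E d => z.2 - z.1) γ :=
  have := isProbabilityMeasure_of_mem_couplings h
  (memLp_sub_of_mem_couplings h).integrable (by norm_num)

lemma integrable_norm_sub_of_mem_couplings (h : γ ∈ couplings m ν) :
    Integrable (fun z : E d × E d => ‖z.2 - z.1‖) γ :=
  (integrable_sub_of_mem_couplings h).norm

lemma cost_eq (γ : Measure (E d × E d)) : cost γ = ∫ z, ‖z.2 - z.1‖ ^ 2 ∂γ := by
  simp only [cost, norm_sub_rev]

/-- Jensen's inequality, read off from the nonnegativity of the variance of ‖z.2 - z.1‖. -/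
lemma integral_norm_sub_le_sqrt_cost (h : γ ∈ couplings m ν) :
    ∫ z, ‖z.2 - z.1‖ ∂γ ≤ √(cost γ) := by
  have := isProbabilityMeasure_of_mem_couplings h
  apply Real.le_sqrt_of_sq_le
  set c := ∫ z, ‖z.2 - z.1‖ ∂γ
  have h1 : 0 ≤ ∫ z, (‖z.2 - z.1‖ - c) ^ 2 ∂γ := integral_nonneg fun _ => by positivity
  have h2 : ∫ z, (‖z.2 - z.1‖ - c) ^ 2 ∂γ = cost γ - 2 * c * c + c ^ 2 := by
    have : ∀ z : E d × E d, (‖z.2 - z.1‖ - c) ^ 2 =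
        ‖z.2 - z.1‖ ^ 2 - 2 * c * ‖z.2 - z.1‖ + c ^ 2 := fun z => by ring
    simp_rw [this]
    rw [integral_add, integral_sub, integral_const_mul, cost_eq]
    · simp [c]
    · exact integrable_normSq_of_mem_couplings h
    · exact (integrable_norm_sub_of_mem_couplings h).const_mul _
    · exact (integrable_normSq_of_mem_couplings h).sub
        ((integrable_norm_sub_of_mem_couplings h).const_mul _)
    · exact integrable_const _
  nlinarith

lemma prod_mem_couplings (m ν : P2 d) : m.1.prod ν.1 ∈ couplings m ν :=
  ⟨by rw [← Measure.fst, Measure.fst_prod], by rw [← Measure.snd, Measure.snd_prod]⟩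

lemma W2_nonneg (m ν : P2 d) : 0 ≤ W2 m ν := Real.sqrt_nonneg _

lemma W2_sq_eq (m ν : P2 d) : W2 m ν ^ 2 = sInf (cost '' couplings m ν) :=
  Real.sq_sqrt (Real.sInf_nonneg (by rintro _ ⟨γ, _, rfl⟩; exact cost_nonneg γ))

lemma W2_sq_le_cost (h : γ ∈ couplings m ν) : W2 m ν ^ 2 ≤ cost γ := by
  rw [W2_sq_eq]
  exact csInf_le ⟨0, by rintro _ ⟨γ, _, rfl⟩; exact cost_nonneg γ⟩ ⟨γ, h, rfl⟩

lemma cost_eq_of_mem_optimalPlans (h : γ ∈ optimalPlans m ν) : cost γ = W2 m ν ^ 2 := h.2.symm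

lemma sqrt_cost_of_mem_optimalPlans (h : γ ∈ optimalPlans m ν) : √(cost γ) = W2 m ν := by
  rw [cost_eq_of_mem_optimalPlans h, Real.sqrt_sq (W2_nonneg m ν)]

lemma mem_optimalPlans_of_forall_cost_le (h : γ ∈ couplings m ν)
    (hmin : ∀ γ' ∈ couplings m ν, cost γ ≤ cost γ') : γ ∈ optimalPlans m ν := by
  refine ⟨h, le_antisymm (W2_sq_le_cost h) ?_⟩
  rw [W2_sq_eq]
  exact le_csInf ⟨_, γ, h, rfl⟩ (by rintro _ ⟨γ', h', rfl⟩; exact hmin γ' h')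

/-- Prokhorov: the marginal constraints are closed under weak convergence, and a set of plans is
tight when its two sets of marginals are, here singletons. -/
lemma isCompact_couplings (m ν : P2 d) :
    IsCompact {μ : ProbabilityMeasure (E d × E d) | (μ : Measure (E d × E d)) ∈ couplings m ν} := by
  set S := {μ : ProbabilityMeasure (E d × E d) | (μ : Measure (E d × E d)) ∈ couplings m ν}
  have hclosed : IsClosed S := by
    have h1 : Continuous fun μ : ProbabilityMeasure (E d × E d) =>
        μ.map measurable_fst.aemeasurable := ProbabilityMeasure.continuous_map continuous_fst
    have h2 : Continuous fun μ : ProbabilityMeasure (E d × E d) =>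
        μ.map measurable_snd.aemeasurable := ProbabilityMeasure.continuous_map continuous_snd
    let pm : ProbabilityMeasure (E d) := ⟨m.1, inferInstance⟩
    let pν : ProbabilityMeasure (E d) := ⟨ν.1, inferInstance⟩
    have : S = (fun μ : ProbabilityMeasure (E d × E d) => μ.map measurable_fst.aemeasurable) ⁻¹'
          {pm} ∩
        (fun μ : ProbabilityMeasure (E d × E d) => μ.map measurable_snd.aemeasurable) ⁻¹'
          {pν} := by
      ext μ
      exact and_congr (Subtype.ext_iff (a1 := μ.map measurable_fst.aemeasurable) (a2 := pm)).symm
        (Subtype.ext_iff (a1 := μ.map measurable_snd.aemeasurable) (a2 := pν)).symm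
    rw [this]
    exact (isClosed_singleton.preimage h1).inter (isClosed_singleton.preimage h2)
  rw [← hclosed.closure_eq]
  apply isCompact_closure_of_isTightMeasureSet
  apply IsTightMeasureSet.prodMk
  · refine (isTightMeasureSet_singleton (μ := m.1)).subset ?_
    rintro _ ⟨_, ⟨μ, hμ, rfl⟩, rfl⟩
    exact hμ.1
  · refine (isTightMeasureSet_singleton (μ := ν.1)).subset ?_
    rintro _ ⟨_, ⟨μ, hμ, rfl⟩, rfl⟩
    exact hμ.2

/-- The transport cost truncated at level `n`. -/
def truncatedCost (d n : ℕ) : BoundedContinuousFunction (E d × E d) ℝ :=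
  BoundedContinuousFunction.ofNormedAddCommGroup (fun z => min (‖z.1 - z.2‖ ^ 2) (n : ℝ))
    (by fun_prop) n fun z => by
      rw [Real.norm_of_nonneg (le_min (by positivity) (by positivity))]
      exact min_le_right _ _

lemma truncatedCost_apply (d n : ℕ) (z : E d × E d) :
    truncatedCost d n z = min (‖z.1 - z.2‖ ^ 2) (n : ℝ) := rfl

/-- Dominated convergence. The supremum form makes the cost lower semicontinuous for weak
convergence, which provides a minimiser on the compact set of couplings. -/
lemma iSup_truncatedCost (h : γ ∈ couplings m ν) :
    ⨆ n, ENNReal.ofReal (∫ z, truncatedCost d n z ∂γ) = ENNReal.ofReal (cost γ) := by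
  have := isProbabilityMeasure_of_mem_couplings h
  have hi : Integrable (fun z : E d × E d => ‖z.1 - z.2‖ ^ 2) γ := by
    simpa only [norm_sub_rev] using integrable_normSq_of_mem_couplings h
  apply le_antisymm
  · refine iSup_le fun n => ENNReal.ofReal_le_ofReal ?_
    exact integral_mono ((truncatedCost d n).integrable γ) hi fun z => min_le_left _ _
  · have ht : Tendsto (fun n : ℕ => ∫ z, truncatedCost d n z ∂γ) atTop (𝓝 (cost γ)) := by
      refine tendsto_integral_of_dominated_convergence (fun z => ‖z.1 - z.2‖ ^ 2)
        (fun n => (truncatedCost d n).continuous.aestronglyMeasurable) hi ?_ ?_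
      · intro n
        refine ae_of_all _ fun z => ?_
        rw [truncatedCost_apply, Real.norm_of_nonneg (le_min (by positivity) (by positivity))]
        exact min_le_left _ _
      · refine ae_of_all _ fun z => tendsto_const_nhds.congr' ?_
        obtain ⟨N, hN⟩ := exists_nat_ge (‖z.1 - z.2‖ ^ 2)
        filter_upwards [eventually_ge_atTop N] with n hn
        rw [truncatedCost_apply, min_eq_left (hN.trans (by exact_mod_cast hn))]
    exact le_of_tendsto (ENNReal.tendsto_ofReal ht)
      (Eventually.of_forall fun n => le_iSup (fun n => ENNReal.ofReal (∫ z, truncatedCost d n z ∂γ)) n)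

/-- Optimal plans exist. -/
lemma optimalPlans_nonempty (m ν : P2 d) : (optimalPlans m ν).Nonempty := by
  have hlsc : LowerSemicontinuous fun μ : ProbabilityMeasure (E d × E d) =>
      ⨆ n, ENNReal.ofReal (∫ z, truncatedCost d n z ∂(μ : Measure (E d × E d))) :=
    lowerSemicontinuous_iSup fun n => (ENNReal.continuous_ofReal.comp
      (ProbabilityMeasure.continuous_integral_boundedContinuousFunction _)).lowerSemicontinuous
  have hne : {μ : ProbabilityMeasure (E d × E d) |
      (μ : Measure (E d × E d)) ∈ couplings m ν}.Nonempty :=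
    ⟨⟨m.1.prod ν.1, inferInstance⟩, prod_mem_couplings m ν⟩
  obtain ⟨μ, hμ, hmin⟩ := LowerSemicontinuousOn.exists_isMinOn hne
    (isCompact_couplings m ν) (hlsc.lowerSemicontinuousOn _)
  refine ⟨μ, mem_optimalPlans_of_forall_cost_le hμ fun γ' h' => ?_⟩
  let μ' : ProbabilityMeasure (E d × E d) := ⟨γ', isProbabilityMeasure_of_mem_couplings h'⟩
  have hle : ⨆ n, ENNReal.ofReal (∫ z, truncatedCost d n z ∂(μ : Measure (E d × E d))) ≤
      ⨆ n, ENNReal.ofReal (∫ z, truncatedCost d n z ∂γ') := hmin (a := μ') h'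
  rw [iSup_truncatedCost hμ, iSup_truncatedCost h'] at hle
  exact (ENNReal.ofReal_le_ofReal_iff (cost_nonneg _)).1 hle

end Coupling

/-! ### Test functions -/

section Test

variable {d : ℕ} {F : Type} [NormedAddCommGroup F] [NormedSpace ℝ F]

lemma norm_sub_sub_fderiv_le {G : Type*} [NormedAddCommGroup G] [NormedSpace ℝ G]
    {f : E d → G} (hf : Differentiable ℝ f) {K : ℝ}
    (hK : ∀ x y, ‖fderiv ℝ f x - fderiv ℝ f y‖ ≤ K * ‖x - y‖) (hK0 : 0 ≤ K) (x y : E d) :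
    ‖f y - f x - fderiv ℝ f x (y - x)‖ ≤ K * ‖y - x‖ ^ 2 := by
  have h := (convex_segment x y).norm_image_sub_le_of_norm_fderiv_le' (𝕜 := ℝ) (f := f)
    (φ := fderiv ℝ f x) (C := K * ‖y - x‖) (fun z _ => hf z) (fun z hz => ?_)
    (left_mem_segment ℝ x y) (right_mem_segment ℝ x y)
  · calc _ ≤ _ := h
      _ = _ := by ring
  · refine (hK z x).trans ?_
    gcongr
    rw [segment_eq_image'] at hz
    obtain ⟨θ, hθ, rfl⟩ := hz
    rw [add_sub_cancel_left, norm_smul, Real.norm_of_nonneg hθ.1]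
    exact mul_le_of_le_one_left (norm_nonneg _) hθ.2

lemma IsTest.differentiable {f : E d → F} (hf : IsTest f) : Differentiable ℝ f :=
  hf.1.differentiable (by simp)

lemma IsTest.continuous {f : E d → F} (hf : IsTest f) : Continuous f := hf.1.continuous

lemma IsTest.fderiv {f : E d → F} (hf : IsTest f) : IsTest (fderiv ℝ f) :=
  ⟨hf.1.fderiv_right (by simp), hf.2.fderiv ℝ⟩

lemma IsTest.gradient {φ : E d → ℝ} (hφ : IsTest φ) : IsTest (gradient φ) := by
  have h := hφ.fderiv
  constructor
  · exact ((InnerProductSpace.toDual ℝ (E d)).symm.toContinuousLinearEquiv.contDiff).comp h.1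
  · exact h.2.comp_left (g := (InnerProductSpace.toDual ℝ (E d)).symm) (by simp)

lemma IsTest.exists_bound {f : E d → F} (hf : IsTest f) : ∃ C, 0 ≤ C ∧ ∀ x, ‖f x‖ ≤ C := by
  obtain ⟨C, hC⟩ := hf.2.exists_bound_of_continuous hf.continuous
  exact ⟨C, (norm_nonneg _).trans (hC 0), hC⟩

lemma IsTest.exists_lipschitz {f : E d → F} (hf : IsTest f) :
    ∃ C, 0 ≤ C ∧ ∀ x y, ‖f x - f y‖ ≤ C * ‖x - y‖ := by
  obtain ⟨C, h0, hC⟩ := hf.fderiv.exists_bound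
  exact ⟨C, h0, fun x y => convex_univ.norm_image_sub_le_of_norm_fderiv_le (𝕜 := ℝ)
    (fun z _ => hf.differentiable z) (fun z _ => hC z) (mem_univ _) (mem_univ _)⟩

lemma IsTest.exists_taylor {f : E d → F} (hf : IsTest f) :
    ∃ C, 0 ≤ C ∧ ∀ x y, ‖f y - f x - _root_.fderiv ℝ f x (y - x)‖ ≤ C * ‖y - x‖ ^ 2 := by
  obtain ⟨C, h0, hC⟩ := hf.fderiv.exists_lipschitz
  exact ⟨C, h0, norm_sub_sub_fderiv_le hf.differentiable hC h0⟩

lemma IsTest.smul {f : E d → F} (hf : IsTest f) (c : ℝ) : IsTest (fun x => c • f x) :=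
  ⟨hf.1.const_smul c, hf.2.smul_left (f := fun _ => c)⟩

lemma inner_gradient {φ : E d → ℝ} (x v : E d) :
    inner ℝ (gradient φ x) v = fderiv ℝ φ x v := by
  rw [gradient, InnerProductSpace.toDual_symm_apply]

end Test

/-! ### Perturbations of the identity -/

section Perturb

variable {d : ℕ}

lemma perturb_moment (m : P2 d) {v : E d → E d} (hv : Measurable v)
    {C : ℝ} (hC : ∀ x, ‖v x‖ ≤ C) : ∫⁻ x, ‖x‖ₑ ^ 2 ∂(m.1.map fun x => x + v x) < ⊤ := by
  rw [lintegral_map (by fun_prop) (by fun_prop)]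
  have h : ∀ x, ‖x + v x‖ₑ ^ 2 ≤ 2 * ‖x‖ₑ ^ 2 + 2 * ENNReal.ofReal C ^ 2 := fun x => by
    refine (enorm_add_sq_le x (v x)).trans ?_
    gcongr
    rw [← ofReal_norm]
    exact ENNReal.ofReal_le_ofReal (hC x)
  refine (lintegral_mono h).trans_lt ?_
  rw [lintegral_add_left (by fun_prop), lintegral_const_mul _ (by fun_prop)]
  simp only [lintegral_const, measure_univ, mul_one]
  exact ENNReal.add_lt_top.2 ⟨ENNReal.mul_lt_top (by simp) m.2.2,
    ENNReal.mul_lt_top (by simp) (by simp)⟩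

/-- The push-forward `(id + v)_# m` by a bounded perturbation of the identity. -/
def P2.perturb (m : P2 d) (v : E d → E d) (hv : Measurable v) (C : ℝ) (hC : ∀ x, ‖v x‖ ≤ C) :
    P2 d :=
  ⟨m.1.map fun x => x + v x, Measure.isProbabilityMeasure_map (by fun_prop),
    perturb_moment m hv hC⟩

lemma perturb_mem_couplings (m : P2 d) {v : E d → E d} (hv : Measurable v)
    {C : ℝ} (hC : ∀ x, ‖v x‖ ≤ C) :
    m.1.map (fun x => (x, x + v x)) ∈ couplings m (m.perturb v hv C hC) := by
  constructor <;> rw [Measure.map_map (by fun_prop) (by fun_prop)]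
  · exact Measure.map_id
  · rfl

/-- A plan which is concentrated on the graph of `id + t∇φ` is the only optimal one. -/
lemma ae_eq_of_mem_optimalPlans_perturb {φ : E d → ℝ} (hφ : IsTest φ) :
    ∃ t₀ : ℝ, 0 < t₀ ∧ ∀ t : ℝ, 0 < t → t < t₀ → ∀ (m : P2 d) (hv : Measurable (t • gradient φ))
      (C : ℝ) (hC : ∀ x, ‖(t • gradient φ) x‖ ≤ C),
      ∀ γ ∈ optimalPlans m (m.perturb (t • gradient φ) hv C hC),
        ∀ᵐ z ∂γ, z.2 = z.1 + t • gradient φ z.1 := by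
  obtain ⟨L₁, hL₁, hlip⟩ := hφ.gradient.exists_lipschitz
  obtain ⟨L₂, hL₂, htay⟩ := hφ.exists_taylor
  set L := L₁ + L₂ + 1
  -- Below this threshold t·L₁ < 1/4 makes id + t∇φ a homeomorphism, and t·L₂ < 1/4 leaves a strict
  -- gap in the duality inequality `hkey`. The summand 1 in `L` keeps it positive.
  refine ⟨1 / (4 * L), by positivity, fun t ht ht0 m hv C hC γ hγ => ?_⟩
  have htL : t * L < 1 / 4 := by
    rw [lt_div_iff₀ (by positivity)] at ht0
    linarith
  have htL₁ : t * L₁ < 1 / 4 := lt_of_le_of_lt (by gcongr; simp only [L]; linarith) htL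
  have htL₂ : t * L₂ < 1 / 4 := lt_of_le_of_lt (by gcongr; simp only [L]; linarith) htL
  -- The map id + t∇φ differs from the identity by a contraction, so it is a homeomorphism of the
  -- whole space; `S` is its inverse.
  have happ : ApproximatesLinearOn (fun x => x + (t • gradient φ) x)
      ((ContinuousLinearEquiv.refl ℝ (E d) : E d ≃L[ℝ] E d) : E d →L[ℝ] E d) univ
      (1 / 2 : ℝ≥0) := by
    intro x _ y _
    have : x + (t • gradient φ) x - (y + (t • gradient φ) y) -
        ((ContinuousLinearEquiv.refl ℝ (E d) : E d ≃L[ℝ] E d) : E d →L[ℝ] E d) (x - y) =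
        t • (gradient φ x - gradient φ y) := by
      simp only [Pi.smul_apply, ContinuousLinearEquiv.coe_coe, ContinuousLinearEquiv.refl_apply,
        smul_sub]
      abel
    rw [this, norm_smul, Real.norm_of_nonneg ht.le]
    calc t * ‖gradient φ x - gradient φ y‖ ≤ t * (L₁ * ‖x - y‖) := by gcongr; exact hlip x y
      _ = t * L₁ * ‖x - y‖ := by ring
      _ ≤ _ := by
        gcongr
        simp only [one_div, NNReal.coe_inv, NNReal.coe_ofNat]
        linarith
  have hsub : Subsingleton (E d) ∨ (1 / 2 : ℝ≥0) <
      ‖((ContinuousLinearEquiv.refl ℝ (E d)).symm : E d →L[ℝ] E d)‖₊⁻¹ := by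
    rcases subsingleton_or_nontrivial (E d) with h | h
    · exact Or.inl h
    · right
      have : ((ContinuousLinearEquiv.refl ℝ (E d)).symm : E d →L[ℝ] E d) =
        ContinuousLinearMap.id ℝ (E d) := rfl
      rw [this]
      simp only [ContinuousLinearMap.nnnorm_id, inv_one]
      rw [div_lt_one (by norm_num)]
      norm_num
  let T := happ.toHomeomorph _ hsub
  have hT : ∀ x, T x = x + t • gradient φ x := fun x => rfl
  let S : E d → E d := fun y => T.symm y
  have hSc : Continuous S := T.symm.continuous_toFun
  have hTS : ∀ y, S y + t • gradient φ (S y) = y := fun y => by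
    rw [← hT]; exact T.apply_symm_apply y
  have hST : ∀ x, S (x + t • gradient φ x) = x := fun x => by
    rw [← hT]; exact T.symm_apply_apply x
  -- Kantorovich dual potential paired with -2tφ: the two add up to |y - x|² exactly when x = S y.
  set k : E d → ℝ := fun y => t ^ 2 * ‖gradient φ (S y)‖ ^ 2 + 2 * t * φ (S y) with hk
  have hgc : Continuous (gradient φ) := hφ.gradient.continuous
  have hkc : Continuous k := by have := hφ.continuous; fun_prop
  -- Duality with a gap. Writing y = S y + t∇φ(S y), the cost contains the full square |x - S y|²;
  -- the Taylor error of φ consumes at most half of it, and the other half measures the distance to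
  -- the graph.
  have hkey : ∀ x y : E d, -(2 * t * φ x) + k y + (1 / 2) * ‖x - S y‖ ^ 2 ≤ ‖y - x‖ ^ 2 := by
    intro x y
    have h1 : ‖y - x‖ ^ 2 = ‖x - S y‖ ^ 2 - 2 * t * inner ℝ (gradient φ (S y)) (x - S y) +
        t ^ 2 * ‖gradient φ (S y)‖ ^ 2 := by
      have : y - x = t • gradient φ (S y) - (x - S y) := by
        nth_rewrite 1 [← hTS y]
        abel
      rw [this, norm_sub_sq_real, norm_smul, real_inner_smul_left, Real.norm_of_nonneg ht.le]
      ring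
    have h2 := (abs_le.1 (htay (S y) x)).1
    rw [← inner_gradient] at h2
    have h3 : t * (-(L₂ * ‖x - S y‖ ^ 2)) ≤
      t * (φ x - φ (S y) - inner ℝ (gradient φ (S y)) (x - S y)) := by gcongr
    have h4 : t * L₂ * ‖x - S y‖ ^ 2 ≤ 1 / 4 * ‖x - S y‖ ^ 2 := by gcongr
    simp only [hk, h1]
    linarith
  set ν := m.perturb (t • gradient φ) hv C hC
  have hmem : m.1.map (fun x => (x, x + (t • gradient φ) x)) ∈ couplings m ν :=
    perturb_mem_couplings m hv hC
  obtain ⟨B, hB0, hB⟩ := hφ.exists_bound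
  obtain ⟨B', hB'0, hB'⟩ := hφ.gradient.exists_bound
  have hφi : ∀ μ : Measure (E d × E d), IsProbabilityMeasure μ →
      Integrable (fun z : E d × E d => -(2 * t * φ z.1)) μ := fun μ _ => by
    refine Integrable.of_bound (by have := hφ.continuous; fun_prop) (2 * t * B)
      (ae_of_all _ fun z => ?_)
    rw [norm_neg, norm_mul, Real.norm_of_nonneg (by positivity)]
    gcongr
    exact hB _
  have hki : ∀ μ : Measure (E d × E d), IsProbabilityMeasure μ →
      Integrable (fun z : E d × E d => k z.2) μ := fun μ _ => by
    refine Integrable.of_bound (by fun_prop) (t ^ 2 * B' ^ 2 + 2 * t * B)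
      (ae_of_all _ fun z => ?_)
    refine (norm_add_le _ _).trans ?_
    rw [norm_mul, norm_mul, norm_pow, norm_pow, norm_norm, Real.norm_of_nonneg ht.le,
      Real.norm_of_nonneg (show 0 ≤ 2 * t by positivity)]
    gcongr
    · exact hB' _
    · exact hB _
  have hpγ := isProbabilityMeasure_of_mem_couplings hγ.1
  have hpT := isProbabilityMeasure_of_mem_couplings hmem
  have e1 : ∀ μ ∈ couplings m ν, ∫ z, -(2 * t * φ z.1) ∂μ = ∫ x, -(2 * t * φ x) ∂m.1 :=
    fun μ hμ => by
      rw [← hμ.1, integral_map (by fun_prop) (by have := hφ.continuous; fun_prop)]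
  have e2 : ∀ μ ∈ couplings m ν, ∫ z, k z.2 ∂μ = ∫ y, k y ∂ν.1 :=
    fun μ hμ => by
      rw [← hμ.2, integral_map (by fun_prop) (by fun_prop)]
  -- The graph plan attains equality in the duality, so its cost is the dual value, which depends on
  -- the marginals only.
  have hcostT : cost (m.1.map (fun x => (x, x + (t • gradient φ) x))) =
      ∫ x, -(2 * t * φ x) ∂m.1 + ∫ y, k y ∂ν.1 := by
    rw [← e1 _ hmem, ← e2 _ hmem, ← integral_add (hφi _ hpT) (hki _ hpT), cost_eq,
      integral_map (by fun_prop) (by fun_prop),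
      integral_map (by fun_prop) (by have := hφ.continuous; fun_prop)]
    refine integral_congr_ae (ae_of_all _ fun x => ?_)
    simp only [hk, Pi.smul_apply, hST, add_sub_cancel_left, norm_smul, mul_pow]
    simp
  have hcost : cost γ ≤ ∫ x, -(2 * t * φ x) ∂m.1 + ∫ y, k y ∂ν.1 := by
    rw [← hcostT, cost_eq_of_mem_optimalPlans hγ]
    exact W2_sq_le_cost hmem
  have hint : Integrable (fun z : E d × E d => (1 / 2) * ‖z.1 - S z.2‖ ^ 2) γ := by
    refine (((integrable_normSq_of_mem_couplings hγ.1).sub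
      (hφi γ hpγ)).sub (hki γ hpγ)).mono' (by fun_prop) (ae_of_all _ fun z => ?_)
    rw [Real.norm_of_nonneg (by positivity)]
    simp only [Pi.sub_apply]
    linarith [hkey z.1 z.2]
  -- Integrating `hkey` against an optimal plan leaves no room for the gap term, so it vanishes
  -- almost everywhere.
  have hle : ∫ z, (1 / 2) * ‖z.1 - S z.2‖ ^ 2 ∂γ ≤ 0 := by
    have : ∫ z, (-(2 * t * φ z.1) + k z.2 + (1 / 2) * ‖z.1 - S z.2‖ ^ 2) ∂γ ≤ cost γ := by
      rw [cost_eq]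
      exact integral_mono (((hφi γ hpγ).add (hki γ hpγ)).add hint)
        (integrable_normSq_of_mem_couplings hγ.1) fun z => hkey z.1 z.2
    have hs : Integrable (fun z : E d × E d => -(2 * t * φ z.1) + k z.2) γ :=
      (hφi γ hpγ).add (hki γ hpγ)
    rw [integral_add hs hint, integral_add (hφi γ hpγ) (hki γ hpγ),
      e1 γ hγ.1, e2 γ hγ.1] at this
    linarith
  have h0 : ∫ z, (1 / 2) * ‖z.1 - S z.2‖ ^ 2 ∂γ = 0 :=
    le_antisymm hle (integral_nonneg fun _ => by positivity)
  rw [integral_eq_zero_iff_of_nonneg (fun _ => by positivity) hint] at h0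
  filter_upwards [h0] with z hz
  have h1 : z.1 = S z.2 := by
    simpa [sub_eq_zero] using hz
  rw [h1, hTS]

end Perturb

/-! ### Gradients from quadratic expansions -/

section FirstOrder

variable {d : ℕ} {m : P2 d} {U : P2 d → ℝ} {g : E d → E d}

/-- `U` has the first order expansion `∫ g(x)·(y-x) dγ` along all plans, with a quadratic error. -/
def HasQuadExpansion (U : P2 d → ℝ) (m : P2 d) (g : E d → E d) : Prop :=
  ∃ K : ℝ, 0 ≤ K ∧ ∀ ν, ∀ γ ∈ couplings m ν,
    |U ν - U m - ∫ z, inner ℝ (g z.1) (z.2 - z.1) ∂γ| ≤ K * cost γ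

lemma HasQuadExpansion.neg (h : HasQuadExpansion U m g) :
    HasQuadExpansion (fun ν => -U ν) m (fun x => -g x) := by
  obtain ⟨K, hK0, hK⟩ := h
  refine ⟨K, hK0, fun ν γ hγ => ?_⟩
  rw [← abs_neg]
  simp only [inner_neg_left, integral_neg]
  convert hK ν γ hγ using 2
  ring

lemma integral_fst_of_mem_couplings {G : Type*} [NormedAddCommGroup G] [NormedSpace ℝ G]
    {ν : P2 d} {γ : Measure (E d × E d)} (hγ : γ ∈ couplings m ν) {f : E d → G}
    (hf : AEStronglyMeasurable f m.1) : ∫ z, f z.1 ∂γ = ∫ x, f x ∂m.1 := by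
  have h := integral_map (μ := γ) (φ := Prod.fst) (f := f) (by fun_prop) (by rwa [hγ.1])
  rw [← h, hγ.1]

lemma integral_snd_of_mem_couplings {G : Type*} [NormedAddCommGroup G] [NormedSpace ℝ G]
    {ν : P2 d} {γ : Measure (E d × E d)} (hγ : γ ∈ couplings m ν) {f : E d → G}
    (hf : AEStronglyMeasurable f ν.1) : ∫ z, f z.2 ∂γ = ∫ x, f x ∂ν.1 := by
  have h := integral_map (μ := γ) (φ := Prod.snd) (f := f) (by fun_prop) (by rwa [hγ.2])
  rw [← h, hγ.2]

lemma eventually_W2_lt (m : P2 d) {r : ℝ} (hr : 0 < r) : ∀ᶠ ν in wNhds m, W2 m ν < r := by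
  unfold wNhds
  rw [eventually_comap]
  filter_upwards [eventually_lt_nhds hr] with a ha ν hν
  rwa [hν]

lemma integral_inner_toLp (hg : MemLp g 2 m.1) {ν : P2 d} {γ : Measure (E d × E d)}
    (hγ : γ ∈ couplings m ν) :
    ∫ z, inner ℝ (hg.toLp g z.1) (z.2 - z.1) ∂γ = ∫ z, inner ℝ (g z.1) (z.2 - z.1) ∂γ := by
  refine integral_congr_ae ?_
  filter_upwards [(measurePreserving_fst_of_mem_couplings hγ).quasiMeasurePreserving.ae
    hg.coeFn_toLp] with z hz
  simp only [hz]

lemma HasQuadExpansion.mem_subdifferential (h : HasQuadExpansion U m g) (hg : MemLp g 2 m.1) :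
    hg.toLp g ∈ subdifferential U m := by
  obtain ⟨K, hK0, hK⟩ := h
  intro η hη
  filter_upwards [eventually_W2_lt m (show 0 < η / (K + 1) by positivity)] with ν hν
  obtain ⟨γ₀, hγ₀⟩ := optimalPlans_nonempty m ν
  have hbound : ∀ γ ∈ optimalPlans m ν,
      |U ν - U m - ∫ z, inner ℝ (hg.toLp g z.1) (z.2 - z.1) ∂γ| ≤ K * W2 m ν ^ 2 := by
    intro γ hγ
    rw [integral_inner_toLp hg hγ.1, ← cost_eq_of_mem_optimalPlans hγ]
    exact hK ν γ hγ.1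
  have hinf : (⨅ γ : optimalPlans m ν,
      ∫ z, inner ℝ (hg.toLp g z.1) (z.2 - z.1) ∂(γ : Measure (E d × E d))) ≤
      ∫ z, inner ℝ (hg.toLp g z.1) (z.2 - z.1) ∂γ₀ := by
    refine ciInf_le (f := fun γ : optimalPlans m ν =>
      ∫ z, inner ℝ (hg.toLp g z.1) (z.2 - z.1) ∂(γ : Measure (E d × E d)))
      ⟨U ν - U m - K * W2 m ν ^ 2, ?_⟩ ⟨γ₀, hγ₀⟩
    rintro _ ⟨γ, rfl⟩
    have := (abs_le.1 (hbound γ γ.2)).2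
    simp only
    linarith
  have h1 := (abs_le.1 (hbound γ₀ hγ₀)).1
  have h2 : K * W2 m ν ^ 2 ≤ η * W2 m ν := by
    have h3 : K * W2 m ν ≤ η := by
      have := W2_nonneg m ν
      rw [lt_div_iff₀ (by positivity)] at hν
      nlinarith
    calc K * W2 m ν ^ 2 = K * W2 m ν * W2 m ν := by ring
      _ ≤ _ := by gcongr; exact W2_nonneg m ν
  linarith

lemma inner_toLp_eq (hg : MemLp g 2 m.1) (f : L2 m) :
    inner ℝ f (hg.toLp g) = ∫ x, inner ℝ (f x) (g x) ∂m.1 := by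
  rw [MeasureTheory.L2.inner_def]
  refine integral_congr_ae ?_
  filter_upwards [hg.coeFn_toLp] with x hx
  rw [hx]

lemma IsTest.memLp {f : E d → E d} (hf : IsTest f) (m : P2 d) : MemLp f 2 m.1 := by
  obtain ⟨C, _, hC⟩ := hf.exists_bound
  exact MemLp.of_bound hf.continuous.aestronglyMeasurable C (ae_of_all _ hC)

/-- Test the subgradient inequality along ν_t = (id + t∇φ)_# m. Both the lower bound by η and the
expansion by g are linear in t up to errors e·t·B and K·t²·B²; divide by t, let t → 0, then e → 0.
Only t > 0 is allowed, hence an inequality; replacing φ by -φ reverses it. -/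
lemma HasQuadExpansion.inner_sub_nonpos (h : HasQuadExpansion U m g) (hg : MemLp g 2 m.1)
    {η : L2 m} (hη : η ∈ subdifferential U m) {φ : E d → ℝ} (hφ : IsTest φ) :
    inner ℝ (η - hg.toLp g) ((hφ.gradient.memLp m).toLp _) ≤ 0 := by
  obtain ⟨K, hK0, hK⟩ := h
  obtain ⟨t₀, ht₀, hopt⟩ := ae_eq_of_mem_optimalPlans_perturb hφ
  obtain ⟨B, hB0, hB⟩ := hφ.gradient.exists_bound
  have hgm : Measurable (gradient φ) := hφ.gradient.continuous.measurable
  have hbd : ∀ t : ℝ, 0 < t → ∀ x, ‖(t • gradient φ) x‖ ≤ t * B := fun t ht x => by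
    rw [Pi.smul_apply, norm_smul, Real.norm_of_nonneg ht.le]
    gcongr
    exact hB x
  set I := inner ℝ (η - hg.toLp g) ((hφ.gradient.memLp m).toLp _) with hI
  have hfun : ∀ (f : L2 m) (t : ℝ) (ht : 0 < t), t < t₀ → ∀ γ ∈ optimalPlans m
      (m.perturb (t • gradient φ) (hgm.const_smul t) _ (hbd t ht)),
      ∫ z, inner ℝ (f z.1) (z.2 - z.1) ∂γ =
        t * inner ℝ f ((hφ.gradient.memLp m).toLp _) := by
    intro f t ht htt γ hγ
    rw [inner_toLp_eq, ← integral_const_mul, ← integral_fst_of_mem_couplings hγ.1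
      (((Lp.aestronglyMeasurable f).inner hgm.aestronglyMeasurable).const_mul _)]
    refine integral_congr_ae ?_
    filter_upwards [hopt t ht htt m _ _ _ γ hγ] with z hz
    rw [hz, add_sub_cancel_left, inner_smul_right]
  have hW : ∀ (t : ℝ) (ht : 0 < t), t < t₀ →
      W2 m (m.perturb (t • gradient φ) (hgm.const_smul t) _ (hbd t ht)) ≤ t * B := by
    intro t ht htt
    refine (sq_le_sq₀ (W2_nonneg _ _) (by positivity)).1
      ((W2_sq_le_cost (perturb_mem_couplings m _ _)).trans ?_)
    rw [cost_eq, integral_map (by fun_prop) (by fun_prop)]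
    refine (integral_mono_of_nonneg (ae_of_all _ fun _ => by positivity)
      (integrable_const ((t * B) ^ 2)) (ae_of_all _ fun x => ?_)).trans (by simp)
    simp only [add_sub_cancel_left]
    gcongr
    exact hbd t ht x
  have hmain : ∀ e : ℝ, 0 < e → ∀ᶠ t in 𝓝[>] (0 : ℝ), I ≤ e * B + K * t * B ^ 2 := by
    intro e he
    have hev := hη e he
    unfold wNhds at hev
    rw [eventually_comap] at hev
    obtain ⟨r, hr, hr'⟩ := Metric.eventually_nhds_iff.1 hev
    have h1 : ∀ᶠ t in 𝓝[>] (0 : ℝ), t * B < r := by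
      have : Tendsto (fun t : ℝ => t * B) (𝓝[>] 0) (𝓝 (0 * B)) :=
        (tendsto_id.mul_const B).mono_left nhdsWithin_le_nhds
      rw [zero_mul] at this
      exact this.eventually_lt_const hr
    filter_upwards [h1, self_mem_nhdsWithin, Ioo_mem_nhdsGT ht₀] with t h1 ht ht'
    have ht : 0 < t := ht
    set ν := m.perturb (t • gradient φ) (hgm.const_smul t) _ (hbd t ht)
    have hWν : W2 m ν ≤ t * B := hW t ht ht'.2
    have h2 := hr' (y := W2 m ν) (by
      rw [Real.dist_eq, sub_zero, abs_of_nonneg (W2_nonneg _ _)]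
      exact hWν.trans_lt h1) ν rfl
    obtain ⟨γ, hγ⟩ := optimalPlans_nonempty m ν
    have : Nonempty (optimalPlans m ν) := ⟨⟨γ, hγ⟩⟩
    have h3 : (⨅ γ : optimalPlans m ν,
        ∫ z, inner ℝ (η z.1) (z.2 - z.1) ∂(γ : Measure (E d × E d))) =
        t * inner ℝ η ((hφ.gradient.memLp m).toLp _) := by
      -- All optimal plans sit on the graph of id + t∇φ, so the infimum runs over a constant family.
      rw [iInf_congr fun γ' : optimalPlans m ν => hfun η t ht ht'.2 γ' γ'.2, ciInf_const]
    rw [h3] at h2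
    have h4 := (abs_le.1 (hK ν γ hγ.1)).2
    rw [← integral_inner_toLp hg hγ.1, hfun _ t ht ht'.2 γ hγ,
      cost_eq_of_mem_optimalPlans hγ] at h4
    have h5 : W2 m ν ^ 2 ≤ (t * B) ^ 2 := by
      have := W2_nonneg m ν
      gcongr
    have h6 : t * I ≤ t * (e * B + K * t * B ^ 2) := by
      rw [hI, inner_sub_left]
      have h7 : e * W2 m ν ≤ e * (t * B) := by gcongr
      have h8 : K * W2 m ν ^ 2 ≤ K * (t * B) ^ 2 := by gcongr
      linarith
    exact le_of_mul_le_mul_left h6 ht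
  have hlim : ∀ e : ℝ, 0 < e → I ≤ e * B := by
    intro e he
    have h1 : Tendsto (fun t : ℝ => e * B + K * t * B ^ 2) (𝓝[>] 0)
        (𝓝 (e * B + K * 0 * B ^ 2)) :=
      (by fun_prop : Continuous fun t : ℝ => e * B + K * t * B ^ 2).continuousAt.tendsto.mono_left
        nhdsWithin_le_nhds
    simp only [mul_zero, zero_mul, add_zero] at h1
    exact ge_of_tendsto h1 (hmain e he)
  by_contra! hpos
  have := hlim (I / (2 * (B + 1))) (by positivity)
  have h2 : I / (2 * (B + 1)) * B ≤ I / 2 := by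
    rw [div_mul_eq_mul_div, div_le_div_iff₀ (by positivity) (by positivity)]
    nlinarith
  linarith

/-- An element of the subdifferential has the same tangential part as the gradient. -/
lemma HasQuadExpansion.inner_sub_eq_zero (h : HasQuadExpansion U m g) (hg : MemLp g 2 m.1)
    {η : L2 m} (hη : η ∈ subdifferential U m) {f : L2 m} (hf : f ∈ tangent m) :
    inner ℝ (η - hg.toLp g) f = 0 := by
  have hle : ∀ φ : E d → ℝ, IsTest φ → ∀ f : L2 m, f =ᵐ[m.1] gradient φ →
      inner ℝ (η - hg.toLp g) f ≤ 0 := by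
    intro φ hφ f hf
    have : f = (hφ.gradient.memLp m).toLp _ := Lp.ext (hf.trans (MemLp.coeFn_toLp _).symm)
    rw [this]
    exact h.inner_sub_nonpos hg hη hφ
  -- The orthogonal complement of η - g is closed, so it suffices that it contains the gradients of
  -- test functions.
  have hmem : tangent m ≤ (Submodule.span ℝ {η - hg.toLp g})ᗮ := by
    refine Submodule.topologicalClosure_minimal _ ?_ (Submodule.isClosed_orthogonal _)
    rw [Submodule.span_le]
    rintro f ⟨φ, hφ, hf⟩
    rw [SetLike.mem_coe, Submodule.mem_orthogonal_singleton_iff_inner_right]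
    refine le_antisymm (hle φ hφ f hf) ?_
    have h2 := hle _ (hφ.smul (-1)) (-f) (by
      filter_upwards [hf, Lp.coeFn_neg f] with x hx hx'
      rw [hx', Pi.neg_apply, hx]
      have : (fun x => (-1 : ℝ) • φ x) = fun x => (-1 : ℝ) * φ x := rfl
      rw [gradient, gradient, this, fderiv_const_mul hφ.differentiable.differentiableAt]
      simp)
    rw [inner_neg_right] at h2
    linarith
  exact (Submodule.mem_orthogonal_singleton_iff_inner_right).1 (hmem hf)

/-- Since g is itself tangent, η - g is orthogonal to g and ‖η‖² = ‖η - g‖² + ‖g‖². -/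
lemma HasQuadExpansion.isWGradient (h : HasQuadExpansion U m g) (hg : MemLp g 2 m.1)
    (ht : hg.toLp g ∈ tangent m) : IsWGradient U m (hg.toLp g) := by
  refine ⟨h.mem_subdifferential hg, fun η hη => ?_⟩
  have h0 := h.inner_sub_eq_zero hg hη ht
  have h1 : η = (η - hg.toLp g) + hg.toLp g := by abel
  have h2 := norm_add_sq_real (η - hg.toLp g) (hg.toLp g)
  rw [h0, ← h1] at h2
  refine (sq_le_sq₀ (norm_nonneg _) (norm_nonneg _)).1 ?_
  nlinarith [sq_nonneg ‖η - hg.toLp g‖]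

/-- `wGrad` is some element of minimal norm chosen by `epsilon`; the Pythagorean identity forces
every such element to be g. -/
lemma HasQuadExpansion.wGrad_eq (h : HasQuadExpansion U m g) (hg : MemLp g 2 m.1)
    (ht : hg.toLp g ∈ tangent m) : wGrad U m = hg.toLp g := by
  have h1 : IsWGradient U m (wGrad U m) :=
    Classical.epsilon_spec (p := fun g => IsWGradient U m g) ⟨_, h.isWGradient hg ht⟩
  have h0 := h.inner_sub_eq_zero hg h1.1 ht
  have hle := h1.2 _ (h.mem_subdifferential hg)
  have h2 := norm_add_sq_real (wGrad U m - hg.toLp g) (hg.toLp g)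
  rw [h0, sub_add_cancel] at h2
  have h3 : ‖wGrad U m - hg.toLp g‖ ^ 2 ≤ 0 := by
    have : ‖wGrad U m‖ ^ 2 ≤ ‖hg.toLp g‖ ^ 2 := by gcongr
    linarith
  have h4 : ‖wGrad U m - hg.toLp g‖ = 0 := by
    have := norm_nonneg (wGrad U m - hg.toLp g)
    nlinarith
  exact sub_eq_zero.1 (norm_eq_zero.1 h4)

lemma HasQuadExpansion.wDifferentiableAt (h : HasQuadExpansion U m g) (hg : MemLp g 2 m.1)
    (ht : hg.toLp g ∈ tangent m) : WDifferentiableAt U m := by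
  refine ⟨⟨_, h.mem_subdifferential hg⟩, ⟨hg.toLp g, ?_⟩, ⟨_, h.isWGradient hg ht⟩⟩
  have := h.neg.mem_subdifferential hg.neg
  rwa [show hg.neg.toLp (fun x => -g x) = -hg.toLp g from MemLp.toLp_neg hg] at this

end FirstOrder

/-! ### Tangent vector fields -/

section Tangent

variable {d : ℕ} {m : P2 d}

/-- The class of the vector field `f` in `L²(m)` is a tangent vector. -/
def IsTangent (m : P2 d) (f : E d → E d) : Prop := ∃ g ∈ tangent m, g =ᵐ[m.1] f

instance (m : P2 d) : (tangent m).HasOrthogonalProjection := by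
  unfold tangent; infer_instance

lemma IsTangent.memLp {f : E d → E d} (hf : IsTangent m f) : MemLp f 2 m.1 := by
  obtain ⟨g, _, hg⟩ := hf
  exact (Lp.memLp g).ae_eq hg

lemma IsTangent.toLp_mem {f : E d → E d} (hf : IsTangent m f) (h : MemLp f 2 m.1) :
    h.toLp f ∈ tangent m := by
  obtain ⟨g, hg, hgf⟩ := hf
  rwa [← show g = h.toLp f from Lp.ext (hgf.trans h.coeFn_toLp.symm)]

/-- A closed subspace equals its double orthogonal. Tangency thus becomes a family of scalar
equations, through which limits and integrals pass. -/
lemma isTangent_of_forall_integral_eq_zero {f : E d → E d} (hf : MemLp f 2 m.1)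
    (h : ∀ w ∈ (tangent m)ᗮ, ∫ x, inner ℝ (w x) (f x) ∂m.1 = 0) : IsTangent m f := by
  refine ⟨hf.toLp f, ?_, hf.coeFn_toLp⟩
  rw [← Submodule.orthogonal_orthogonal (tangent m), Submodule.mem_orthogonal]
  intro w hw
  rw [inner_toLp_eq, h w hw]

lemma IsTangent.integral_eq_zero {f : E d → E d} (hf : IsTangent m f) {w : L2 m}
    (hw : w ∈ (tangent m)ᗮ) : ∫ x, inner ℝ (w x) (f x) ∂m.1 = 0 := by
  rw [← inner_toLp_eq hf.memLp]
  exact Submodule.inner_left_of_mem_orthogonal (hf.toLp_mem hf.memLp) hw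

lemma isTangent_gradient_of_isTest {φ : E d → ℝ} (hφ : IsTest φ) (m : P2 d) :
    IsTangent m (gradient φ) := by
  refine ⟨(hφ.gradient.memLp m).toLp _, ?_, MemLp.coeFn_toLp _⟩
  exact Submodule.le_topologicalClosure _ (Submodule.subset_span ⟨φ, hφ, MemLp.coeFn_toLp _⟩)

lemma IsTangent.congr {f g : E d → E d} (hf : IsTangent m f) (h : ∀ x, f x = g x) :
    IsTangent m g := by
  rwa [← show f = g from funext h]

lemma IsTangent.add {f g : E d → E d} (hf : IsTangent m f) (hg : IsTangent m g) :
    IsTangent m fun x => f x + g x := by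
  obtain ⟨u, hu, hu'⟩ := hf
  obtain ⟨v, hv, hv'⟩ := hg
  exact ⟨u + v, add_mem hu hv, (Lp.coeFn_add u v).trans (hu'.add hv')⟩

lemma isTangent_zero (m : P2 d) : IsTangent m fun _ => 0 :=
  ⟨0, zero_mem _, Lp.coeFn_zero _ _ _⟩

lemma isTangent_sum {ι : Type*} (s : Finset ι) {f : ι → E d → E d}
    (hf : ∀ i ∈ s, IsTangent m (f i)) : IsTangent m fun x => ∑ i ∈ s, f i x := by
  classical
  induction s using Finset.induction_on with
  | empty => simpa using isTangent_zero m
  | insert i s his ih =>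
    simp only [Finset.sum_insert his]
    exact (hf i (by simp)).add (ih fun j hj => hf j (by simp [hj]))

lemma integrable_L2 (w : L2 m) : Integrable w m.1 :=
  (Lp.memLp w).integrable (by norm_num)

/-- Bounded pointwise limits of tangent fields are tangent. -/
lemma isTangent_of_tendsto {f : ℕ → E d → E d} {g : E d → E d} (hf : ∀ n, IsTangent m (f n))
    {C : ℝ} (hC : ∀ n x, ‖f n x‖ ≤ C) (h : ∀ x, Tendsto (fun n => f n x) atTop (𝓝 (g x))) :
    IsTangent m g := by
  have hg : MemLp g 2 m.1 := by
    refine MemLp.of_bound (aestronglyMeasurable_of_tendsto_ae atTop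
      (fun n => (hf n).memLp.1) (ae_of_all _ h)) C (ae_of_all _ fun x => ?_)
    exact le_of_tendsto (h x).norm (Eventually.of_forall fun n => hC n x)
  refine isTangent_of_forall_integral_eq_zero hg fun w hw => ?_
  have hlim : Tendsto (fun n => ∫ x, inner ℝ (w x) (f n x) ∂m.1) atTop
      (𝓝 (∫ x, inner ℝ (w x) (g x) ∂m.1)) := by
    refine tendsto_integral_of_dominated_convergence (fun x => ‖w x‖ * C)
      (fun n => (Lp.aestronglyMeasurable w).inner (hf n).memLp.1)
      ((integrable_L2 w).norm.mul_const C) (fun n => ae_of_all _ fun x => ?_)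
      (ae_of_all _ fun x => tendsto_const_nhds.inner (h x))
    exact (norm_inner_le_norm _ _).trans (by gcongr; exact hC n x)
  simp only [(hf _).integral_eq_zero hw] at hlim
  exact (tendsto_nhds_unique hlim tendsto_const_nhds)

/-- Superpositions of tangent fields are tangent. -/
lemma isTangent_integral {Θ : Type*} [MeasurableSpace Θ] {μ : Measure Θ} [SFinite μ]
    {f : Θ → E d → E d} (hf : ∀ θ, IsTangent m (f θ))
    (hm : AEStronglyMeasurable (fun p : Θ × E d => f p.1 p.2) (μ.prod m.1))
    {M : Θ → ℝ} (hM : Integrable M μ) (hb : ∀ θ x, ‖f θ x‖ ≤ M θ) :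
    IsTangent m fun x => ∫ θ, f θ x ∂μ := by
  have hint : Integrable (fun p : Θ × E d => f p.1 p.2) (μ.prod m.1) := by
    refine Integrable.mono' (hM.comp_fst m.1) hm (ae_of_all _ fun p => hb p.1 p.2)
  have hg : MemLp (fun x => ∫ θ, f θ x ∂μ) 2 m.1 := by
    refine MemLp.of_bound hint.swap.integral_prod_left.aestronglyMeasurable (∫ θ, M θ ∂μ)
      (ae_of_all _ fun x => norm_integral_le_of_norm_le hM (ae_of_all _ fun θ => hb θ x))
  refine isTangent_of_forall_integral_eq_zero hg fun w hw => ?_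
  have hint2 : Integrable (fun p : Θ × E d => inner ℝ (w p.2) (f p.1 p.2)) (μ.prod m.1) := by
    have hw1 := (integrable_L2 w)
    refine Integrable.mono' (hM.mul_prod hw1.norm)
      ((hw1.aestronglyMeasurable.comp_snd).inner hm) (ae_of_all _ fun p => ?_)
    refine (norm_inner_le_norm _ _).trans ?_
    rw [mul_comm]
    gcongr
    exact hb p.1 p.2
  have hfib : ∀ᵐ x ∂m.1, Integrable (fun θ => f θ x) μ := hint.prod_left_ae
  have h1 : ∫ x, inner ℝ (w x) (∫ θ, f θ x ∂μ) ∂m.1 =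
      ∫ x, ∫ θ, inner ℝ (w x) (f θ x) ∂μ ∂m.1 := by
    refine integral_congr_ae ?_
    filter_upwards [hfib] with x hx
    rw [integral_inner hx]
  -- By Fubini, orthogonality to w is tested on each f θ separately.
  rw [h1, integral_integral_swap (f := fun x θ => inner ℝ (w x) (f θ x)) hint2.swap]
  simp only [(hf _).integral_eq_zero hw, integral_zero]

lemma norm_gradient_eq (f : E d → ℝ) (x : E d) : ‖gradient f x‖ = ‖fderiv ℝ f x‖ := by
  rw [gradient, LinearIsometryEquiv.norm_map]

/-- The gradient of a smooth function is tangent if it is bounded. -/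
lemma isTangent_gradient {f : E d → ℝ} (hf : ContDiff ℝ ((⊤ : ℕ∞) : WithTop ℕ∞) f) {M : ℝ}
    (hM : ∀ x, ‖gradient f x‖ ≤ M) : IsTangent m (gradient f) := by
  let χ : ContDiffBump (0 : E d) := ⟨1, 2, by norm_num, by norm_num⟩
  have hχt : IsTest χ := ⟨χ.contDiff, χ.hasCompactSupport⟩
  obtain ⟨B, hB0, hB⟩ := hχt.fderiv.exists_bound
  have hM0 : 0 ≤ M := (norm_nonneg _).trans (hM 0)
  have hfd : Differentiable ℝ f := hf.differentiable (by simp)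
  -- Linear growth of f is what allows the cut-off: the derivative of x ↦ χ(x/(n+1)) is O(1/n) and
  -- lives where |x| ≤ 2(n+1), so its product with f stays bounded in n.
  have hlin : ∀ x, ‖f x‖ ≤ ‖f 0‖ + M * ‖x‖ := fun x => by
    have h := convex_univ.norm_image_sub_le_of_norm_fderiv_le (𝕜 := ℝ) (f := f) (C := M)
      (fun z _ => hfd z) (fun z _ => by rw [← norm_gradient_eq]; exact hM z)
      (mem_univ 0) (mem_univ x)
    rw [sub_zero] at h
    have := norm_le_norm_add_norm_sub' (f x) (f 0)
    linarith
  let c : ℕ → ℝ := fun n => ((n : ℝ) + 1)⁻¹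
  have hc : ∀ n, 0 < c n := fun n => by positivity
  let g : ℕ → E d → ℝ := fun n x => χ (c n • x) * f x
  have hχc : ∀ n, IsTest fun x => χ (c n • x) := fun n =>
    ⟨χ.contDiff.comp (contDiff_const_smul _), χ.hasCompactSupport.comp_smul (hc n).ne'⟩
  have hg : ∀ n, IsTest (g n) := fun n => ⟨(hχc n).1.mul hf, (hχc n).2.mul_right⟩
  have hbound : ∀ n x, ‖gradient (g n) x‖ ≤ M + B * (‖f 0‖ + 2 * M) := by
    intro n x
    have hd : HasFDerivAt (fun x => χ (c n • x)) (c n • fderiv ℝ χ (c n • x)) x := by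
      refine ((hχt.differentiable (c n • x)).hasFDerivAt.comp x
        ((hasFDerivAt_id x).const_smul (c n))).congr_fderiv ?_
      ext v
      simp
    have hgd : HasFDerivAt (g n) _ x := hd.mul (hfd x).hasFDerivAt
    rw [norm_gradient_eq, hgd.fderiv]
    refine (norm_add_le _ _).trans ?_
    rw [norm_smul, norm_smul]
    have h1 : ‖χ (c n • x)‖ * ‖fderiv ℝ f x‖ ≤ M := by
      rw [← norm_gradient_eq, Real.norm_of_nonneg χ.nonneg]
      exact (mul_le_of_le_one_left (norm_nonneg _) χ.le_one).trans (hM x)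
    have h2 : ‖f x‖ * ‖c n • fderiv ℝ χ (c n • x)‖ ≤ B * (‖f 0‖ + 2 * M) := by
      rw [norm_smul, Real.norm_of_nonneg (hc n).le]
      by_cases hx : ‖c n • x‖ ≤ 2
      · have h3 : c n * ‖f x‖ ≤ ‖f 0‖ + 2 * M := by
          rw [norm_smul, Real.norm_of_nonneg (hc n).le] at hx
          have h4 : c n ≤ 1 := inv_le_one_of_one_le₀ (by
            have : (0 : ℝ) ≤ n := Nat.cast_nonneg n
            linarith)
          calc c n * ‖f x‖ ≤ c n * (‖f 0‖ + M * ‖x‖) := by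
                have := hc n
                gcongr
                exact hlin x
            _ = c n * ‖f 0‖ + M * (c n * ‖x‖) := by ring
            _ ≤ 1 * ‖f 0‖ + M * 2 := by gcongr
            _ = _ := by ring
        calc ‖f x‖ * (c n * ‖fderiv ℝ χ (c n • x)‖)
            = ‖fderiv ℝ χ (c n • x)‖ * (c n * ‖f x‖) := by ring
          _ ≤ _ := by
            gcongr
            exact hB _
      · have : fderiv ℝ χ (c n • x) = 0 := by
          by_contra h0
          have h5 := support_fderiv_subset ℝ (f := χ) (Function.mem_support.2 h0)
          rw [χ.tsupport_eq, mem_closedBall_zero_iff] at h5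
          exact hx h5
        rw [this]
        simp only [norm_zero, mul_zero]
        positivity
    linarith
  refine isTangent_of_tendsto (fun n => isTangent_gradient_of_isTest (hg n) m) hbound fun x => ?_
  refine tendsto_const_nhds.congr' ?_
  obtain ⟨N, hN⟩ := exists_nat_ge ‖x‖
  filter_upwards [eventually_ge_atTop N] with n hn
  -- For n ≥ |x| the cut-off equals 1 near x, so the gradients agree there and the pointwise limit
  -- is trivial.
  have hev : f =ᶠ[𝓝 x] g n := by
    have hnx : ‖x‖ < n + 1 := by
      have : (N : ℝ) ≤ n := by exact_mod_cast hn
      linarith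
    filter_upwards [continuous_norm.continuousAt.eventually_lt_const hnx] with y hy
    simp only [g]
    rw [χ.one_of_mem_closedBall, one_mul]
    rw [mem_closedBall_zero_iff, norm_smul, Real.norm_of_nonneg (hc n).le]
    simp only [c]
    rw [inv_mul_le_iff₀ (by positivity)]
    linarith
  rw [gradient, gradient, hev.fderiv_eq]

end Tangent

/-! ### Functions with uniform second order expansions -/

/-- `U` has first derivative `A m x = ∇_w U[m](x)` and second derivatives `D m x = ∇(∇_w U[m])(x)`
and `H m x y = ∇_w² U[m](x,y)`, with all bounds, Lipschitz constants and second order errors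
controlled by `M`, along all plans. -/
structure HasUniformDerivs {d : ℕ} (U : P2 d → ℝ) (A : P2 d → E d → E d)
    (D : P2 d → E d → E d →L[ℝ] E d) (H : P2 d → E d → E d → E d →L[ℝ] E d) (M : ℝ) : Prop where
  norm_A : ∀ m x, ‖A m x‖ ≤ M
  norm_D : ∀ m x, ‖D m x‖ ≤ M
  norm_H : ∀ m x y, ‖H m x y‖ ≤ M
  expand_U : ∀ m ν, ∀ γ ∈ couplings m ν,
    |U ν - U m - ∫ z, inner ℝ (A m z.1) (z.2 - z.1) ∂γ| ≤ M * cost γ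
  taylor_A : ∀ m x y, ‖A m y - A m x - D m x (y - x)‖ ≤ M * ‖y - x‖ ^ 2
  lip_D : ∀ m x y, ‖D m y - D m x‖ ≤ M * ‖y - x‖
  lip_D' : ∀ m ν, ∀ γ ∈ couplings m ν, ∀ x, ‖D ν x - D m x‖ ≤ M * √(cost γ)
  expand_A : ∀ m ν, ∀ γ ∈ couplings m ν, ∀ x,
    ‖A ν x - A m x - ∫ z, H m x z.1 (z.2 - z.1) ∂γ‖ ≤ M * cost γ
  lip_H : ∀ m x y x' y', ‖H m x' y' - H m x y‖ ≤ M * (‖x' - x‖ + ‖y' - y‖)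
  lip_H' : ∀ m ν, ∀ γ ∈ couplings m ν, ∀ x y, ‖H ν x y - H m x y‖ ≤ M * √(cost γ)
  tangent_A : ∀ m, IsTangent m (A m)
  tangent_H : ∀ m x e, IsTangent m fun y => ContinuousLinearMap.adjoint (H m x y) e
  -- This field is the gradient of x ↦ ⟨A m x, ζ x⟩; it forms the local part of the gradient of ν ↦
  -- ζ·(U[ν]).
  tangent_D : ∀ m (ζ : E d → E d), IsTest ζ → IsTangent m fun x =>
    ContinuousLinearMap.adjoint (D m x) (ζ x) +
      ContinuousLinearMap.adjoint (fderiv ℝ ζ x) (A m x)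

lemma hasFDerivAt_of_norm_sub_sub_le {d : ℕ} {f : E d → E d} {L : E d →L[ℝ] E d} {M : ℝ} {x : E d}
    (h : ∀ y, ‖f y - f x - L (y - x)‖ ≤ M * ‖y - x‖ ^ 2) : HasFDerivAt f L x := by
  rw [hasFDerivAt_iff_isLittleO_nhds_zero]
  have h1 : (fun v : E d => f (x + v) - f x - L v) =O[𝓝 0] fun v => ‖v‖ ^ 2 := by
    refine Asymptotics.IsBigO.of_bound M (Eventually.of_forall fun v => ?_)
    have := h (x + v)
    rw [add_sub_cancel_left] at this
    simpa using this
  exact h1.trans_isLittleO (Asymptotics.isLittleO_norm_pow_id one_lt_two)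

lemma tendsto_W2 {d : ℕ} (m : P2 d) : Tendsto (W2 m) (wNhds m) (𝓝 0) := tendsto_comap

namespace HasUniformDerivs

variable {d : ℕ} {U : P2 d → ℝ} {A : P2 d → E d → E d} {D : P2 d → E d → E d →L[ℝ] E d}
  {H : P2 d → E d → E d → E d →L[ℝ] E d} {M : ℝ}

lemma nonneg (h : HasUniformDerivs U A D H M) : 0 ≤ M :=
  -- `heatLaw d 0 0`, the Dirac mass at the origin, merely supplies a point of the Wasserstein
  -- space.
  (norm_nonneg _).trans (h.norm_A (heatLaw d 0 0) 0)

lemma hasFDerivAt_A (h : HasUniformDerivs U A D H M) (m : P2 d) (x : E d) :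
    HasFDerivAt (A m) (D m x) x := hasFDerivAt_of_norm_sub_sub_le (h.taylor_A m x)

lemma continuous_A (h : HasUniformDerivs U A D H M) (m : P2 d) : Continuous (A m) :=
  continuous_iff_continuousAt.2 fun x => (h.hasFDerivAt_A m x).continuousAt

lemma continuous_D (h : HasUniformDerivs U A D H M) (m : P2 d) : Continuous (D m) := by
  refine (LipschitzWith.of_dist_le_mul (K := ⟨M, h.nonneg⟩) fun x y => ?_).continuous
  rw [dist_eq_norm, dist_eq_norm]
  exact h.lip_D m y x

lemma continuous_H (h : HasUniformDerivs U A D H M) (m : P2 d) :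
    Continuous fun p : E d × E d => H m p.1 p.2 := by
  refine (LipschitzWith.of_dist_le_mul (K := ⟨2 * M, by have := h.nonneg; positivity⟩)
    fun p q => ?_).continuous
  rw [dist_eq_norm, dist_eq_norm]
  refine (h.lip_H m q.1 q.2 p.1 p.2).trans ?_
  have h1 : ‖p.1 - q.1‖ ≤ ‖p - q‖ := norm_fst_le (p - q)
  have h2 : ‖p.2 - q.2‖ ≤ ‖p - q‖ := norm_snd_le (p - q)
  have := h.nonneg
  calc M * (‖p.1 - q.1‖ + ‖p.2 - q.2‖) ≤ M * (‖p - q‖ + ‖p - q‖) := by gcongr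
    _ = 2 * M * ‖p - q‖ := by ring

lemma memLp_A (h : HasUniformDerivs U A D H M) (m : P2 d) : MemLp (A m) 2 m.1 :=
  (h.tangent_A m).memLp

lemma hasQuadExpansion (h : HasUniformDerivs U A D H M) (m : P2 d) :
    HasQuadExpansion U m (A m) := ⟨M, h.nonneg, h.expand_U m⟩

lemma wDifferentiableAt (h : HasUniformDerivs U A D H M) (m : P2 d) : WDifferentiableAt U m :=
  (h.hasQuadExpansion m).wDifferentiableAt (h.memLp_A m) ((h.tangent_A m).toLp_mem _)

lemma dirDeriv_eq (h : HasUniformDerivs U A D H M) (m : P2 d) (ζ : E d → E d) :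
    dirDeriv U m ζ = ∫ x, inner ℝ (A m x) (ζ x) ∂m.1 := by
  rw [dirDeriv, (h.hasQuadExpansion m).wGrad_eq (h.memLp_A m) ((h.tangent_A m).toLp_mem _)]
  refine integral_congr_ae ?_
  filter_upwards [(h.memLp_A m).coeFn_toLp] with x hx
  rw [hx]

/-- Move from (m, x) to (ν, x) by `expand_A`, then from x to y by `taylor_A` at ν. Replacing D ν by
D m costs a mixed term √cost·|y - x|, absorbed by the two squares. -/
lemma expansion (h : HasUniformDerivs U A D H M) {m ν : P2 d} {γ : Measure (E d × E d)}
    (hγ : γ ∈ couplings m ν) (x y : E d) :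
    ‖A ν y - A m x - (D m x (y - x) + ∫ z, H m x z.1 (z.2 - z.1) ∂γ)‖ ≤
      2 * M * (‖y - x‖ ^ 2 + cost γ) := by
  have h1 := h.taylor_A ν x y
  have h2 : ‖(D ν x - D m x) (y - x)‖ ≤ M * √(cost γ) * ‖y - x‖ :=
    (ContinuousLinearMap.le_opNorm _ _).trans (by gcongr; exact h.lip_D' m ν γ hγ x)
  have h3 := h.expand_A m ν γ hγ x
  have e : A ν y - A m x - (D m x (y - x) + ∫ z, H m x z.1 (z.2 - z.1) ∂γ) =
      (A ν y - A ν x - D ν x (y - x)) + (D ν x - D m x) (y - x) +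
      (A ν x - A m x - ∫ z, H m x z.1 (z.2 - z.1) ∂γ) := by
    rw [sub_apply]
    abel
  rw [e]
  refine (norm_add₃_le).trans ?_
  have h4 : √(cost γ) * ‖y - x‖ ≤ ‖y - x‖ ^ 2 + cost γ := by
    nlinarith [sq_nonneg (√(cost γ) - ‖y - x‖), Real.sq_sqrt (cost_nonneg γ), sq_nonneg ‖y - x‖,
      cost_nonneg γ]
  have := mul_le_mul_of_nonneg_left h4 h.nonneg
  linarith

lemma isTwiceDifferentiable (h : HasUniformDerivs U A D H M) :
    IsTwiceDifferentiable U A D H where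
  differentiable := h.wDifferentiableAt
  gradient m := ⟨h.memLp_A m, (h.hasQuadExpansion m).isWGradient _ ((h.tangent_A m).toLp_mem _)⟩
  continuous := h.continuous_A
  growth m := ⟨M, Eventually.of_forall fun ν x => (h.norm_A ν x).trans
    (le_mul_of_one_le_right h.nonneg (by linarith [norm_nonneg x]))⟩
  measurable_D m := (h.continuous_D m).measurable
  bounded_D m := ⟨M, h.norm_D m⟩
  measurable_H m := (h.continuous_H m).measurable
  bounded_H m := ⟨M, h.norm_H m⟩
  tangent_H m x e := h.tangent_H m x e
  expansion m := by
    have hM := h.nonneg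
    -- The error is quadratic, so both moduli are linear; the absolute value keeps the second one
    -- nonnegative on all of ℝ.
    refine ⟨fun t => 2 * M * t, fun t => 2 * M * |t|, ⟨by simp, by fun_prop, ?_, ?_, ?_⟩,
      fun t => by positivity, ?_, ?_⟩
    · intro a _ b _ hab
      simp only
      gcongr
    · exact ((LinearMap.mul ℝ ℝ (2 * M)).concaveOn (convex_Ici 0))
    · intro s t _ _
      exact (mul_add _ _ _).le
    · have : Tendsto (fun t : ℝ => 2 * M * |t|) (𝓝 0) (𝓝 (2 * M * |0|)) :=
        (by fun_prop : Continuous fun t : ℝ => 2 * M * |t|).continuousAt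
      simp only [abs_zero, mul_zero] at this
      exact this.mono_left nhdsWithin_le_nhds
    · intro ν γ hγ x y
      refine (h.expansion hγ.1 x y).trans_eq ?_
      simp only [cost_eq_of_mem_optimalPlans hγ, norm_sub_rev y x, abs_of_nonneg (W2_nonneg m ν)]
      ring

lemma isC2Real (h : HasUniformDerivs U A D H M) : IsC2Real U := by
  refine ⟨A, D, H, h.isTwiceDifferentiable, fun m x => ?_, fun m x y => ?_⟩
  · rw [tendsto_iff_norm_sub_tendsto_zero]
    have hW : Tendsto (fun p : E d × P2 d => W2 m p.2) (𝓝 x ×ˢ wNhds m) (𝓝 0) :=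
      (tendsto_W2 m).comp tendsto_snd
    have hx : Tendsto (fun p : E d × P2 d => ‖p.1 - x‖) (𝓝 x ×ˢ wNhds m) (𝓝 0) :=
      (tendsto_iff_norm_sub_tendsto_zero.1 tendsto_id).comp tendsto_fst
    refine squeeze_zero (fun _ => norm_nonneg _) (fun p => ?_)
      (by simpa using (hW.const_mul M).add (hx.const_mul M))
    obtain ⟨γ, hγ⟩ := optimalPlans_nonempty m p.2
    rw [← sub_add_sub_cancel _ (D m p.1)]
    refine (norm_add_le _ _).trans (add_le_add ?_ (h.lip_D m x p.1))
    rw [← sqrt_cost_of_mem_optimalPlans hγ]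
    exact h.lip_D' m p.2 γ hγ.1 p.1
  · rw [tendsto_iff_norm_sub_tendsto_zero]
    have hW : Tendsto (fun p : (E d × E d) × P2 d => W2 m p.2)
      ((𝓝 x ×ˢ 𝓝 y) ×ˢ wNhds m) (𝓝 0) := (tendsto_W2 m).comp tendsto_snd
    have hx : Tendsto (fun p : (E d × E d) × P2 d => ‖p.1.1 - x‖)
      ((𝓝 x ×ˢ 𝓝 y) ×ˢ wNhds m) (𝓝 0) :=
      (tendsto_iff_norm_sub_tendsto_zero.1 tendsto_id).comp (tendsto_fst.comp tendsto_fst)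
    have hy : Tendsto (fun p : (E d × E d) × P2 d => ‖p.1.2 - y‖)
      ((𝓝 x ×ˢ 𝓝 y) ×ˢ wNhds m) (𝓝 0) :=
      (tendsto_iff_norm_sub_tendsto_zero.1 tendsto_id).comp (tendsto_snd.comp tendsto_fst)
    refine squeeze_zero (fun _ => norm_nonneg _) (fun p => ?_)
      (by simpa using (hW.const_mul M).add ((hx.add hy).const_mul M))
    obtain ⟨γ, hγ⟩ := optimalPlans_nonempty m p.2
    rw [← sub_add_sub_cancel _ (H m p.1.1 p.1.2)]
    refine (norm_add_le _ _).trans (add_le_add ?_ (h.lip_H m x y p.1.1 p.1.2))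
    rw [← sqrt_cost_of_mem_optimalPlans hγ]
    exact h.lip_H' m p.2 γ hγ.1 _ _

end HasUniformDerivs

/-! ### The Hessian -/

namespace HasUniformDerivs

variable {d : ℕ} {U : P2 d → ℝ} {A : P2 d → E d → E d} {D : P2 d → E d → E d →L[ℝ] E d}
  {H : P2 d → E d → E d → E d →L[ℝ] E d} {M : ℝ} {m : P2 d} {ζ : E d → E d}

/-- The Wasserstein gradient at `m` of `ν ↦ ζ·(U[ν])`. -/
def dirGrad (A : P2 d → E d → E d) (D : P2 d → E d → E d →L[ℝ] E d)
    (H : P2 d → E d → E d → E d →L[ℝ] E d) (m : P2 d) (ζ : E d → E d) (y : E d) : E d :=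
  ContinuousLinearMap.adjoint (D m y) (ζ y) +
    ContinuousLinearMap.adjoint (fderiv ℝ ζ y) (A m y) +
    ∫ x, ContinuousLinearMap.adjoint (H m x y) (ζ x) ∂m.1

lemma continuous_adjoint_H (h : HasUniformDerivs U A D H M) (hζ : IsTest ζ) :
    Continuous fun p : E d × E d => ContinuousLinearMap.adjoint (H m p.1 p.2) (ζ p.1) := by
  have h1 := h.continuous_H m
  have h2 := hζ.continuous
  have h3 : Continuous fun p : E d × E d => ContinuousLinearMap.adjoint (H m p.1 p.2) :=
    (ContinuousLinearMap.adjoint (𝕜 := ℝ) (E := E d) (F := E d)).continuous.comp h1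
  fun_prop

lemma norm_adjoint_H_le (h : HasUniformDerivs U A D H M) {B : ℝ} (hB : ∀ x, ‖ζ x‖ ≤ B)
    (x y : E d) : ‖ContinuousLinearMap.adjoint (H m x y) (ζ x)‖ ≤ M * B := by
  refine (ContinuousLinearMap.le_opNorm _ _).trans ?_
  rw [LinearIsometryEquiv.norm_map]
  have := h.nonneg
  gcongr
  · exact h.norm_H m x y
  · exact hB x

lemma isTangent_integral_adjoint_H (h : HasUniformDerivs U A D H M) (hζ : IsTest ζ) :
    IsTangent m fun y => ∫ x, ContinuousLinearMap.adjoint (H m x y) (ζ x) ∂m.1 := by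
  obtain ⟨B, hB0, hB⟩ := hζ.exists_bound
  exact isTangent_integral (M := fun _ => M * B) (fun x => h.tangent_H m x (ζ x))
    (h.continuous_adjoint_H hζ).aestronglyMeasurable (integrable_const _)
    (fun x y => h.norm_adjoint_H_le hB x y)

lemma isTangent_dirGrad (h : HasUniformDerivs U A D H M) (hζ : IsTest ζ) :
    IsTangent m (dirGrad A D H m ζ) :=
  (h.tangent_D m ζ hζ).add (h.isTangent_integral_adjoint_H hζ)

lemma aestronglyMeasurable_integral_adjoint_H (h : HasUniformDerivs U A D H M) (hζ : IsTest ζ) :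
    AEStronglyMeasurable
      (fun y => ∫ x, ContinuousLinearMap.adjoint (H m x y) (ζ x) ∂m.1) m.1 :=
  (h.isTangent_integral_adjoint_H hζ).memLp.1

lemma norm_integral_adjoint_H_le (h : HasUniformDerivs U A D H M) {B : ℝ} (hB : ∀ x, ‖ζ x‖ ≤ B)
    (y : E d) : ‖∫ x, ContinuousLinearMap.adjoint (H m x y) (ζ x) ∂m.1‖ ≤ M * B := by
  refine (norm_integral_le_of_norm_le_const
    (ae_of_all _ fun x => h.norm_adjoint_H_le hB x y)).trans ?_
  simp

lemma aestronglyMeasurable_comp_fst {ν : P2 d} {γ : Measure (E d × E d)}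
    (hγ : γ ∈ couplings m ν) {G : Type*} [TopologicalSpace G] {f : E d → G}
    (hf : AEStronglyMeasurable f m.1) : AEStronglyMeasurable (fun z : E d × E d => f z.1) γ :=
  hf.comp_quasiMeasurePreserving (measurePreserving_fst_of_mem_couplings hγ).quasiMeasurePreserving

lemma integrable_inner_sub {ν : P2 d} {γ : Measure (E d × E d)} (hγ : γ ∈ couplings m ν)
    {f : E d → E d} (hf : AEStronglyMeasurable f m.1) {B : ℝ} (hB : ∀ x, ‖f x‖ ≤ B) :
    Integrable (fun z : E d × E d => inner ℝ (f z.1) (z.2 - z.1)) γ := by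
  refine Integrable.mono' ((integrable_norm_sub_of_mem_couplings hγ).const_mul B)
    ((aestronglyMeasurable_comp_fst hγ hf).inner (by fun_prop)) (ae_of_all _ fun z => ?_)
  refine (norm_inner_le_norm _ _).trans ?_
  gcongr
  exact hB _

lemma integrable_H_apply (h : HasUniformDerivs U A D H M) {ν : P2 d} {γ : Measure (E d × E d)}
    (hγ : γ ∈ couplings m ν) (x : E d) : Integrable (fun z => H m x z.1 (z.2 - z.1)) γ := by
  refine Integrable.mono' ((integrable_norm_sub_of_mem_couplings hγ).const_mul M) ?_
    (ae_of_all _ fun z => (ContinuousLinearMap.le_opNorm _ _).trans ?_)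
  · have h1 : Continuous fun z : E d × E d => H m x z.1 :=
      (h.continuous_H m).comp (by fun_prop : Continuous fun z : E d × E d => (x, z.1))
    exact (h1.clm_apply (by fun_prop)).aestronglyMeasurable
  · gcongr
    exact h.norm_H m x _

lemma norm_integral_H_apply_le (h : HasUniformDerivs U A D H M) {ν : P2 d}
    {γ : Measure (E d × E d)} (hγ : γ ∈ couplings m ν) (x : E d) :
    ‖∫ z, H m x z.1 (z.2 - z.1) ∂γ‖ ≤ M * √(cost γ) := by
  refine (norm_integral_le_of_norm_le
    ((integrable_norm_sub_of_mem_couplings hγ).const_mul M)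
    (ae_of_all _ fun z => (ContinuousLinearMap.le_opNorm _ _).trans
      (mul_le_mul_of_nonneg_right (h.norm_H m x _) (norm_nonneg _)))).trans ?_
  rw [integral_const_mul]
  have := h.nonneg
  gcongr
  exact integral_norm_sub_le_sqrt_cost hγ

lemma integral_add_add {α : Type*} [MeasurableSpace α] {μ : Measure α} {f₁ f₂ f₃ : α → ℝ}
    (h₁ : Integrable f₁ μ) (h₂ : Integrable f₂ μ) (h₃ : Integrable f₃ μ) :
    ∫ x, (f₁ x + f₂ x + f₃ x) ∂μ = ∫ x, f₁ x ∂μ + ∫ x, f₂ x ∂μ + ∫ x, f₃ x ∂μ := by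
  rw [← integral_add h₁ h₂]
  exact integral_add (h₁.add h₂) h₃

lemma integral_sub_sub_add_add {α : Type*} [MeasurableSpace α] {μ : Measure α}
    {f₁ f₂ f₃ f₄ f₅ : α → ℝ} (h₁ : Integrable f₁ μ) (h₂ : Integrable f₂ μ) (h₃ : Integrable f₃ μ)
    (h₄ : Integrable f₄ μ) (h₅ : Integrable f₅ μ) :
    ∫ x, (f₁ x - f₂ x - (f₃ x + f₄ x + f₅ x)) ∂μ =
      ∫ x, f₁ x ∂μ - ∫ x, f₂ x ∂μ - (∫ x, f₃ x ∂μ + ∫ x, f₄ x ∂μ + ∫ x, f₅ x ∂μ) := by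
  rw [← integral_add_add h₃ h₄ h₅, ← integral_sub h₁ h₂]
  exact integral_sub (h₁.sub h₂) ((h₃.add h₄).add h₅)

/-- Exchange of the two integrals against `∇_w² U`. -/
lemma integral_inner_integral_H (h : HasUniformDerivs U A D H M) (hζ : IsTest ζ) {ν : P2 d}
    {γ : Measure (E d × E d)} (hγ : γ ∈ couplings m ν) :
    Integrable (fun z : E d × E d => inner ℝ (∫ z', H m z.1 z'.1 (z'.2 - z'.1) ∂γ) (ζ z.1)) γ ∧
    ∫ z, inner ℝ (∫ z', H m z.1 z'.1 (z'.2 - z'.1) ∂γ) (ζ z.1) ∂γ =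
      ∫ z, inner ℝ (∫ x, ContinuousLinearMap.adjoint (H m x z.1) (ζ x) ∂m.1) (z.2 - z.1) ∂γ := by
  have hp := isProbabilityMeasure_of_mem_couplings hγ
  obtain ⟨B, hB0, hB⟩ := hζ.exists_bound
  have hζc := hζ.continuous
  have hint : Integrable (fun p : (E d × E d) × (E d × E d) =>
      inner ℝ (H m p.1.1 p.2.1 (p.2.2 - p.2.1)) (ζ p.1.1)) (γ.prod γ) := by
    refine Integrable.mono' (((integrable_norm_sub_of_mem_couplings hγ).const_mul
      (M * B)).comp_snd γ) ?_ (ae_of_all _ fun p => ?_)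
    · have h1 : Continuous fun p : (E d × E d) × (E d × E d) => H m p.1.1 p.2.1 :=
        (h.continuous_H m).comp (by fun_prop : Continuous fun p : (E d × E d) × (E d × E d) =>
          (p.1.1, p.2.1))
      have h2 := h1.clm_apply (by fun_prop :
        Continuous fun p : (E d × E d) × (E d × E d) => p.2.2 - p.2.1)
      exact (h2.inner (by fun_prop)).aestronglyMeasurable
    · refine (norm_inner_le_norm _ _).trans ?_
      have h1 : ‖H m p.1.1 p.2.1 (p.2.2 - p.2.1)‖ ≤ M * ‖p.2.2 - p.2.1‖ :=
        (ContinuousLinearMap.le_opNorm _ _).trans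
          (mul_le_mul_of_nonneg_right (h.norm_H m _ _) (norm_nonneg _))
      have := h.nonneg
      calc _ ≤ M * ‖p.2.2 - p.2.1‖ * B := by gcongr; exact hB _
        _ = _ := by ring
  have e1 : ∀ z : E d × E d, inner ℝ (∫ z', H m z.1 z'.1 (z'.2 - z'.1) ∂γ) (ζ z.1) =
      ∫ z', inner ℝ (H m z.1 z'.1 (z'.2 - z'.1)) (ζ z.1) ∂γ := fun z => by
    rw [real_inner_comm, ← integral_inner (h.integrable_H_apply hγ z.1)]
    simp only [real_inner_comm]
  simp only [e1]
  refine ⟨hint.integral_prod_left, ?_⟩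
  rw [integral_integral_swap hint]
  refine integral_congr_ae (ae_of_all _ fun z' => ?_)
  have hi : Integrable (fun x => ContinuousLinearMap.adjoint (H m x z'.1) (ζ x)) m.1 := by
    refine Integrable.of_bound ?_ (M * B) (ae_of_all _ fun x => h.norm_adjoint_H_le hB x z'.1)
    exact ((h.continuous_adjoint_H hζ).comp
      (by fun_prop : Continuous fun x : E d => (x, z'.1))).aestronglyMeasurable
  simp only
  rw [real_inner_comm, ← integral_inner hi,
    ← integral_fst_of_mem_couplings hγ (hi.const_inner _).aestronglyMeasurable]
  refine integral_congr_ae (ae_of_all _ fun z => ?_)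
  simp only
  rw [ContinuousLinearMap.adjoint_inner_right]

lemma integrable_inner_A (h : HasUniformDerivs U A D H M) (hζ : IsTest ζ) (μ : P2 d) :
    Integrable (fun x => inner ℝ (A μ x) (ζ x)) μ.1 := by
  obtain ⟨B, hB0, hB⟩ := hζ.exists_bound
  have := h.nonneg
  refine Integrable.of_bound
    ((h.continuous_A μ).inner hζ.continuous).aestronglyMeasurable (M * B)
    (ae_of_all _ fun x => (norm_inner_le_norm _ _).trans ?_)
  gcongr
  · exact h.norm_A μ x
  · exact hB x

lemma integrable_inner_adjoint_D (h : HasUniformDerivs U A D H M) (hζ : IsTest ζ) {ν : P2 d}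
    {γ : Measure (E d × E d)} (hγ : γ ∈ couplings m ν) :
    Integrable (fun z : E d × E d =>
      inner ℝ (ContinuousLinearMap.adjoint (D m z.1) (ζ z.1)) (z.2 - z.1)) γ := by
  obtain ⟨B, hB0, hB⟩ := hζ.exists_bound
  have hM := h.nonneg
  have hD : Continuous fun x => ContinuousLinearMap.adjoint (D m x) :=
    (ContinuousLinearMap.adjoint (𝕜 := ℝ) (E := E d) (F := E d)).continuous.comp (h.continuous_D m)
  refine integrable_inner_sub hγ (f := fun x => ContinuousLinearMap.adjoint (D m x) (ζ x))
    (hD.clm_apply hζ.continuous).aestronglyMeasurable (B := M * B) fun x => ?_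
  refine (ContinuousLinearMap.le_opNorm _ _).trans ?_
  rw [LinearIsometryEquiv.norm_map]
  exact mul_le_mul (h.norm_D m x) (hB x) (norm_nonneg _) hM

lemma integrable_inner_adjoint_fderiv (h : HasUniformDerivs U A D H M) (hζ : IsTest ζ) {ν : P2 d}
    {γ : Measure (E d × E d)} (hγ : γ ∈ couplings m ν) :
    Integrable (fun z : E d × E d =>
      inner ℝ (ContinuousLinearMap.adjoint (fderiv ℝ ζ z.1) (A m z.1)) (z.2 - z.1)) γ := by
  obtain ⟨B, hB0, hB⟩ := hζ.fderiv.exists_bound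
  have hD : Continuous fun x => ContinuousLinearMap.adjoint (fderiv ℝ ζ x) :=
    (ContinuousLinearMap.adjoint (𝕜 := ℝ) (E := E d) (F := E d)).continuous.comp
      hζ.fderiv.continuous
  refine integrable_inner_sub hγ
    (f := fun x => ContinuousLinearMap.adjoint (fderiv ℝ ζ x) (A m x))
    (hD.clm_apply (h.continuous_A m)).aestronglyMeasurable (B := B * M) fun x => ?_
  refine (ContinuousLinearMap.le_opNorm _ _).trans ?_
  rw [LinearIsometryEquiv.norm_map]
  exact mul_le_mul (hB x) (h.norm_A m x) (norm_nonneg _) hB0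

/-- Product rule for ⟨A ν y, ζ y⟩. The remainder consists of the error of `expansion` paired with ζ,
the first order increment of A paired with ζ y - ζ x, and the Taylor error of ζ; each is of second
order. -/
lemma exists_norm_remainder_le (h : HasUniformDerivs U A D H M) (hζ : IsTest ζ) :
    ∃ K, 0 ≤ K ∧ ∀ ν, ∀ γ ∈ couplings m ν, ∀ x y,
      ‖inner ℝ (A ν y) (ζ y) - inner ℝ (A m x) (ζ x) -
        (inner ℝ (D m x (y - x) + ∫ z, H m x z.1 (z.2 - z.1) ∂γ) (ζ x) +
          inner ℝ (A m x) (fderiv ℝ ζ x (y - x)))‖ ≤ K * (‖y - x‖ ^ 2 + cost γ) := by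
  have hM := h.nonneg
  obtain ⟨B, hB0, hB⟩ := hζ.exists_bound
  obtain ⟨L, hL0, hL⟩ := hζ.exists_lipschitz
  obtain ⟨L₂, hL₂0, hL₂⟩ := hζ.exists_taylor
  refine ⟨2 * M * B + 2 * M * L + M * L₂, by positivity, fun ν γ hγ x y => ?_⟩
  set r := D m x (y - x) + ∫ z', H m x z'.1 (z'.2 - z'.1) ∂γ with hr
  have e : inner ℝ (A ν y) (ζ y) - inner ℝ (A m x) (ζ x) -
        (inner ℝ r (ζ x) + inner ℝ (A m x) (fderiv ℝ ζ x (y - x))) =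
      inner ℝ (A ν y - A m x - r) (ζ y) + inner ℝ r (ζ y - ζ x) +
      inner ℝ (A m x) (ζ y - ζ x - fderiv ℝ ζ x (y - x)) := by
    simp only [inner_sub_left, inner_sub_right]
    ring
  have hrn : ‖r‖ ≤ M * (‖y - x‖ + √(cost γ)) := by
    refine (norm_add_le _ _).trans ?_
    rw [mul_add]
    refine add_le_add ((ContinuousLinearMap.le_opNorm _ _).trans ?_)
      (h.norm_integral_H_apply_le hγ _)
    gcongr
    exact h.norm_D m _
  rw [e]
  refine (norm_add₃_le).trans ?_
  have h1 : ‖inner ℝ (A ν y - A m x - r) (ζ y)‖ ≤ 2 * M * (‖y - x‖ ^ 2 + cost γ) * B := by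
    refine (norm_inner_le_norm _ _).trans ?_
    have := cost_nonneg γ
    gcongr
    · exact h.expansion hγ x y
    · exact hB _
  have h2 : ‖inner ℝ r (ζ y - ζ x)‖ ≤ M * (‖y - x‖ + √(cost γ)) * (L * ‖y - x‖) := by
    refine (norm_inner_le_norm _ _).trans ?_
    gcongr
    exact hL _ _
  have h3 : ‖inner ℝ (A m x) (ζ y - ζ x - fderiv ℝ ζ x (y - x))‖ ≤ M * (L₂ * ‖y - x‖ ^ 2) := by
    refine (norm_inner_le_norm _ _).trans ?_
    gcongr
    · exact h.norm_A m _
    · exact hL₂ _ _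
  have h4 : (‖y - x‖ + √(cost γ)) * ‖y - x‖ ≤ 2 * (‖y - x‖ ^ 2 + cost γ) := by
    nlinarith [sq_nonneg (√(cost γ) - ‖y - x‖), Real.sq_sqrt (cost_nonneg γ),
      sq_nonneg ‖y - x‖, cost_nonneg γ]
  have h5 := mul_le_mul_of_nonneg_left h4 (mul_nonneg hM hL0)
  have h6 : M * L₂ * ‖y - x‖ ^ 2 ≤ M * L₂ * (‖y - x‖ ^ 2 + cost γ) := by
    gcongr
    linarith [cost_nonneg γ]
  linarith

/-- Integrate the pointwise product rule over γ. Adjoints move the operators onto ζ, and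
`integral_inner_integral_H` turns the double integral over plans into an integral against y - x, so
that the linear part is given by `dirGrad`. -/
lemma hasQuadExpansion_dirDeriv (h : HasUniformDerivs U A D H M) (hζ : IsTest ζ) :
    HasQuadExpansion (fun ν => dirDeriv U ν ζ) m (dirGrad A D H m ζ) := by
  obtain ⟨B, hB0, hB⟩ := hζ.exists_bound
  obtain ⟨K, hK0, hK⟩ := h.exists_norm_remainder_le (m := m) hζ
  -- The pointwise bound contains |y - x|² and the constant cost γ; each of them integrates to cost
  -- γ.
  refine ⟨2 * K, by positivity, fun ν γ hγ => ?_⟩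
  have hp := isProbabilityMeasure_of_mem_couplings hγ
  simp only [h.dirDeriv_eq]
  have iA := h.integrable_inner_A hζ
  set R : E d × E d → ℝ := fun z => inner ℝ (A ν z.2) (ζ z.2) - inner ℝ (A m z.1) (ζ z.1) -
    (inner ℝ (D m z.1 (z.2 - z.1) + ∫ z', H m z.1 z'.1 (z'.2 - z'.1) ∂γ) (ζ z.1) +
      inner ℝ (A m z.1) (fderiv ℝ ζ z.1 (z.2 - z.1)))
  have hR : ∀ z, ‖R z‖ ≤ K * (‖z.2 - z.1‖ ^ 2 + cost γ) := fun z => hK ν γ hγ z.1 z.2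
  have i1 : Integrable (fun z : E d × E d => inner ℝ (A ν z.2) (ζ z.2)) γ :=
    (measurePreserving_snd_of_mem_couplings hγ).integrable_comp_of_integrable (iA ν)
  have i2 : Integrable (fun z : E d × E d => inner ℝ (A m z.1) (ζ z.1)) γ :=
    (measurePreserving_fst_of_mem_couplings hγ).integrable_comp_of_integrable (iA m)
  have i3 := h.integrable_inner_adjoint_D hζ hγ
  have i4 := h.integrable_inner_adjoint_fderiv hζ hγ
  have i5 : Integrable (fun z : E d × E d => inner ℝ
      (∫ x, ContinuousLinearMap.adjoint (H m x z.1) (ζ x) ∂m.1) (z.2 - z.1)) γ :=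
    integrable_inner_sub hγ (h.aestronglyMeasurable_integral_adjoint_H hζ)
      (h.norm_integral_adjoint_H_le hB)
  obtain ⟨i6, e6⟩ := h.integral_inner_integral_H hζ hγ
  have hRe : ∀ z, R z = inner ℝ (A ν z.2) (ζ z.2) - inner ℝ (A m z.1) (ζ z.1) -
      (inner ℝ (ContinuousLinearMap.adjoint (D m z.1) (ζ z.1)) (z.2 - z.1) +
        inner ℝ (∫ z', H m z.1 z'.1 (z'.2 - z'.1) ∂γ) (ζ z.1) +
        inner ℝ (ContinuousLinearMap.adjoint (fderiv ℝ ζ z.1) (A m z.1)) (z.2 - z.1)) := by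
    intro z
    simp only [R, inner_add_left, ContinuousLinearMap.adjoint_inner_left]
    rw [real_inner_comm (ζ z.1) (D m z.1 (z.2 - z.1))]
  have e : (∫ x, inner ℝ (A ν x) (ζ x) ∂ν.1) - ∫ x, inner ℝ (A m x) (ζ x) ∂m.1 -
      ∫ z, inner ℝ (dirGrad A D H m ζ z.1) (z.2 - z.1) ∂γ = ∫ z, R z ∂γ := by
    rw [integral_congr_ae (ae_of_all _ hRe), integral_sub_sub_add_add i1 i2 i3 i6 i4, e6,
      integral_snd_of_mem_couplings hγ (iA ν).1, integral_fst_of_mem_couplings hγ (iA m).1]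
    simp only [dirGrad, inner_add_left]
    rw [integral_add_add i3 i4 i5]
    ring
  rw [e, ← Real.norm_eq_abs]
  have iK : Integrable (fun z : E d × E d => K * (‖z.2 - z.1‖ ^ 2 + cost γ)) γ :=
    ((integrable_normSq_of_mem_couplings hγ).add (integrable_const _)).const_mul _
  refine (norm_integral_le_of_norm_le iK (ae_of_all _ hR)).trans_eq ?_
  rw [integral_const_mul, integral_add (integrable_normSq_of_mem_couplings hγ)
    (integrable_const _), ← cost_eq]
  simp
  ring

end HasUniformDerivs

/-! ### Norm inequalities in L²(m) -/

section L2norms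

variable {d : ℕ} {m : P2 d}

lemma integrable_norm_mul_norm (u v : L2 m) : Integrable (fun x => ‖u x‖ * ‖v x‖) m.1 :=
  (Lp.memLp u).norm.integrable_mul (Lp.memLp v).norm

lemma integral_norm_mul_norm_le (u v : L2 m) : ∫ x, ‖u x‖ * ‖v x‖ ∂m.1 ≤ ‖u‖ * ‖v‖ := by
  have h := real_inner_le_norm ((Lp.memLp u).norm.toLp _) ((Lp.memLp v).norm.toLp _)
  rw [MeasureTheory.L2.inner_def, Lp.norm_toLp, Lp.norm_toLp, eLpNorm_norm, eLpNorm_norm] at h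
  refine le_of_eq_of_le (integral_congr_ae ?_) h
  filter_upwards [(Lp.memLp u).norm.coeFn_toLp, (Lp.memLp v).norm.coeFn_toLp] with x hu hv
  rw [hu, hv]
  simp [mul_comm]

lemma integral_norm_le_norm (u : L2 m) : ∫ x, ‖u x‖ ∂m.1 ≤ ‖u‖ := by
  have h : eLpNorm u 1 m.1 ≤ eLpNorm u 2 m.1 :=
    eLpNorm_le_eLpNorm_of_exponent_le (by norm_num) (Lp.aestronglyMeasurable u)
  rw [integral_norm_eq_lintegral_enorm (Lp.aestronglyMeasurable u), Lp.norm_def,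
    ← eLpNorm_one_eq_lintegral_enorm]
  exact ENNReal.toReal_mono (Lp.eLpNorm_ne_top u) h

end L2norms

/-! ### The Hessian as a bounded bilinear form -/

namespace HasUniformDerivs

variable {d : ℕ} {U : P2 d → ℝ} {A : P2 d → E d → E d} {D : P2 d → E d → E d →L[ℝ] E d}
  {H : P2 d → E d → E d → E d →L[ℝ] E d} {M : ℝ} {m : P2 d}

lemma integrable_inner_D (h : HasUniformDerivs U A D H M) (u v : L2 m) :
    Integrable (fun x => inner ℝ (v x) (D m x (u x))) m.1 := by
  refine Integrable.mono' ((integrable_norm_mul_norm u v).const_mul M)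
    ((Lp.aestronglyMeasurable v).inner
      ((ContinuousLinearMap.id ℝ (E d →L[ℝ] E d)).aestronglyMeasurable_comp₂
        (h.continuous_D m).aestronglyMeasurable (Lp.aestronglyMeasurable u)))
    (ae_of_all _ fun x => ?_)
  refine (norm_inner_le_norm _ _).trans ?_
  calc ‖v x‖ * ‖D m x (u x)‖ ≤ ‖v x‖ * (M * ‖u x‖) := by
        gcongr
        exact (ContinuousLinearMap.le_opNorm _ _).trans (by gcongr; exact h.norm_D m x)
    _ = _ := by ring

lemma norm_integral_inner_D_le (h : HasUniformDerivs U A D H M) (u v : L2 m) :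
    ‖∫ x, inner ℝ (v x) (D m x (u x)) ∂m.1‖ ≤ M * ‖u‖ * ‖v‖ := by
  refine (norm_integral_le_of_norm_le ((integrable_norm_mul_norm u v).const_mul M)
    (ae_of_all _ fun x => ?_)).trans ?_
  · refine (norm_inner_le_norm _ _).trans ?_
    calc ‖v x‖ * ‖D m x (u x)‖ ≤ ‖v x‖ * (M * ‖u x‖) := by
          gcongr
          exact (ContinuousLinearMap.le_opNorm _ _).trans (by gcongr; exact h.norm_D m x)
      _ = _ := by ring
  · rw [integral_const_mul, mul_assoc]
    have := h.nonneg
    gcongr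
    exact integral_norm_mul_norm_le u v

lemma norm_inner_H_le (h : HasUniformDerivs U A D H M) (u v : E d → E d) (p : E d × E d) :
    ‖inner ℝ (v p.1) (H m p.1 p.2 (u p.2))‖ ≤ M * (‖v p.1‖ * ‖u p.2‖) := by
  refine (norm_inner_le_norm _ _).trans ?_
  calc ‖v p.1‖ * ‖H m p.1 p.2 (u p.2)‖ ≤ ‖v p.1‖ * (M * ‖u p.2‖) := by
        gcongr
        exact (ContinuousLinearMap.le_opNorm _ _).trans (by gcongr; exact h.norm_H m _ _)
    _ = _ := by ring

lemma integrable_inner_H (h : HasUniformDerivs U A D H M) (u v : L2 m) :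
    Integrable (fun p : E d × E d => inner ℝ (v p.1) (H m p.1 p.2 (u p.2))) (m.1.prod m.1) := by
  refine Integrable.mono'
    (((integrable_L2 v).norm.mul_prod (integrable_L2 u).norm).const_mul M)
    ((Lp.aestronglyMeasurable v).comp_fst.inner
      ((ContinuousLinearMap.id ℝ (E d →L[ℝ] E d)).aestronglyMeasurable_comp₂
        (h.continuous_H m).aestronglyMeasurable (Lp.aestronglyMeasurable u).comp_snd))
    (ae_of_all _ fun p => ?_)
  exact h.norm_inner_H_le u v p

lemma norm_integral_inner_H_le (h : HasUniformDerivs U A D H M) (u v : L2 m) :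
    ‖∫ p, inner ℝ (v p.1) (H m p.1 p.2 (u p.2)) ∂(m.1.prod m.1)‖ ≤ M * ‖u‖ * ‖v‖ := by
  refine (norm_integral_le_of_norm_le
    (((integrable_L2 v).norm.mul_prod (integrable_L2 u).norm).const_mul M)
    (ae_of_all _ fun p => h.norm_inner_H_le u v p)).trans ?_
  rw [integral_const_mul, integral_prod_mul (fun x => ‖v x‖) (fun x => ‖u x‖), mul_assoc,
    mul_comm ‖u‖]
  have := h.nonneg
  gcongr
  · exact integral_norm_le_norm v
  · exact integral_norm_le_norm u

/-- The bilinear form on `L²(m)` given by the second derivatives. -/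
lemma exists_bilinear (h : HasUniformDerivs U A D H M) (m : P2 d) :
    ∃ B : tangent m →L[ℝ] tangent m →L[ℝ] ℝ, ∀ u v : tangent m,
      B u v = ∫ x, inner ℝ ((v : L2 m) x) (D m x ((u : L2 m) x)) ∂m.1 +
        ∫ p, inner ℝ ((v : L2 m) p.1) (H m p.1 p.2 ((u : L2 m) p.2)) ∂(m.1.prod m.1) := by
  let b : L2 m → L2 m → ℝ := fun u v => ∫ x, inner ℝ (v x) (D m x (u x)) ∂m.1 +
    ∫ p, inner ℝ (v p.1) (H m p.1 p.2 (u p.2)) ∂(m.1.prod m.1)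
  have hfst : ∀ {f g : E d → E d}, f =ᵐ[m.1] g →
      ∀ᵐ p : E d × E d ∂(m.1.prod m.1), f p.1 = g p.1 := fun hfg =>
    Measure.quasiMeasurePreserving_fst.ae hfg
  have hsnd : ∀ {f g : E d → E d}, f =ᵐ[m.1] g →
      ∀ᵐ p : E d × E d ∂(m.1.prod m.1), f p.2 = g p.2 := fun hfg =>
    Measure.quasiMeasurePreserving_snd.ae hfg
  have add_left : ∀ u u' v, b (u + u') v = b u v + b u' v := by
    intro u u' v
    have h1 : ∫ x, inner ℝ (v x) (D m x ((u + u' : L2 m) x)) ∂m.1 =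
        ∫ x, inner ℝ (v x) (D m x (u x)) ∂m.1 + ∫ x, inner ℝ (v x) (D m x (u' x)) ∂m.1 := by
      rw [← integral_add (h.integrable_inner_D u v) (h.integrable_inner_D u' v)]
      refine integral_congr_ae ?_
      filter_upwards [Lp.coeFn_add u u'] with x hx
      rw [hx, Pi.add_apply, map_add, inner_add_right]
    have h2 : ∫ p, inner ℝ (v p.1) (H m p.1 p.2 ((u + u' : L2 m) p.2)) ∂(m.1.prod m.1) =
        ∫ p, inner ℝ (v p.1) (H m p.1 p.2 (u p.2)) ∂(m.1.prod m.1) +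
          ∫ p, inner ℝ (v p.1) (H m p.1 p.2 (u' p.2)) ∂(m.1.prod m.1) := by
      rw [← integral_add (h.integrable_inner_H u v) (h.integrable_inner_H u' v)]
      refine integral_congr_ae ?_
      filter_upwards [hsnd (Lp.coeFn_add u u')] with x hx
      rw [hx, Pi.add_apply, map_add, inner_add_right]
    simp only [b, h1, h2]
    ring
  have add_right : ∀ u v v', b u (v + v') = b u v + b u v' := by
    intro u v v'
    have h1 : ∫ x, inner ℝ ((v + v' : L2 m) x) (D m x (u x)) ∂m.1 =
        ∫ x, inner ℝ (v x) (D m x (u x)) ∂m.1 + ∫ x, inner ℝ (v' x) (D m x (u x)) ∂m.1 := by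
      rw [← integral_add (h.integrable_inner_D u v) (h.integrable_inner_D u v')]
      refine integral_congr_ae ?_
      filter_upwards [Lp.coeFn_add v v'] with x hx
      rw [hx, Pi.add_apply, inner_add_left]
    have h2 : ∫ p, inner ℝ ((v + v' : L2 m) p.1) (H m p.1 p.2 (u p.2)) ∂(m.1.prod m.1) =
        ∫ p, inner ℝ (v p.1) (H m p.1 p.2 (u p.2)) ∂(m.1.prod m.1) +
          ∫ p, inner ℝ (v' p.1) (H m p.1 p.2 (u p.2)) ∂(m.1.prod m.1) := by
      rw [← integral_add (h.integrable_inner_H u v) (h.integrable_inner_H u v')]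
      refine integral_congr_ae ?_
      filter_upwards [hfst (Lp.coeFn_add v v')] with x hx
      rw [hx, Pi.add_apply, inner_add_left]
    simp only [b, h1, h2]
    ring
  have smul_left : ∀ (c : ℝ) u v, b (c • u) v = c • b u v := by
    intro c u v
    have h1 : ∫ x, inner ℝ (v x) (D m x ((c • u : L2 m) x)) ∂m.1 =
        c * ∫ x, inner ℝ (v x) (D m x (u x)) ∂m.1 := by
      rw [← integral_const_mul]
      refine integral_congr_ae ?_
      filter_upwards [Lp.coeFn_smul c u] with x hx
      rw [hx, Pi.smul_apply, map_smul, inner_smul_right]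
    have h2 : ∫ p, inner ℝ (v p.1) (H m p.1 p.2 ((c • u : L2 m) p.2)) ∂(m.1.prod m.1) =
        c * ∫ p, inner ℝ (v p.1) (H m p.1 p.2 (u p.2)) ∂(m.1.prod m.1) := by
      rw [← integral_const_mul]
      refine integral_congr_ae ?_
      filter_upwards [hsnd (Lp.coeFn_smul c u)] with x hx
      rw [hx, Pi.smul_apply, map_smul, inner_smul_right]
    simp only [b, h1, h2, smul_eq_mul]
    ring
  have smul_right : ∀ (c : ℝ) u v, b u (c • v) = c • b u v := by
    intro c u v
    have h1 : ∫ x, inner ℝ ((c • v : L2 m) x) (D m x (u x)) ∂m.1 =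
        c * ∫ x, inner ℝ (v x) (D m x (u x)) ∂m.1 := by
      rw [← integral_const_mul]
      refine integral_congr_ae ?_
      filter_upwards [Lp.coeFn_smul c v] with x hx
      rw [hx, Pi.smul_apply, real_inner_smul_left]
    have h2 : ∫ p, inner ℝ ((c • v : L2 m) p.1) (H m p.1 p.2 (u p.2)) ∂(m.1.prod m.1) =
        c * ∫ p, inner ℝ (v p.1) (H m p.1 p.2 (u p.2)) ∂(m.1.prod m.1) := by
      rw [← integral_const_mul]
      refine integral_congr_ae ?_
      filter_upwards [hfst (Lp.coeFn_smul c v)] with x hx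
      rw [hx, Pi.smul_apply, real_inner_smul_left]
    simp only [b, h1, h2, smul_eq_mul]
    ring
  let L : tangent m →ₗ[ℝ] tangent m →ₗ[ℝ] ℝ := LinearMap.mk₂ ℝ (fun u v => b u v)
    (fun u u' v => add_left u u' v) (fun c u v => smul_left c u v)
    (fun u v v' => add_right u v v') (fun c u v => smul_right c u v)
  refine ⟨L.mkContinuous₂ (2 * M) fun u v => ?_, fun u v => rfl⟩
  refine (norm_add_le _ _).trans ?_
  have h1 := h.norm_integral_inner_D_le (u : L2 m) v
  have h2 := h.norm_integral_inner_H_le (u : L2 m) v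
  rw [Submodule.norm_coe, Submodule.norm_coe] at h1 h2
  linarith

/-- The term of `dirGrad` containing the derivative of ζ₂ is exactly the one subtracted in
`barHess`. What remains involves only the values of the fields, which is why it extends continuously
to the tangent space. -/
lemma barHess_eq (h : HasUniformDerivs U A D H M) {ζ₁ ζ₂ : E d → E d} (h₁ : IsTest ζ₁)
    (h₂ : IsTest ζ₂) :
    barHess U m ζ₁ ζ₂ = ∫ x, inner ℝ (ζ₂ x) (D m x (ζ₁ x)) ∂m.1 +
      ∫ p, inner ℝ (ζ₂ p.1) (H m p.1 p.2 (ζ₁ p.2)) ∂(m.1.prod m.1) := by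
  have hM := h.nonneg
  have hT := h.isTangent_dirGrad (m := m) h₂
  obtain ⟨B₁, hB₁0, hB₁⟩ := h₁.exists_bound
  obtain ⟨B₂, hB₂0, hB₂⟩ := h₂.exists_bound
  obtain ⟨B₂', hB₂'0, hB₂'⟩ := h₂.fderiv.exists_bound
  have c₁ := h₁.continuous
  have c₂ := h₂.continuous
  have c₂' := h₂.fderiv.continuous
  have cA := h.continuous_A m
  have cD := h.continuous_D m
  have cH := h.continuous_H m
  have e0 : dirDeriv (fun ν => dirDeriv U ν ζ₂) m ζ₁ =
      ∫ x, inner ℝ (dirGrad A D H m ζ₂ x) (ζ₁ x) ∂m.1 := by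
    rw [dirDeriv, (h.hasQuadExpansion_dirDeriv h₂).wGrad_eq hT.memLp (hT.toLp_mem _)]
    refine integral_congr_ae ?_
    filter_upwards [hT.memLp.coeFn_toLp] with x hx
    rw [hx]
  have i1 : Integrable (fun x => inner ℝ (ζ₂ x) (D m x (ζ₁ x))) m.1 := by
    refine Integrable.of_bound (c₂.inner (cD.clm_apply c₁)).aestronglyMeasurable
      (B₂ * (M * B₁)) (ae_of_all _ fun x => (norm_inner_le_norm _ _).trans ?_)
    exact mul_le_mul (hB₂ x) ((ContinuousLinearMap.le_opNorm _ _).trans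
      (mul_le_mul (h.norm_D m x) (hB₁ x) (norm_nonneg _) hM)) (norm_nonneg _) hB₂0
  have i2 : Integrable (fun x => inner ℝ (A m x) (fderiv ℝ ζ₂ x (ζ₁ x))) m.1 := by
    refine Integrable.of_bound (cA.inner (c₂'.clm_apply c₁)).aestronglyMeasurable
      (M * (B₂' * B₁)) (ae_of_all _ fun x => (norm_inner_le_norm _ _).trans ?_)
    exact mul_le_mul (h.norm_A m x) ((ContinuousLinearMap.le_opNorm _ _).trans
      (mul_le_mul (hB₂' x) (hB₁ x) (norm_nonneg _) hB₂'0)) (norm_nonneg _) hM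
  have i4 : Integrable (fun p : E d × E d => inner ℝ (ζ₂ p.1) (H m p.1 p.2 (ζ₁ p.2)))
      (m.1.prod m.1) := by
    refine Integrable.of_bound ((c₂.comp continuous_fst).inner
      (cH.clm_apply (c₁.comp continuous_snd))).aestronglyMeasurable
      (B₂ * (M * B₁)) (ae_of_all _ fun p => (norm_inner_le_norm _ _).trans ?_)
    exact mul_le_mul (hB₂ _) ((ContinuousLinearMap.le_opNorm _ _).trans
      (mul_le_mul (h.norm_H m _ _) (hB₁ _) (norm_nonneg _) hM)) (norm_nonneg _) hB₂0
  have e3 : ∀ y, inner ℝ (∫ x, ContinuousLinearMap.adjoint (H m x y) (ζ₂ x) ∂m.1) (ζ₁ y) =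
      ∫ x, inner ℝ (ζ₂ x) (H m x y (ζ₁ y)) ∂m.1 := by
    intro y
    have hi : Integrable (fun x => ContinuousLinearMap.adjoint (H m x y) (ζ₂ x)) m.1 := by
      refine Integrable.of_bound ?_ (M * B₂) (ae_of_all _ fun x => h.norm_adjoint_H_le hB₂ x y)
      exact ((h.continuous_adjoint_H h₂).comp
        (by fun_prop : Continuous fun x : E d => (x, y))).aestronglyMeasurable
    rw [real_inner_comm, ← integral_inner hi]
    refine integral_congr_ae (ae_of_all _ fun x => ?_)
    simp only
    rw [ContinuousLinearMap.adjoint_inner_right, real_inner_comm]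
  have e4 : ∫ p, inner ℝ (ζ₂ p.1) (H m p.1 p.2 (ζ₁ p.2)) ∂(m.1.prod m.1) =
      ∫ y, ∫ x, inner ℝ (ζ₂ x) (H m x y (ζ₁ y)) ∂m.1 ∂m.1 := integral_prod_symm _ i4
  have i3 : Integrable (fun y => ∫ x, inner ℝ (ζ₂ x) (H m x y (ζ₁ y)) ∂m.1) m.1 :=
    i4.integral_prod_right
  rw [barHess, e0, h.dirDeriv_eq, e4, sub_eq_iff_eq_add, add_right_comm,
    ← integral_add_add i1 i2 i3]
  refine integral_congr_ae (ae_of_all _ fun x => ?_)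
  simp only [dirGrad, inner_add_left, ContinuousLinearMap.adjoint_inner_left, e3]

lemma exists_hasHessian (h : HasUniformDerivs U A D H M) (m : P2 d) :
    ∃ B : tangent m →L[ℝ] tangent m →L[ℝ] ℝ, HasHessian U m B ∧ ∀ u v : tangent m,
      B u v = ∫ x, inner ℝ ((v : L2 m) x) (D m x ((u : L2 m) x)) ∂m.1 +
        ∫ p, inner ℝ ((v : L2 m) p.1) (H m p.1 p.2 ((u : L2 m) p.2)) ∂(m.1.prod m.1) := by
  obtain ⟨B, hB⟩ := h.exists_bilinear m
  refine ⟨B, ⟨Eventually.of_forall h.wDifferentiableAt, fun ζ hζ => ?_, ?_⟩, hB⟩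
  · have hT := h.isTangent_dirGrad (m := m) hζ
    exact (h.hasQuadExpansion_dirDeriv hζ).wDifferentiableAt hT.memLp (hT.toLp_mem _)
  · intro φ ψ hφ hψ u v hu hv
    rw [hB, h.barHess_eq hφ.gradient hψ.gradient]
    congr 1
    · refine integral_congr_ae ?_
      filter_upwards [hu, hv] with x hx hx'
      rw [hx, hx']
    · refine integral_congr_ae ?_
      filter_upwards [Measure.quasiMeasurePreserving_fst.ae hv,
        Measure.quasiMeasurePreserving_snd.ae hu] with x hx hx'
      rw [hx, hx']

end HasUniformDerivs

/-! ### The Laplacian -/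

section Laplacian

variable {d : ℕ}

lemma gradient_coord (i : Fin d) (x : E d) :
    gradient (fun x : E d => x i) x = EuclideanSpace.single i 1 := by
  have h : HasFDerivAt (fun x : E d => x i) (EuclideanSpace.proj i : E d →L[ℝ] ℝ) x :=
    (EuclideanSpace.proj i : E d →L[ℝ] ℝ).hasFDerivAt
  rw [gradient, h.fderiv, LinearIsometryEquiv.symm_apply_eq]
  ext v
  simp [EuclideanSpace.inner_single_left]

/-- A constant field is not compactly supported, but it is the gradient of a coordinate function,
whose gradient is bounded. -/
lemma isTangent_single (m : P2 d) (i : Fin d) :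
    IsTangent m fun _ => EuclideanSpace.single i (1 : ℝ) := by
  refine IsTangent.congr (isTangent_gradient (f := fun x : E d => x i) (M := 1) ?_ fun x => ?_)
    (gradient_coord i)
  · exact (EuclideanSpace.proj i : E d →L[ℝ] ℝ).contDiff
  · rw [gradient_coord]
    simp

lemma hasQuadExpansion_moment (m : P2 d) (i : Fin d) :
    HasQuadExpansion (fun ν : P2 d => ∫ x, x i ∂ν.1) m
      (fun _ => EuclideanSpace.single i (1 : ℝ)) := by
  -- The moment is linear in the measure and in x, so its expansion has no error.
  refine ⟨0, le_rfl, fun ν γ hγ => ?_⟩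
  beta_reduce
  have hi : ∀ μ : P2 d, Integrable (fun x : E d => x i) μ.1 := fun μ =>
    (EuclideanSpace.proj i : E d →L[ℝ] ℝ).integrable_comp
      ((memLp_id μ).integrable (by norm_num))
  have i1 : Integrable (fun z : E d × E d => z.2 i) γ :=
    (measurePreserving_snd_of_mem_couplings hγ).integrable_comp_of_integrable (hi ν)
  have i2 : Integrable (fun z : E d × E d => z.1 i) γ :=
    (measurePreserving_fst_of_mem_couplings hγ).integrable_comp_of_integrable (hi m)
  rw [← integral_snd_of_mem_couplings hγ (hi ν).1, ← integral_fst_of_mem_couplings hγ (hi m).1,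
    ← integral_sub i1 i2]
  simp [EuclideanSpace.inner_single_left]

/-- The trace of an operator on `ℝ^d`. -/
def opTrace (d : ℕ) : (E d →L[ℝ] E d) →L[ℝ] ℝ :=
  ∑ i : Fin d, (innerSL ℝ (EuclideanSpace.single i (1 : ℝ))).comp
    (ContinuousLinearMap.apply ℝ (E d) (EuclideanSpace.single i (1 : ℝ)))

lemma opTrace_apply (L : E d →L[ℝ] E d) :
    opTrace d L = ∑ i : Fin d, inner ℝ (EuclideanSpace.single i (1 : ℝ))
      (L (EuclideanSpace.single i (1 : ℝ))) := by
  simp [opTrace]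

/-- The perturbed Laplacian in terms of the second derivatives. -/
def traceLaplacian (ε : ℝ) (m : P2 d) (D : E d → E d →L[ℝ] E d) (H : E d → E d → E d →L[ℝ] E d) :
    ℝ :=
  (1 + ε) * ∫ x, opTrace d (D x) ∂m.1 + ∫ p, opTrace d (H p.1 p.2) ∂(m.1.prod m.1)

variable {U : P2 d → ℝ} {A : P2 d → E d → E d} {D : P2 d → E d → E d →L[ℝ] E d}
  {H : P2 d → E d → E d → E d →L[ℝ] E d} {M : ℝ}

/-- The fields ζᵢ are the constants e_i, on which the Hessian gives ∫ tr D + ∬ tr H. The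
perturbation contributes ε ∫ tr D once more, hence the factor 1 + ε. -/
lemma HasUniformDerivs.hasWLaplacianReal (h : HasUniformDerivs U A D H M) (ε : ℝ) (m : P2 d) :
    HasWLaplacianReal ε U m (traceLaplacian ε m (D m) (H m)) := by
  obtain ⟨B, hB, hBe⟩ := h.exists_hasHessian m
  have hT := isTangent_single m
  let ζ : Fin d → tangent m := fun i => ⟨(hT i).memLp.toLp _, (hT i).toLp_mem _⟩
  have hζ : ∀ i, ((ζ i : L2 m) : E d → E d) =ᵐ[m.1] fun _ => EuclideanSpace.single i (1 : ℝ) :=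
    fun i => (hT i).memLp.coeFn_toLp
  refine ⟨A, D, H, h.isTwiceDifferentiable, B, hB, ζ, fun i => ?_, ?_⟩
  · exact ((hasQuadExpansion_moment m i).wGrad_eq (hT i).memLp ((hT i).toLp_mem _)).symm
  · have cD := h.continuous_D m
    have cH := h.continuous_H m
    have i1 : ∀ i : Fin d, Integrable (fun x => inner ℝ (EuclideanSpace.single i (1 : ℝ))
        (D m x (EuclideanSpace.single i (1 : ℝ)))) m.1 := fun i => by
      refine Integrable.of_bound (Continuous.aestronglyMeasurable
        (continuous_const.inner (cD.clm_apply continuous_const))) M (ae_of_all _ fun x => ?_)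
      refine (norm_inner_le_norm _ _).trans ?_
      simpa using ((D m x).le_opNorm (EuclideanSpace.single i (1 : ℝ))).trans
        (mul_le_mul_of_nonneg_right (h.norm_D m x) (norm_nonneg _))
    have i2 : ∀ i : Fin d, Integrable (fun p : E d × E d =>
        inner ℝ (EuclideanSpace.single i (1 : ℝ))
          (H m p.1 p.2 (EuclideanSpace.single i (1 : ℝ)))) (m.1.prod m.1) := fun i => by
      refine Integrable.of_bound (Continuous.aestronglyMeasurable
        (continuous_const.inner (cH.clm_apply continuous_const))) M (ae_of_all _ fun x => ?_)
      refine (norm_inner_le_norm _ _).trans ?_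
      simpa using ((H m x.1 x.2).le_opNorm (EuclideanSpace.single i (1 : ℝ))).trans
        (mul_le_mul_of_nonneg_right (h.norm_H m x.1 x.2) (norm_nonneg _))
    simp only [traceLaplacian, opTrace_apply]
    rw [integral_finsetSum _ fun i _ => i1 i, integral_finsetSum _ fun i _ => i2 i,
      Finset.mul_sum, ← Finset.sum_add_distrib]
    refine Finset.sum_congr rfl fun i _ => ?_
    have e1 : ∫ x, inner ℝ ((ζ i : L2 m) x) (D m x ((ζ i : L2 m) x)) ∂m.1 =
        ∫ x, inner ℝ (EuclideanSpace.single i (1 : ℝ))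
          (D m x (EuclideanSpace.single i (1 : ℝ))) ∂m.1 := by
      refine integral_congr_ae ?_
      filter_upwards [hζ i] with x hx
      rw [hx]
    have e2 : ∫ p, inner ℝ ((ζ i : L2 m) p.1) (H m p.1 p.2 ((ζ i : L2 m) p.2)) ∂(m.1.prod m.1) =
        ∫ p, inner ℝ (EuclideanSpace.single i (1 : ℝ))
          (H m p.1 p.2 (EuclideanSpace.single i (1 : ℝ))) ∂(m.1.prod m.1) := by
      refine integral_congr_ae ?_
      filter_upwards [Measure.quasiMeasurePreserving_fst.ae (hζ i),
        Measure.quasiMeasurePreserving_snd.ae (hζ i)] with x hx hx'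
      rw [hx, hx']
    have e3 : ∫ x, inner ℝ (D m x ((ζ i : L2 m) x)) ((ζ i : L2 m) x) ∂m.1 =
        ∫ x, inner ℝ (EuclideanSpace.single i (1 : ℝ))
          (D m x (EuclideanSpace.single i (1 : ℝ))) ∂m.1 := by
      rw [← e1]
      simp only [real_inner_comm]
    rw [hBe, e1, e2, e3]
    ring

end Laplacian

/-! ### Plane waves -/

section Wave

variable {d : ℕ}

/-- The plane wave `exp(-i⟨η, x⟩)`. -/
def wave (η x : E d) : ℂ := Complex.exp (-(Complex.I * (inner ℝ η x : ℝ)))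

lemma norm_wave (η x : E d) : ‖wave η x‖ = 1 := by
  rw [wave, show -(Complex.I * ((inner ℝ η x : ℝ) : ℂ)) = ((-inner ℝ η x : ℝ) : ℂ) * Complex.I by
    push_cast; ring, Complex.norm_exp_ofReal_mul_I]

lemma wave_add (η x y : E d) : wave η (x + y) = wave η x * wave η y := by
  rw [wave, wave, wave, ← Complex.exp_add, inner_add_right]
  congr 1
  push_cast
  ring

lemma norm_wave_sub_one_le (η x : E d) : ‖wave η x - 1‖ ≤ ‖η‖ * ‖x‖ := by
  rw [wave, show -(Complex.I * ((inner ℝ η x : ℝ) : ℂ)) = Complex.I * ((-inner ℝ η x : ℝ) : ℂ) by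
    push_cast; ring]
  refine (Real.norm_exp_I_mul_ofReal_sub_one_le).trans ?_
  rw [norm_neg]
  exact norm_inner_le_norm _ _

lemma norm_wave_sub_le (η x y : E d) : ‖wave η y - wave η x‖ ≤ ‖η‖ * ‖y - x‖ := by
  have : wave η y - wave η x = wave η x * (wave η (y - x) - 1) := by
    rw [mul_sub, ← wave_add, add_sub_cancel, mul_one]
  rw [this, norm_mul, norm_wave, one_mul]
  exact norm_wave_sub_one_le _ _

lemma norm_wave_sub_one_sub_le (η x : E d) :
    ‖wave η x - 1 - -Complex.I * (inner ℝ η x : ℝ)‖ ≤ 2 * (‖η‖ * ‖x‖) ^ 2 := by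
  set r : ℝ := inner ℝ η x with hr
  have hr' : |r| ≤ ‖η‖ * ‖x‖ := abs_real_inner_le_norm η x
  have hsq : r ^ 2 ≤ (‖η‖ * ‖x‖) ^ 2 := by
    rw [← sq_abs r]
    gcongr
  have hn : ‖-Complex.I * (r : ℂ)‖ = |r| := by simp
  have hw : wave η x = Complex.exp (-Complex.I * r) := by rw [wave, ← hr, neg_mul]
  -- For |r| ≤ 1 this is the power series estimate; for |r| ≥ 1 the trivial bound 2|r| is at most
  -- 2r².
  rcases le_total |r| 1 with h1 | h1
  · have := Complex.norm_exp_sub_one_sub_id_le (x := -Complex.I * (r : ℂ)) (by rw [hn]; exact h1)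
    rw [hn, sq_abs] at this
    rw [hw]
    nlinarith [sq_nonneg r]
  · have h2 : ‖wave η x - 1‖ ≤ |r| := by
      rw [hw, show -Complex.I * (r : ℂ) = Complex.I * ((-r : ℝ) : ℂ) by push_cast; ring]
      refine (Real.norm_exp_I_mul_ofReal_sub_one_le).trans ?_
      rw [norm_neg, Real.norm_eq_abs]
    refine (norm_sub_le _ _).trans ?_
    rw [hn]
    nlinarith [sq_abs r]

lemma norm_wave_sub_sub_le (η x y : E d) :
    ‖wave η y - wave η x - -Complex.I * (inner ℝ η (y - x) : ℝ) * wave η x‖ ≤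
      2 * (‖η‖ * ‖y - x‖) ^ 2 := by
  have : wave η y - wave η x - -Complex.I * (inner ℝ η (y - x) : ℝ) * wave η x =
      wave η x * (wave η (y - x) - 1 - -Complex.I * (inner ℝ η (y - x) : ℝ)) := by
    rw [mul_sub, mul_sub, ← wave_add, add_sub_cancel, mul_one]
    ring
  rw [this, norm_mul, norm_wave, one_mul]
  exact norm_wave_sub_one_sub_le _ _

lemma contDiff_wave (η : E d) : ContDiff ℝ ((⊤ : ℕ∞) : WithTop ℕ∞) (wave η) := by
  unfold wave
  have h : ContDiff ℝ ((⊤ : ℕ∞) : WithTop ℕ∞) fun x : E d => ((inner ℝ η x : ℝ) : ℂ) :=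
    Complex.ofRealCLM.contDiff.comp (innerSL ℝ η).contDiff
  exact (contDiff_const.mul h).neg.cexp

lemma continuous_wave : Continuous fun p : E d × E d => wave p.1 p.2 := by
  unfold wave
  fun_prop

@[fun_prop]
lemma Continuous.wave {X : Type*} [TopologicalSpace X] {f g : X → E d} (hf : Continuous f)
    (hg : Continuous g) : Continuous fun x => wave (f x) (g x) :=
  continuous_wave.comp (hf.prodMk hg)

lemma hasFDerivAt_wave (η x : E d) :
    HasFDerivAt (wave η) ((innerSL ℝ η).smulRight (-Complex.I * wave η x)) x := by
  have h : HasFDerivAt (fun x : E d => -(Complex.I * ((inner ℝ η x : ℝ) : ℂ)))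
      ((innerSL ℝ η).smulRight (-Complex.I)) x := by
    have h1 : HasFDerivAt (fun x : E d => ((inner ℝ η x : ℝ) : ℂ))
        (Complex.ofRealCLM.comp (innerSL ℝ η)) x :=
      (Complex.ofRealCLM.comp (innerSL ℝ η)).hasFDerivAt
    refine (h1.const_mul Complex.I).neg.congr_fderiv ?_
    ext v
    simp [mul_comm]
  refine h.cexp.congr_fderiv ?_
  ext v
  simp [wave]
  ring

lemma gradient_re_wave (κ : ℂ) (η x : E d) :
    gradient (fun x => (κ * wave η x).re) x = (κ * (-Complex.I * wave η x)).re • η := by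
  have h : HasFDerivAt (fun x => (κ * wave η x).re)
      (Complex.reCLM.comp (κ • (innerSL ℝ η).smulRight (-Complex.I * wave η x))) x :=
    Complex.reCLM.hasFDerivAt.comp x ((hasFDerivAt_wave η x).const_mul κ)
  rw [gradient, h.fderiv, LinearIsometryEquiv.symm_apply_eq]
  ext v
  simp only [ContinuousLinearMap.comp_apply, smul_apply,
    ContinuousLinearMap.smulRight_apply, innerSL_apply_apply, Complex.reCLM_apply,
    InnerProductSpace.toDual_apply_apply, real_inner_smul_left, smul_eq_mul]
  rw [mul_smul_comm, Complex.smul_re, smul_eq_mul, mul_comm]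

/-- The field is the gradient of Re(κ·wave). All gradients and second gradients of the Fourier
products are combinations of such fields, so their tangency reduces to this case. -/
lemma isTangent_wave (m : P2 d) (κ : ℂ) (η : E d) :
    IsTangent m fun x => (κ * (-Complex.I * wave η x)).re • η := by
  refine IsTangent.congr (isTangent_gradient (f := fun x => (κ * wave η x).re)
    (M := ‖κ‖ * ‖η‖) ?_ fun x => ?_) (gradient_re_wave κ η)
  · exact Complex.reCLM.contDiff.comp (contDiff_const.mul (contDiff_wave η))
  · rw [gradient_re_wave, norm_smul]
    gcongr
    refine (Complex.abs_re_le_norm _).trans ?_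
    simp [norm_wave]

/-- The Fourier transform `∫ exp(-i⟨η, x⟩) m(dx)`. -/
def ft (m : P2 d) (η : E d) : ℂ := ∫ x, wave η x ∂m.1

lemma integrable_wave (μ : Measure (E d)) [IsFiniteMeasure μ] (η : E d) :
    Integrable (wave η) μ :=
  Integrable.of_bound (by fun_prop : Continuous (wave η)).aestronglyMeasurable 1
    (ae_of_all _ fun x => (norm_wave η x).le)

lemma norm_ft_le (m : P2 d) (η : E d) : ‖ft m η‖ ≤ 1 := by
  refine (norm_integral_le_of_norm_le_const (C := 1)
    (ae_of_all _ fun x => (norm_wave η x).le)).trans ?_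
  simp

lemma continuous_ft (m : P2 d) : Continuous (ft m) := by
  refine continuous_of_dominated (bound := fun _ => 1) (fun η => ?_) (fun η => ?_)
    (integrable_const _) (ae_of_all _ fun x => by fun_prop)
  · exact (integrable_wave m.1 η).1
  · exact ae_of_all _ fun x => (norm_wave η x).le

variable {m ν : P2 d} {γ : Measure (E d × E d)}

/-- The linearization of `m ↦ ft m η` along a plan. -/
def ftLin (γ : Measure (E d × E d)) (η : E d) : ℂ :=
  ∫ z, -Complex.I * (inner ℝ η (z.2 - z.1) : ℝ) * wave η z.1 ∂γ

lemma integrable_ftLin (hγ : γ ∈ couplings m ν) (η : E d) :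
    Integrable (fun z : E d × E d => -Complex.I * (inner ℝ η (z.2 - z.1) : ℝ) * wave η z.1) γ := by
  refine Integrable.mono' ((integrable_norm_sub_of_mem_couplings hγ).const_mul ‖η‖)
    (Continuous.aestronglyMeasurable (by fun_prop)) (ae_of_all _ fun z => ?_)
  rw [norm_mul, norm_wave, mul_one, norm_mul, norm_neg, Complex.norm_I, one_mul,
    Complex.norm_real]
  exact norm_inner_le_norm _ _

lemma ft_sub_ft (hγ : γ ∈ couplings m ν) (η : E d) :
    ft ν η - ft m η = ∫ z, (wave η z.2 - wave η z.1) ∂γ := by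
  have hp := isProbabilityMeasure_of_mem_couplings hγ
  rw [integral_sub, integral_snd_of_mem_couplings hγ (integrable_wave ν.1 η).1,
    integral_fst_of_mem_couplings hγ (integrable_wave m.1 η).1]
  · rfl
  · exact Integrable.of_bound (Continuous.aestronglyMeasurable (by fun_prop)) 1
      (ae_of_all _ fun z => (norm_wave η _).le)
  · exact Integrable.of_bound (Continuous.aestronglyMeasurable (by fun_prop)) 1
      (ae_of_all _ fun z => (norm_wave η _).le)

lemma norm_ft_sub_le (hγ : γ ∈ couplings m ν) (η : E d) :
    ‖ft ν η - ft m η‖ ≤ ‖η‖ * √(cost γ) := by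
  rw [ft_sub_ft hγ]
  refine (norm_integral_le_of_norm_le ((integrable_norm_sub_of_mem_couplings hγ).const_mul ‖η‖)
    (ae_of_all _ fun z => norm_wave_sub_le η z.1 z.2)).trans ?_
  rw [integral_const_mul]
  gcongr
  exact integral_norm_sub_le_sqrt_cost hγ

lemma norm_ft_sub_sub_le (hγ : γ ∈ couplings m ν) (η : E d) :
    ‖ft ν η - ft m η - ftLin γ η‖ ≤ 2 * ‖η‖ ^ 2 * cost γ := by
  have hp := isProbabilityMeasure_of_mem_couplings hγ
  have hi : Integrable (fun z : E d × E d => wave η z.2 - wave η z.1) γ :=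
    Integrable.of_bound (Continuous.aestronglyMeasurable (by fun_prop)) (1 + 1)
      (ae_of_all _ fun z => (norm_sub_le _ _).trans
        (add_le_add (norm_wave η _).le (norm_wave η _).le))
  rw [ft_sub_ft hγ, ftLin, ← integral_sub hi (integrable_ftLin hγ η), cost_eq,
    ← integral_const_mul]
  refine norm_integral_le_of_norm_le ((integrable_normSq_of_mem_couplings hγ).const_mul _)
    (ae_of_all _ fun z => (norm_wave_sub_sub_le η z.1 z.2).trans_eq ?_)
  ring

/-! ### Products of Fourier transforms -/

variable {ι : Type*}

/-- `∏_{i ∈ s} ft m (η i)`. -/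
def ftProd (η : ι → E d) (s : Finset ι) (m : P2 d) : ℂ := ∏ i ∈ s, ft m (η i)

lemma norm_ftProd_le (η : ι → E d) (s : Finset ι) (m : P2 d) : ‖ftProd η s m‖ ≤ 1 := by
  rw [ftProd, norm_prod]
  exact Finset.prod_le_one (fun _ _ => norm_nonneg _) fun i _ => norm_ft_le m (η i)

variable [DecidableEq ι]

/-- The factors have modulus at most 1, so differences of products telescope into a sum of
differences of single factors. -/
lemma norm_ftProd_sub_le (hγ : γ ∈ couplings m ν) (η : ι → E d) (s : Finset ι) :
    ‖ftProd η s ν - ftProd η s m‖ ≤ (∑ i ∈ s, ‖η i‖) * √(cost γ) := by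
  induction s using Finset.induction_on with
  | empty => simp [ftProd]
  | insert i s his ih =>
    have e : ∀ μ : P2 d, ftProd η (insert i s) μ = ft μ (η i) * ftProd η s μ := fun μ =>
      Finset.prod_insert his
    rw [e, e, Finset.sum_insert his, add_mul,
      show ft ν (η i) * ftProd η s ν - ft m (η i) * ftProd η s m =
        (ft ν (η i) - ft m (η i)) * ftProd η s ν + ft m (η i) * (ftProd η s ν - ftProd η s m) by
          ring]
    refine (norm_add_le _ _).trans (add_le_add ?_ ?_)
    · rw [norm_mul]
      exact (mul_le_of_le_one_right (norm_nonneg _) (norm_ftProd_le η s ν)).trans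
        (norm_ft_sub_le hγ _)
    · rw [norm_mul]
      exact (mul_le_of_le_one_left (norm_nonneg _) (norm_ft_le m _)).trans ih

/-- Induction on the product rule. Adding a factor creates the second order error 2|η i|² of that
factor and the cross term |η i|·S of two first order increments; 3(|η i| + S)² dominates these
together with 3S². -/
lemma norm_ftProd_sub_sub_le (hγ : γ ∈ couplings m ν) (η : ι → E d) (s : Finset ι) :
    ‖ftProd η s ν - ftProd η s m - ∑ i ∈ s, ftProd η (s.erase i) m * ftLin γ (η i)‖ ≤
      3 * (∑ i ∈ s, ‖η i‖) ^ 2 * cost γ := by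
  induction s using Finset.induction_on with
  | empty => simp [ftProd]
  | insert i s his ih =>
    have e : ∀ μ : P2 d, ftProd η (insert i s) μ = ft μ (η i) * ftProd η s μ := fun μ =>
      Finset.prod_insert his
    have e2 : ∀ l ∈ s, ftProd η ((insert i s).erase l) m * ftLin γ (η l) =
        ft m (η i) * (ftProd η (s.erase l) m * ftLin γ (η l)) := fun l hl => by
      have hne : i ≠ l := fun h => his (h ▸ hl)
      rw [Finset.erase_insert_of_ne hne, ftProd,
        Finset.prod_insert (fun h => his (Finset.mem_of_mem_erase h)), ← ftProd]
      ring
    rw [Finset.sum_insert his, Finset.erase_insert his, Finset.sum_congr rfl e2, ← Finset.mul_sum,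
      Finset.sum_insert his, e, e,
      show ft ν (η i) * ftProd η s ν - ft m (η i) * ftProd η s m - (ftProd η s m * ftLin γ (η i) +
          ft m (η i) * ∑ i ∈ s, ftProd η (s.erase i) m * ftLin γ (η i)) =
        ft m (η i) * (ftProd η s ν - ftProd η s m -
          ∑ i ∈ s, ftProd η (s.erase i) m * ftLin γ (η i)) +
        (ft ν (η i) - ft m (η i) - ftLin γ (η i)) * ftProd η s m +
        (ft ν (η i) - ft m (η i)) * (ftProd η s ν - ftProd η s m) by ring]
    refine (norm_add₃_le).trans ?_
    rw [norm_mul, norm_mul, norm_mul]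
    set S := ∑ i ∈ s, ‖η i‖
    have hS : 0 ≤ S := Finset.sum_nonneg fun _ _ => norm_nonneg _
    have h1 := (mul_le_of_le_one_left (norm_nonneg _) (norm_ft_le m (η i))).trans ih
    have h2 := (mul_le_of_le_one_right (norm_nonneg _) (norm_ftProd_le η s m)).trans
      (norm_ft_sub_sub_le hγ (η i))
    have h3 := mul_le_mul (norm_ft_sub_le hγ (η i)) (norm_ftProd_sub_le hγ η s)
      (norm_nonneg _) (by positivity)
    have h4 : ‖η i‖ * √(cost γ) * (S * √(cost γ)) = ‖η i‖ * S * cost γ := by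
      rw [show ‖η i‖ * √(cost γ) * (S * √(cost γ)) = ‖η i‖ * S * √(cost γ) ^ 2 by ring,
        Real.sq_sqrt (cost_nonneg γ)]
    have hc := cost_nonneg γ
    have h5 : 3 * (‖η i‖ + S) ^ 2 * cost γ =
      3 * S ^ 2 * cost γ + 2 * ‖η i‖ ^ 2 * cost γ + ‖η i‖ * S * cost γ +
        (‖η i‖ ^ 2 * cost γ + 5 * (‖η i‖ * S * cost γ)) := by ring
    have h6 : 0 ≤ ‖η i‖ ^ 2 * cost γ + 5 * (‖η i‖ * S * cost γ) := by positivity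
    linarith

end Wave

/-! ### Derivatives of products of Fourier transforms -/

section ProdDerivs

set_option linter.unusedSectionVars false

variable {d : ℕ} {ι : Type*} [Fintype ι] [DecidableEq ι]

/-- The rank one operator `v ↦ ⟨η', v⟩ η`. -/
def outer (η η' : E d) : E d →L[ℝ] E d := (innerSL ℝ η').smulRight η

lemma outer_apply (η η' v : E d) : outer η η' v = inner ℝ η' v • η := rfl

lemma norm_outer_le (η η' : E d) : ‖outer η η'‖ ≤ ‖η‖ * ‖η'‖ := by
  rw [outer, ContinuousLinearMap.norm_smulRight_apply, innerSL_apply_norm, mul_comm]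

lemma adjoint_outer_apply (η η' e : E d) :
    ContinuousLinearMap.adjoint (outer η η') e = inner ℝ η e • η' := by
  refine ext_inner_right ℝ fun v => ?_
  rw [ContinuousLinearMap.adjoint_inner_left, outer_apply, inner_smul_right,
    real_inner_smul_left, real_inner_comm e η, mul_comm]

lemma opTrace_outer (η η' : E d) : opTrace d (outer η η') = inner ℝ η η' := by
  rw [opTrace_apply]
  simp [outer_apply, inner_smul_right, PiLp.inner_apply]

/-- The gradient of `m ↦ Re (c ∏ ft m (η i))`. -/
def prodA (c : ℂ) (η : ι → E d) (m : P2 d) (x : E d) : E d :=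
  ∑ j, (c * ftProd η (Finset.univ.erase j) m * (-Complex.I * wave (η j) x)).re • η j

/-- The spatial derivative of the gradient of `m ↦ Re (c ∏ ft m (η i))`. -/
def prodD (c : ℂ) (η : ι → E d) (m : P2 d) (x : E d) : E d →L[ℝ] E d :=
  ∑ j, (-(c * ftProd η (Finset.univ.erase j) m * wave (η j) x)).re • outer (η j) (η j)

/-- The second Wasserstein gradient of `m ↦ Re (c ∏ ft m (η i))`. -/
def prodH (c : ℂ) (η : ι → E d) (m : P2 d) (x y : E d) : E d →L[ℝ] E d :=
  ∑ j, ∑ l ∈ Finset.univ.erase j,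
    (-(c * ftProd η ((Finset.univ.erase j).erase l) m * wave (η j) x * wave (η l) y)).re •
      outer (η j) (η l)

variable (c : ℂ) (η : ι → E d)

lemma sum_norm_nonneg : 0 ≤ ∑ j, ‖η j‖ := Finset.sum_nonneg fun _ _ => norm_nonneg _

lemma sum_erase_norm_le (j : ι) : ∑ l ∈ Finset.univ.erase j, ‖η l‖ ≤ ∑ l, ‖η l‖ :=
  Finset.sum_le_sum_of_subset_of_nonneg (Finset.erase_subset _ _) fun _ _ _ => norm_nonneg _

lemma norm_le_sum (j : ι) : ‖η j‖ ≤ ∑ l, ‖η l‖ :=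
  Finset.single_le_sum (f := fun l => ‖η l‖) (fun _ _ => norm_nonneg _) (Finset.mem_univ j)

lemma norm_re_smul_le {F : Type*} [NormedAddCommGroup F] [NormedSpace ℝ F] {z : ℂ} {v : F}
    {a b : ℝ} (hz : ‖z‖ ≤ a) (hv : ‖v‖ ≤ b) : ‖z.re • v‖ ≤ a * b := by
  rw [norm_smul]
  exact mul_le_mul ((Complex.abs_re_le_norm z).trans hz) hv (norm_nonneg _)
    ((norm_nonneg _).trans hz)

/-- A sum over single indices. -/
lemma norm_sum_re_smul_le {F : Type*} [NormedAddCommGroup F] [NormedSpace ℝ F] {z : ι → ℂ}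
    {v : ι → F} {a : ℝ} (hz : ∀ j, ‖z j‖ ≤ a) (hv : ∀ j, ‖v j‖ ≤ ‖η j‖) :
    ‖∑ j, (z j).re • v j‖ ≤ a * ∑ j, ‖η j‖ := by
  rw [Finset.mul_sum]
  exact norm_sum_le_of_le _ fun j _ => norm_re_smul_le (hz j) (hv j)

/-- A sum over single indices, with squares. -/
lemma norm_sum_re_smul_outer_le {z : ι → ℂ} {a : ℝ} (hz : ∀ j, ‖z j‖ ≤ a) :
    ‖∑ j, (z j).re • outer (η j) (η j)‖ ≤ a * (∑ j, ‖η j‖) ^ 2 := by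
  have h : ‖∑ j, (z j).re • outer (η j) (η j)‖ ≤ ∑ j, a * (‖η j‖ * ∑ l, ‖η l‖) := by
    refine norm_sum_le_of_le _ fun j _ => norm_re_smul_le (hz j) ((norm_outer_le _ _).trans ?_)
    gcongr
    exact norm_le_sum η j
  refine h.trans_eq ?_
  rw [← Finset.mul_sum, ← Finset.sum_mul, sq]

/-- A sum over pairs of indices. -/
lemma norm_sum_sum_re_smul_outer_le {z : ι → ι → ℂ} {a : ℝ} (ha : 0 ≤ a)
    (hz : ∀ j l, ‖z j l‖ ≤ a) :
    ‖∑ j, ∑ l ∈ Finset.univ.erase j, (z j l).re • outer (η j) (η l)‖ ≤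
      a * (∑ j, ‖η j‖) ^ 2 := by
  have h : ‖∑ j, ∑ l ∈ Finset.univ.erase j, (z j l).re • outer (η j) (η l)‖ ≤
      ∑ j, a * (‖η j‖ * ∑ l, ‖η l‖) := by
    refine norm_sum_le_of_le _ fun j _ => ?_
    have h2 : ‖∑ l ∈ Finset.univ.erase j, (z j l).re • outer (η j) (η l)‖ ≤
        ∑ l ∈ Finset.univ.erase j, a * (‖η j‖ * ‖η l‖) :=
      norm_sum_le_of_le _ fun l _ => norm_re_smul_le (hz j l) (norm_outer_le _ _)
    refine h2.trans ?_
    rw [← Finset.mul_sum, ← Finset.mul_sum]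
    have := sum_erase_norm_le η j
    gcongr
  refine h.trans_eq ?_
  rw [← Finset.mul_sum, ← Finset.sum_mul, sq]

/-- The constant which controls all derivatives of `m ↦ Re (c ∏ ft m (η i))`. -/
def prodBound (c : ℂ) (η : ι → E d) : ℝ := 3 * ‖c‖ * (1 + ∑ j, ‖η j‖) ^ 3

lemma le_prodBound_one : ‖c‖ * ∑ j, ‖η j‖ ≤ prodBound c η := by
  have h := sum_norm_nonneg η
  rw [prodBound, mul_comm (3 : ℝ), mul_assoc]
  gcongr
  nlinarith [pow_nonneg h 2, pow_nonneg h 3]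

lemma le_prodBound_two : 3 * ‖c‖ * (∑ j, ‖η j‖) ^ 2 ≤ prodBound c η := by
  have h := sum_norm_nonneg η
  rw [prodBound]
  gcongr
  nlinarith [pow_nonneg h 2, pow_nonneg h 3]

lemma le_prodBound_three : 3 * ‖c‖ * (∑ j, ‖η j‖) ^ 3 ≤ prodBound c η := by
  have h := sum_norm_nonneg η
  rw [prodBound]
  gcongr
  linarith

variable {c η} in
lemma norm_coeff_le (s : Finset ι) (m : P2 d) {w : ℂ} (hw : ‖w‖ ≤ 1) :
    ‖c * ftProd η s m * w‖ ≤ ‖c‖ := by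
  rw [norm_mul, norm_mul]
  calc ‖c‖ * ‖ftProd η s m‖ * ‖w‖ ≤ ‖c‖ * 1 * 1 := by
        gcongr
        exact norm_ftProd_le η s m
    _ = ‖c‖ := by ring

lemma re_smul_sub {F : Type*} [NormedAddCommGroup F] [NormedSpace ℝ F] (z w : ℂ) (v : F) :
    z.re • v - w.re • v = (z - w).re • v := by
  rw [Complex.sub_re, sub_smul]

lemma sum_sum_re_smul_sub (z w : ι → ι → ℂ) :
    ∑ j, ∑ l ∈ Finset.univ.erase j, (z j l).re • outer (η j) (η l) -
      ∑ j, ∑ l ∈ Finset.univ.erase j, (w j l).re • outer (η j) (η l) =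
      ∑ j, ∑ l ∈ Finset.univ.erase j, (z j l - w j l).re • outer (η j) (η l) := by
  rw [← Finset.sum_sub_distrib]
  refine Finset.sum_congr rfl fun j _ => ?_
  rw [← Finset.sum_sub_distrib]
  exact Finset.sum_congr rfl fun l _ => re_smul_sub _ _ _

lemma norm_prodA_le (m : P2 d) (x : E d) : ‖prodA c η m x‖ ≤ ‖c‖ * ∑ j, ‖η j‖ :=
  norm_sum_re_smul_le η (fun j => norm_coeff_le _ m (by simp [norm_wave])) fun j => le_rfl

lemma norm_prodD_le (m : P2 d) (x : E d) : ‖prodD c η m x‖ ≤ ‖c‖ * (∑ j, ‖η j‖) ^ 2 :=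
  norm_sum_re_smul_outer_le η fun j => by
    rw [norm_neg]
    exact norm_coeff_le _ m (norm_wave _ _).le

lemma norm_prodH_le (m : P2 d) (x y : E d) :
    ‖prodH c η m x y‖ ≤ ‖c‖ * (∑ j, ‖η j‖) ^ 2 :=
  norm_sum_sum_re_smul_outer_le η (norm_nonneg _) fun j l => by
    rw [norm_neg, mul_assoc]
    exact norm_coeff_le _ m (by simp [norm_wave])

lemma prodA_taylor (m : P2 d) (x y : E d) :
    ‖prodA c η m y - prodA c η m x - prodD c η m x (y - x)‖ ≤
      2 * ‖c‖ * (∑ j, ‖η j‖) ^ 3 * ‖y - x‖ ^ 2 := by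
  have e : prodA c η m y - prodA c η m x - prodD c η m x (y - x) =
      ∑ j, (c * ftProd η (Finset.univ.erase j) m * (-Complex.I * (wave (η j) y - wave (η j) x -
        -Complex.I * (inner ℝ (η j) (y - x) : ℝ) * wave (η j) x))).re • η j := by
    rw [prodA, prodA, prodD, sum_apply, ← Finset.sum_sub_distrib,
      ← Finset.sum_sub_distrib]
    refine Finset.sum_congr rfl fun j _ => ?_
    rw [smul_apply, outer_apply, smul_smul, ← sub_smul, ← sub_smul]
    congr 1
    set r : ℝ := inner ℝ (η j) (y - x)
    rw [← Complex.re_mul_ofReal, ← Complex.sub_re, ← Complex.sub_re]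
    congr 1
    linear_combination (c * ftProd η (Finset.univ.erase j) m * wave (η j) x * r) *
      Complex.I_mul_I
  have h0 := sum_norm_nonneg η
  rw [e]
  refine (norm_sum_re_smul_le η (a := 2 * ‖c‖ * (∑ j, ‖η j‖) ^ 2 * ‖y - x‖ ^ 2) (fun j => ?_)
    fun j => le_rfl).trans_eq (by ring)
  rw [norm_mul, norm_mul, norm_mul, norm_neg, Complex.norm_I, one_mul]
  calc ‖c‖ * ‖ftProd η (Finset.univ.erase j) m‖ * _
      ≤ ‖c‖ * 1 * (2 * (‖η j‖ * ‖y - x‖) ^ 2) := by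
        gcongr
        · exact norm_ftProd_le _ _ _
        · exact norm_wave_sub_sub_le _ _ _
    _ ≤ ‖c‖ * 1 * (2 * ((∑ j, ‖η j‖) * ‖y - x‖) ^ 2) := by
        gcongr
        exact norm_le_sum η j
    _ = _ := by ring

lemma prodD_lip (m : P2 d) (x y : E d) :
    ‖prodD c η m y - prodD c η m x‖ ≤ ‖c‖ * (∑ j, ‖η j‖) ^ 3 * ‖y - x‖ := by
  have h0 := sum_norm_nonneg η
  rw [prodD, prodD, ← Finset.sum_sub_distrib,
    Finset.sum_congr rfl fun j _ => re_smul_sub _ _ (outer (η j) (η j))]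
  refine (norm_sum_re_smul_outer_le η (a := ‖c‖ * (∑ j, ‖η j‖) * ‖y - x‖)
    fun j => ?_).trans_eq (by ring)
  rw [← neg_sub', norm_neg, ← mul_sub, norm_mul, norm_mul]
  calc _ ≤ ‖c‖ * 1 * (‖η j‖ * ‖y - x‖) := by
        gcongr
        · exact norm_ftProd_le _ _ _
        · exact norm_wave_sub_le _ _ _
    _ ≤ ‖c‖ * 1 * ((∑ j, ‖η j‖) * ‖y - x‖) := by
        gcongr
        exact norm_le_sum η j
    _ = _ := by ring

variable {m ν : P2 d} {γ : Measure (E d × E d)}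

lemma prodD_lip' (hγ : γ ∈ couplings m ν) (x : E d) :
    ‖prodD c η ν x - prodD c η m x‖ ≤ ‖c‖ * (∑ j, ‖η j‖) ^ 3 * √(cost γ) := by
  have h0 := sum_norm_nonneg η
  rw [prodD, prodD, ← Finset.sum_sub_distrib,
    Finset.sum_congr rfl fun j _ => re_smul_sub _ _ (outer (η j) (η j))]
  refine (norm_sum_re_smul_outer_le η (a := ‖c‖ * (∑ j, ‖η j‖) * √(cost γ))
    fun j => ?_).trans_eq (by ring)
  rw [← neg_sub', norm_neg, ← sub_mul, ← mul_sub, norm_mul, norm_mul, norm_wave, mul_one,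
    mul_assoc]
  gcongr
  exact (norm_ftProd_sub_le hγ η _).trans
    (mul_le_mul_of_nonneg_right (sum_erase_norm_le η j) (Real.sqrt_nonneg _))

lemma prodH_lip (m : P2 d) (x y x' y' : E d) :
    ‖prodH c η m x' y' - prodH c η m x y‖ ≤
      ‖c‖ * (∑ j, ‖η j‖) ^ 3 * (‖x' - x‖ + ‖y' - y‖) := by
  have h0 := sum_norm_nonneg η
  rw [prodH, prodH, sum_sum_re_smul_sub]
  refine (norm_sum_sum_re_smul_outer_le η
    (a := ‖c‖ * (∑ j, ‖η j‖) * (‖x' - x‖ + ‖y' - y‖)) (by positivity)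
    fun j l => ?_).trans_eq (by ring)
  rw [← neg_sub', norm_neg, mul_assoc, mul_assoc _ (wave (η j) x), ← mul_sub, norm_mul, norm_mul,
    show wave (η j) x' * wave (η l) y' - wave (η j) x * wave (η l) y =
      (wave (η j) x' - wave (η j) x) * wave (η l) y' +
        wave (η j) x * (wave (η l) y' - wave (η l) y) by ring]
  have h1 : ‖(wave (η j) x' - wave (η j) x) * wave (η l) y' +
        wave (η j) x * (wave (η l) y' - wave (η l) y)‖ ≤
      ‖η j‖ * ‖x' - x‖ + ‖η l‖ * ‖y' - y‖ := by
    refine (norm_add_le _ _).trans ?_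
    rw [norm_mul, norm_mul, norm_wave, norm_wave, mul_one, one_mul]
    exact add_le_add (norm_wave_sub_le _ _ _) (norm_wave_sub_le _ _ _)
  calc _ ≤ ‖c‖ * 1 * (‖η j‖ * ‖x' - x‖ + ‖η l‖ * ‖y' - y‖) := by
        gcongr
        exact norm_ftProd_le _ _ _
    _ ≤ ‖c‖ * 1 * ((∑ j, ‖η j‖) * ‖x' - x‖ + (∑ j, ‖η j‖) * ‖y' - y‖) := by
        gcongr
        · exact norm_le_sum η j
        · exact norm_le_sum η l
    _ = _ := by ring

lemma prodH_lip' (hγ : γ ∈ couplings m ν) (x y : E d) :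
    ‖prodH c η ν x y - prodH c η m x y‖ ≤ ‖c‖ * (∑ j, ‖η j‖) ^ 3 * √(cost γ) := by
  have h0 := sum_norm_nonneg η
  rw [prodH, prodH, sum_sum_re_smul_sub]
  refine (norm_sum_sum_re_smul_outer_le η
    (a := ‖c‖ * (∑ j, ‖η j‖) * √(cost γ)) (by positivity)
    fun j l => ?_).trans_eq (by ring)
  rw [← neg_sub', norm_neg, ← sub_mul, ← sub_mul, ← mul_sub, norm_mul, norm_mul, norm_mul,
    norm_wave, norm_wave, mul_one, mul_one, mul_assoc]
  gcongr
  exact (norm_ftProd_sub_le hγ η _).trans (mul_le_mul_of_nonneg_right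
    ((Finset.sum_le_sum_of_subset_of_nonneg (Finset.erase_subset _ _)
      fun _ _ _ => norm_nonneg _).trans (sum_erase_norm_le η j)) (Real.sqrt_nonneg _))

lemma integral_sum_re {α κ : Type*} [MeasurableSpace α] {μ : Measure α} (s : Finset κ)
    {f : κ → α → ℂ} (hf : ∀ j ∈ s, Integrable (f j) μ) :
    ∫ x, ∑ j ∈ s, (f j x).re ∂μ = ∑ j ∈ s, (∫ x, f j x ∂μ).re := by
  have hre : ∀ j ∈ s, Integrable (fun x => (f j x).re) μ := fun j hj => (hf j hj).re
  rw [integral_finsetSum s hre]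
  exact Finset.sum_congr rfl fun j hj => Complex.reCLM.integral_comp_comm (hf j hj)

/-- Identifies the integrated gradient with the linearization of the product, so that
`norm_ftProd_sub_sub_le` becomes the first order expansion; `integral_prodH_apply` does the same one
order higher, for products with one factor removed. -/
lemma integral_inner_prodA (hγ : γ ∈ couplings m ν) :
    ∫ z, inner ℝ (prodA c η m z.1) (z.2 - z.1) ∂γ =
      (c * ∑ j, ftProd η (Finset.univ.erase j) m * ftLin γ (η j)).re := by
  have e : ∀ z : E d × E d, inner ℝ (prodA c η m z.1) (z.2 - z.1) =
      ∑ j, (c * ftProd η (Finset.univ.erase j) m *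
        (-Complex.I * (inner ℝ (η j) (z.2 - z.1) : ℝ) * wave (η j) z.1)).re := fun z => by
    rw [prodA, sum_inner]
    refine Finset.sum_congr rfl fun j _ => ?_
    rw [real_inner_smul_left, ← Complex.re_mul_ofReal]
    congr 1
    ring
  have hi : ∀ j, Integrable (fun z : E d × E d => c * ftProd η (Finset.univ.erase j) m *
      (-Complex.I * (inner ℝ (η j) (z.2 - z.1) : ℝ) * wave (η j) z.1)) γ := fun j =>
    (integrable_ftLin hγ (η j)).const_mul _
  simp only [e]
  rw [integral_sum_re _ fun j _ => hi j, Finset.mul_sum, Complex.re_sum]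
  refine Finset.sum_congr rfl fun j _ => ?_
  rw [integral_const_mul, mul_assoc]
  rfl

lemma integral_prodH_apply (hγ : γ ∈ couplings m ν) (x : E d) :
    ∫ z, prodH c η m x z.1 (z.2 - z.1) ∂γ =
      ∑ j, (c * (∑ l ∈ Finset.univ.erase j, ftProd η ((Finset.univ.erase j).erase l) m *
        ftLin γ (η l)) * (-Complex.I * wave (η j) x)).re • η j := by
  have e : ∀ z : E d × E d, prodH c η m x z.1 (z.2 - z.1) =
      ∑ j, (∑ l ∈ Finset.univ.erase j, (c * ftProd η ((Finset.univ.erase j).erase l) m *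
        (-Complex.I * wave (η j) x) *
        (-Complex.I * (inner ℝ (η l) (z.2 - z.1) : ℝ) * wave (η l) z.1)).re) • η j := fun z => by
    rw [prodH, sum_apply]
    refine Finset.sum_congr rfl fun j _ => ?_
    rw [sum_apply, Finset.sum_smul]
    refine Finset.sum_congr rfl fun l _ => ?_
    rw [smul_apply, outer_apply, smul_smul, ← Complex.re_mul_ofReal]
    congr 2
    linear_combination (-(c * ftProd η ((Finset.univ.erase j).erase l) m * wave (η j) x *
      wave (η l) z.1 * (inner ℝ (η l) (z.2 - z.1) : ℝ))) * Complex.I_mul_I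
  have hi : ∀ j l, Integrable (fun z : E d × E d =>
      c * ftProd η ((Finset.univ.erase j).erase l) m * (-Complex.I * wave (η j) x) *
        (-Complex.I * (inner ℝ (η l) (z.2 - z.1) : ℝ) * wave (η l) z.1)) γ := fun j l =>
    (integrable_ftLin hγ (η l)).const_mul _
  have hi2 : ∀ j, Integrable (fun z : E d × E d => ∑ l ∈ Finset.univ.erase j,
      (c * ftProd η ((Finset.univ.erase j).erase l) m * (-Complex.I * wave (η j) x) *
        (-Complex.I * (inner ℝ (η l) (z.2 - z.1) : ℝ) * wave (η l) z.1)).re) γ := fun j =>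
    integrable_finsetSum _ fun l _ => (hi j l).re
  simp only [e]
  rw [integral_finsetSum _ fun j _ => (hi2 j).smul_const _]
  refine Finset.sum_congr rfl fun j _ => ?_
  rw [integral_smul_const, integral_sum_re _ fun l _ => hi j l, Finset.mul_sum,
    Finset.sum_mul, Complex.re_sum]
  congr 1
  refine Finset.sum_congr rfl fun l _ => ?_
  rw [integral_const_mul, ← ftLin]
  congr 1
  ring

lemma prodA_expand (hγ : γ ∈ couplings m ν) (x : E d) :
    ‖prodA c η ν x - prodA c η m x - ∫ z, prodH c η m x z.1 (z.2 - z.1) ∂γ‖ ≤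
      3 * ‖c‖ * (∑ j, ‖η j‖) ^ 3 * cost γ := by
  have h0 := sum_norm_nonneg η
  rw [integral_prodH_apply c η hγ, prodA, prodA, ← Finset.sum_sub_distrib,
    ← Finset.sum_sub_distrib]
  simp only [re_smul_sub]
  refine (norm_sum_re_smul_le η (a := 3 * ‖c‖ * (∑ j, ‖η j‖) ^ 2 * cost γ) (fun j => ?_)
    fun j => le_rfl).trans_eq (by ring)
  rw [← sub_mul, ← sub_mul, ← mul_sub, ← mul_sub, norm_mul, norm_mul, norm_mul, norm_neg,
    Complex.norm_I, norm_wave, one_mul, mul_one]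
  calc _ ≤ ‖c‖ * (3 * (∑ i ∈ Finset.univ.erase j, ‖η i‖) ^ 2 * cost γ) := by
        gcongr
        exact norm_ftProd_sub_sub_le hγ η _
    _ ≤ ‖c‖ * (3 * (∑ i, ‖η i‖) ^ 2 * cost γ) := by
        have := cost_nonneg γ
        have := sum_erase_norm_le η j
        gcongr
    _ = _ := by ring

end ProdDerivs

/-! ### Uniform derivatives and Laplacian of a Fourier product -/

section ProdUniform

variable {d : ℕ} {ι : Type*} [Fintype ι] [DecidableEq ι] (c : ℂ) (η : ι → E d)

lemma contDiff_prodA (m : P2 d) : ContDiff ℝ ((⊤ : ℕ∞) : WithTop ℕ∞) (prodA c η m) := by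
  unfold prodA
  refine ContDiff.sum fun j _ => ?_
  have h : ContDiff ℝ ((⊤ : ℕ∞) : WithTop ℕ∞) fun x =>
      (c * ftProd η (Finset.univ.erase j) m * (-Complex.I * wave (η j) x)).re :=
    Complex.reCLM.contDiff.comp
      (contDiff_const.mul (contDiff_const.mul (contDiff_wave (η j))))
  exact h.smul contDiff_const

lemma isTangent_prodA (m : P2 d) : IsTangent m (prodA c η m) :=
  isTangent_sum _ fun _ _ => isTangent_wave m _ _

lemma isTangent_prodH (m : P2 d) (x e : E d) :
    IsTangent m fun y => ContinuousLinearMap.adjoint (prodH c η m x y) e := by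
  have h : ∀ y, ∑ j, ∑ l ∈ Finset.univ.erase j,
      (c * ftProd η ((Finset.univ.erase j).erase l) m * (-Complex.I * wave (η j) x) *
        (inner ℝ (η j) e : ℝ) * (-Complex.I * wave (η l) y)).re • η l =
      ContinuousLinearMap.adjoint (prodH c η m x y) e := fun y => by
    rw [prodH, map_sum, sum_apply]
    refine Finset.sum_congr rfl fun j _ => ?_
    rw [map_sum, sum_apply]
    refine Finset.sum_congr rfl fun l _ => ?_
    rw [map_smulₛₗ, conj_trivial, smul_apply, adjoint_outer_apply, smul_smul,
      ← Complex.re_mul_ofReal]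
    congr 2
    linear_combination (c * ftProd η ((Finset.univ.erase j).erase l) m * wave (η j) x *
      wave (η l) y * (inner ℝ (η j) e : ℝ)) * Complex.I_mul_I
  refine IsTangent.congr ?_ h
  exact isTangent_sum _ fun _ _ => isTangent_sum _ fun _ _ => isTangent_wave m _ _

/-- The function ⟨prodA, ζ⟩ is smooth and inherits the compact support of ζ; the product rule
identifies its gradient. -/
lemma isTangent_prodD (m : P2 d) {ζ : E d → E d} (hζ : IsTest ζ) :
    IsTangent m fun x => ContinuousLinearMap.adjoint (prodD c η m x) (ζ x) +
      ContinuousLinearMap.adjoint (fderiv ℝ ζ x) (prodA c η m x) := by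
  have hφ : IsTest fun x => inner ℝ (prodA c η m x) (ζ x) := by
    refine ⟨(contDiff_prodA c η m).inner ℝ hζ.1, hζ.2.mono' ?_⟩
    refine (Function.support_subset_iff'.2 fun x hx => ?_ : _ ⊆ Function.support ζ).trans
      subset_closure
    rw [Function.notMem_support.1 hx, inner_zero_right]
  refine (isTangent_gradient_of_isTest hφ m).congr fun x => ?_
  refine ext_inner_right ℝ fun v => ?_
  have hA : HasFDerivAt (prodA c η m) (prodD c η m x) x :=
    hasFDerivAt_of_norm_sub_sub_le (prodA_taylor c η m x)
  rw [inner_gradient, (hA.inner ℝ (hζ.differentiable x).hasFDerivAt).fderiv, inner_add_left,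
    ContinuousLinearMap.adjoint_inner_left, ContinuousLinearMap.adjoint_inner_left]
  simp only [ContinuousLinearMap.comp_apply, ContinuousLinearMap.prod_apply,
    fderivInnerCLM_apply]
  rw [add_comm, real_inner_comm (ζ x)]

/-- `m ↦ Re (c ∏ ft m (η i))` has uniform derivatives. -/
lemma hasUniformDerivs_prod :
    HasUniformDerivs (fun m => (c * ftProd η Finset.univ m).re) (prodA c η) (prodD c η)
      (prodH c η) (prodBound c η) := by
  have h0 := sum_norm_nonneg η
  have h1 := le_prodBound_one c η
  have h2 := le_prodBound_two c η
  have h3 := le_prodBound_three c η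
  have h2' : ‖c‖ * (∑ j, ‖η j‖) ^ 2 ≤ prodBound c η := by
    refine le_trans ?_ h2
    rw [mul_assoc]
    have : 0 ≤ ‖c‖ * (∑ j, ‖η j‖) ^ 2 := by positivity
    linarith
  have h3' : ‖c‖ * (∑ j, ‖η j‖) ^ 3 ≤ prodBound c η := by
    refine le_trans ?_ h3
    rw [mul_assoc]
    have : 0 ≤ ‖c‖ * (∑ j, ‖η j‖) ^ 3 := by positivity
    linarith
  have h3'' : 2 * ‖c‖ * (∑ j, ‖η j‖) ^ 3 ≤ prodBound c η := by
    refine le_trans ?_ h3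
    gcongr
    norm_num
  refine ⟨fun m x => (norm_prodA_le c η m x).trans h1,
    fun m x => (norm_prodD_le c η m x).trans h2',
    fun m x y => (norm_prodH_le c η m x y).trans h2', fun m ν γ hγ => ?_,
    fun m x y => (prodA_taylor c η m x y).trans (by gcongr),
    fun m x y => (prodD_lip c η m x y).trans (by gcongr),
    fun m ν γ hγ x => (prodD_lip' c η hγ x).trans (by gcongr),
    fun m ν γ hγ x => (prodA_expand c η hγ x).trans ?_,
    fun m x y x' y' => (prodH_lip c η m x y x' y').trans (by gcongr),
    fun m ν γ hγ x y => (prodH_lip' c η hγ x y).trans (by gcongr),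
    isTangent_prodA c η, isTangent_prodH c η, fun m ζ hζ => isTangent_prodD c η m hζ⟩
  · rw [integral_inner_prodA c η hγ, ← Complex.sub_re, ← Complex.sub_re, ← mul_sub, ← mul_sub]
    refine (Complex.abs_re_le_norm _).trans ?_
    rw [norm_mul]
    have := cost_nonneg γ
    calc _ ≤ ‖c‖ * (3 * (∑ i, ‖η i‖) ^ 2 * cost γ) := by
          gcongr
          exact norm_ftProd_sub_sub_le hγ η _
      _ = 3 * ‖c‖ * (∑ i, ‖η i‖) ^ 2 * cost γ := by ring
      _ ≤ _ := by gcongr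
  · have := cost_nonneg γ
    gcongr

/-- Integrating the wave with frequency η j restores the factor omitted from the product, so the
full product reappears; the trace of the rank one operator contributes |η j|². -/
lemma integral_opTrace_prodD (m : P2 d) :
    ∫ x, opTrace d (prodD c η m x) ∂m.1 =
      -((∑ j, ‖η j‖ ^ 2) * (c * ftProd η Finset.univ m).re) := by
  have e : ∀ x, opTrace d (prodD c η m x) =
      ∑ j, (-((‖η j‖ ^ 2 : ℝ) * c * ftProd η (Finset.univ.erase j) m * wave (η j) x)).re :=
    fun x => by
      rw [prodD, map_sum]
      refine Finset.sum_congr rfl fun j _ => ?_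
      rw [map_smul, opTrace_outer, real_inner_self_eq_norm_sq, smul_eq_mul,
        ← Complex.re_mul_ofReal]
      congr 1
      ring
  have hi : ∀ j, Integrable (fun x => -((‖η j‖ ^ 2 : ℝ) * c *
      ftProd η (Finset.univ.erase j) m * wave (η j) x)) m.1 := fun j =>
    ((integrable_wave m.1 (η j)).const_mul _).neg
  simp only [e]
  rw [integral_sum_re _ fun j _ => hi j, Finset.sum_mul, ← Finset.sum_neg_distrib]
  refine Finset.sum_congr rfl fun j _ => ?_
  rw [integral_neg, integral_const_mul, ← ft, mul_assoc, ftProd,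
    Finset.prod_erase_mul _ _ (Finset.mem_univ j), ← ftProd, Complex.neg_re, mul_assoc,
    Complex.re_ofReal_mul]

lemma integral_opTrace_prodH (m : P2 d) :
    ∫ p, opTrace d (prodH c η m p.1 p.2) ∂(m.1.prod m.1) =
      -((∑ j, ∑ l ∈ Finset.univ.erase j, inner ℝ (η j) (η l)) *
        (c * ftProd η Finset.univ m).re) := by
  have e : ∀ p : E d × E d, opTrace d (prodH c η m p.1 p.2) =
      ∑ j, ∑ l ∈ Finset.univ.erase j, (-((inner ℝ (η j) (η l) : ℝ) * c *
        ftProd η ((Finset.univ.erase j).erase l) m * (wave (η j) p.1 * wave (η l) p.2))).re :=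
    fun p => by
      rw [prodH, map_sum]
      refine Finset.sum_congr rfl fun j _ => ?_
      rw [map_sum]
      refine Finset.sum_congr rfl fun l _ => ?_
      rw [map_smul, opTrace_outer, smul_eq_mul, ← Complex.re_mul_ofReal]
      congr 1
      ring
  have hi : ∀ j l, Integrable (fun p : E d × E d => -((inner ℝ (η j) (η l) : ℝ) * c *
      ftProd η ((Finset.univ.erase j).erase l) m * (wave (η j) p.1 * wave (η l) p.2)))
      (m.1.prod m.1) := fun j l =>
    (((integrable_wave m.1 (η j)).mul_prod (integrable_wave m.1 (η l))).const_mul _).neg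
  have hi2 : ∀ j, Integrable (fun p : E d × E d => ∑ l ∈ Finset.univ.erase j,
      (-((inner ℝ (η j) (η l) : ℝ) * c * ftProd η ((Finset.univ.erase j).erase l) m *
        (wave (η j) p.1 * wave (η l) p.2))).re) (m.1.prod m.1) := fun j =>
    integrable_finsetSum _ fun l _ => (hi j l).re
  simp only [e]
  rw [integral_finsetSum _ fun j _ => hi2 j, Finset.sum_mul, ← Finset.sum_neg_distrib]
  refine Finset.sum_congr rfl fun j _ => ?_
  rw [integral_sum_re _ fun l _ => hi j l, Finset.sum_mul, ← Finset.sum_neg_distrib]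
  refine Finset.sum_congr rfl fun l hl => ?_
  rw [integral_neg, integral_const_mul, integral_prod_mul (wave (η j)) (wave (η l)), ← ft, ← ft,
    show (inner ℝ (η j) (η l) : ℝ) * c * ftProd η ((Finset.univ.erase j).erase l) m *
      (ft m (η j) * ft m (η l)) = (inner ℝ (η j) (η l) : ℝ) * (c *
      ((ftProd η ((Finset.univ.erase j).erase l) m * ft m (η l)) * ft m (η j))) by ring, ftProd,
    Finset.prod_erase_mul _ _ hl, Finset.prod_erase_mul _ _ (Finset.mem_univ j), ← ftProd,
    Complex.neg_re, Complex.re_ofReal_mul]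

lemma sum_norm_sq_add_sum_inner :
    ∑ j, ‖η j‖ ^ 2 + ∑ j, ∑ l ∈ Finset.univ.erase j, inner ℝ (η j) (η l) = ‖∑ j, η j‖ ^ 2 := by
  rw [← Finset.sum_add_distrib, ← real_inner_self_eq_norm_sq, sum_inner]
  refine Finset.sum_congr rfl fun j _ => ?_
  rw [← real_inner_self_eq_norm_sq, inner_sum]
  exact Finset.add_sum_erase _ (fun l => inner ℝ (η j) (η l)) (Finset.mem_univ j)

/-- The eigenvalue equation: (1+ε)Σ|η_j|² comes from D, the off-diagonal Σ⟨η_j, η_l⟩ from H, and the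
latter completes the square |Ση_j|². -/
lemma traceLaplacian_prod (ε : ℝ) (m : P2 d) :
    traceLaplacian ε m (prodD c η m) (prodH c η m) =
      -(‖∑ j, η j‖ ^ 2 + ε * ∑ j, ‖η j‖ ^ 2) * (c * ftProd η Finset.univ m).re := by
  rw [traceLaplacian, integral_opTrace_prodD, integral_opTrace_prodH,
    ← sum_norm_sq_add_sum_inner η]
  ring

end ProdUniform

/-! ### Superposition of functions with uniform derivatives -/

section Superposition

/-- One form of Fubini for an arbitrary bilinear pairing; it serves the inner product with y - x,
the action of H on y - x, and the trace. -/
lemma integral_bilin_integral_comm {Θ Z G K K' : Type*} [MeasurableSpace Θ] [MeasurableSpace Z]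
    [NormedAddCommGroup G] [NormedSpace ℝ G] [CompleteSpace G]
    [NormedAddCommGroup K] [NormedSpace ℝ K] [NormedAddCommGroup K'] [NormedSpace ℝ K']
    [CompleteSpace K']
    {μ : Measure Θ} {γ : Measure Z} [SFinite μ] [SFinite γ] (L : G →L[ℝ] K →L[ℝ] K')
    {f : Θ → Z → G} {v : Z → K} {M : Θ → ℝ}
    (hm : StronglyMeasurable fun p : Θ × Z => f p.1 p.2) (hM : Integrable M μ)
    (hb : ∀ θ z, ‖f θ z‖ ≤ M θ) (hv : Integrable v γ) :
    ∫ z, L (∫ θ, f θ z ∂μ) (v z) ∂γ = ∫ θ, ∫ z, L (f θ z) (v z) ∂γ ∂μ ∧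
      Integrable (fun θ => ∫ z, L (f θ z) (v z) ∂γ) μ := by
  have hint : Integrable (fun p : Θ × Z => L (f p.1 p.2) (v p.2)) (μ.prod γ) := by
    refine Integrable.mono' ((hM.mul_prod hv.norm).const_mul ‖L‖)
      (L.aestronglyMeasurable_comp₂ hm.aestronglyMeasurable hv.aestronglyMeasurable.comp_snd)
      (ae_of_all _ fun p => (L.le_opNorm₂ _ _).trans ?_)
    rw [mul_assoc]
    gcongr
    exact hb p.1 p.2
  have hf : ∀ z, Integrable (fun θ => f θ z) μ := fun z =>
    hM.mono' (hm.comp_measurable (measurable_id.prodMk measurable_const)).aestronglyMeasurable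
      (ae_of_all _ fun θ => hb θ z)
  have h1 : ∀ z, L (∫ θ, f θ z ∂μ) (v z) = ∫ θ, L (f θ z) (v z) ∂μ := fun z => by
    rw [← ContinuousLinearMap.integral_comp_comm L (hf z),
      ContinuousLinearMap.integral_apply (L.integrable_comp (hf z))]
  refine ⟨?_, hint.integral_prod_left⟩
  simp only [h1]
  exact integral_integral_swap (f := fun z θ => L (f θ z) (v z)) hint.swap

lemma adjoint_integral_apply {Θ : Type*} [MeasurableSpace Θ] {μ : Measure Θ} {d : ℕ}
    {T : Θ → E d →L[ℝ] E d} (hT : Integrable T μ) (e : E d) :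
    ContinuousLinearMap.adjoint (∫ θ, T θ ∂μ) e = ∫ θ, ContinuousLinearMap.adjoint (T θ) e ∂μ := by
  have h : Integrable (fun θ => ContinuousLinearMap.adjoint (T θ) e) μ := by
    refine (hT.norm.mul_const ‖e‖).mono' ?_ (ae_of_all _ fun θ => ?_)
    · have h1 : Continuous fun S : E d →L[ℝ] E d => ContinuousLinearMap.adjoint S e :=
        (ContinuousLinearMap.adjoint.continuous).clm_apply continuous_const
      exact h1.comp_aestronglyMeasurable hT.aestronglyMeasurable
    · refine (ContinuousLinearMap.le_opNorm _ _).trans ?_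
      rw [LinearIsometryEquiv.norm_map]
  refine ext_inner_right ℝ fun v => ?_
  rw [ContinuousLinearMap.adjoint_inner_left, ContinuousLinearMap.integral_apply hT,
    ← integral_inner (hT.apply_continuousLinearMap v), real_inner_comm, ← integral_inner h]
  refine integral_congr_ae (ae_of_all _ fun θ => ?_)
  beta_reduce
  rw [← real_inner_comm, ContinuousLinearMap.adjoint_inner_right, real_inner_comm]

lemma integral_sub_sub_eq {Θ G : Type*} [MeasurableSpace Θ] {μ : Measure Θ}
    [NormedAddCommGroup G] [NormedSpace ℝ G] {f g h : Θ → G} (hf : Integrable f μ)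
    (hg : Integrable g μ) (hh : Integrable h μ) :
    ∫ θ, f θ ∂μ - ∫ θ, g θ ∂μ - ∫ θ, h θ ∂μ = ∫ θ, (f θ - g θ - h θ) ∂μ := by
  rw [← integral_sub hf hg]
  exact (integral_sub (hf.sub hg) hh).symm

variable {d : ℕ} {Θ : Type*} [MeasurableSpace Θ] {μ : Measure Θ}
  {U : Θ → P2 d → ℝ} {A : Θ → P2 d → E d → E d} {D : Θ → P2 d → E d → E d →L[ℝ] E d}
  {H : Θ → P2 d → E d → E d → E d →L[ℝ] E d} {M : Θ → ℝ}

lemma integrable_of_stronglyMeasurable_prod {Z G : Type*} [MeasurableSpace Z]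
    [NormedAddCommGroup G] {f : Θ → Z → G}
    (hm : StronglyMeasurable fun p : Θ × Z => f p.1 p.2) (hM : Integrable M μ)
    (hb : ∀ θ z, ‖f θ z‖ ≤ M θ) (z : Z) : Integrable (fun θ => f θ z) μ :=
  hM.mono' (hm.comp_measurable (measurable_id.prodMk measurable_const)).aestronglyMeasurable
    (ae_of_all _ fun θ => hb θ z)

lemma norm_integral_le_integral_mul {G : Type*} [NormedAddCommGroup G] [NormedSpace ℝ G]
    {f : Θ → G} (hM : Integrable M μ) {r : ℝ} (hb : ∀ θ, ‖f θ‖ ≤ M θ * r) :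
    ‖∫ θ, f θ ∂μ‖ ≤ (∫ θ, M θ ∂μ) * r := by
  rw [← integral_mul_const]
  exact norm_integral_le_of_norm_le (hM.mul_const r) (ae_of_all _ hb)

variable [SFinite μ]

/-- Each quantitative condition bounds the norm of an expression linear in (U, A, D, H), so it may
be integrated in θ with M integrated alongside. The tangency conditions pass by
`isTangent_integral`. Fubini exchanges the integrals over θ and over the plan. -/
theorem HasUniformDerivs.integral (h : ∀ θ, HasUniformDerivs (U θ) (A θ) (D θ) (H θ) (M θ))
    (hM : Integrable M μ) (hU : ∀ m, Integrable (fun θ => U θ m) μ)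
    (hA : ∀ m, StronglyMeasurable fun p : Θ × E d => A p.1 m p.2)
    (hD : ∀ m, StronglyMeasurable fun p : Θ × E d => D p.1 m p.2)
    (hH : ∀ m, StronglyMeasurable fun p : Θ × (E d × E d) => H p.1 m p.2.1 p.2.2) :
    HasUniformDerivs (fun m => ∫ θ, U θ m ∂μ) (fun m x => ∫ θ, A θ m x ∂μ)
      (fun m x => ∫ θ, D θ m x ∂μ) (fun m x y => ∫ θ, H θ m x y ∂μ) (∫ θ, M θ ∂μ) := by
  have iA : ∀ m x, Integrable (fun θ => A θ m x) μ := fun m =>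
    integrable_of_stronglyMeasurable_prod (hA m) hM fun θ => (h θ).norm_A m
  have iD : ∀ m x, Integrable (fun θ => D θ m x) μ := fun m =>
    integrable_of_stronglyMeasurable_prod (hD m) hM fun θ => (h θ).norm_D m
  have hH' : ∀ m x, StronglyMeasurable fun p : Θ × E d => H p.1 m x p.2 := fun m x =>
    (hH m).comp_measurable (measurable_fst.prodMk (measurable_const.prodMk measurable_snd))
  have iH : ∀ m x y, Integrable (fun θ => H θ m x y) μ := fun m x =>
    integrable_of_stronglyMeasurable_prod (hH' m x) hM fun θ => (h θ).norm_H m x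
  refine ⟨fun m x => norm_integral_le_of_norm_le hM (ae_of_all _ fun θ => (h θ).norm_A m x),
    fun m x => norm_integral_le_of_norm_le hM (ae_of_all _ fun θ => (h θ).norm_D m x),
    fun m x y => norm_integral_le_of_norm_le hM (ae_of_all _ fun θ => (h θ).norm_H m x y),
    fun m ν γ hγ => ?_, fun m x y => ?_, fun m x y => ?_, fun m ν γ hγ x => ?_,
    fun m ν γ hγ x => ?_, fun m x y x' y' => ?_, fun m ν γ hγ x y => ?_, fun m => ?_,
    fun m x e => ?_, fun m ζ hζ => ?_⟩
  · have := isProbabilityMeasure_of_mem_couplings hγ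
    obtain ⟨e1, e2⟩ := integral_bilin_integral_comm (μ := μ) (γ := γ)
      (f := fun θ z => A θ m z.1) (innerSL ℝ : E d →L[ℝ] E d →L[ℝ] ℝ)
      ((hA m).comp_measurable (measurable_fst.prodMk (measurable_fst.comp measurable_snd))) hM
      (fun θ z => (h θ).norm_A m z.1) (integrable_sub_of_mem_couplings hγ)
    change ∫ z, inner ℝ (∫ θ, A θ m z.1 ∂μ) (z.2 - z.1) ∂γ =
      ∫ θ, ∫ z, inner ℝ (A θ m z.1) (z.2 - z.1) ∂γ ∂μ at e1
    change Integrable (fun θ => ∫ z, inner ℝ (A θ m z.1) (z.2 - z.1) ∂γ) μ at e2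
    rw [e1, integral_sub_sub_eq (hU ν) (hU m) e2, ← Real.norm_eq_abs]
    exact norm_integral_le_integral_mul hM fun θ => (h θ).expand_U m ν γ hγ
  · rw [ContinuousLinearMap.integral_apply (iD m x), integral_sub_sub_eq (iA m y) (iA m x)
      ((iD m x).apply_continuousLinearMap _)]
    exact norm_integral_le_integral_mul hM fun θ => (h θ).taylor_A m x y
  · rw [← integral_sub (iD m y) (iD m x)]
    exact norm_integral_le_integral_mul hM fun θ => (h θ).lip_D m x y
  · rw [← integral_sub (iD ν x) (iD m x)]
    exact norm_integral_le_integral_mul hM fun θ => (h θ).lip_D' m ν γ hγ x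
  · have := isProbabilityMeasure_of_mem_couplings hγ
    obtain ⟨e1, e2⟩ := integral_bilin_integral_comm (μ := μ) (γ := γ)
      (f := fun θ z => H θ m x z.1) (ContinuousLinearMap.id ℝ (E d →L[ℝ] E d))
      ((hH' m x).comp_measurable (measurable_fst.prodMk (measurable_fst.comp measurable_snd))) hM
      (fun θ z => (h θ).norm_H m x z.1) (integrable_sub_of_mem_couplings hγ)
    simp only [ContinuousLinearMap.id_apply] at e1 e2
    rw [e1, integral_sub_sub_eq (iA ν x) (iA m x) e2]
    exact norm_integral_le_integral_mul hM fun θ => (h θ).expand_A m ν γ hγ x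
  · rw [← integral_sub (iH m x' y') (iH m x y)]
    exact norm_integral_le_integral_mul hM fun θ => (h θ).lip_H m x y x' y'
  · rw [← integral_sub (iH ν x y) (iH m x y)]
    exact norm_integral_le_integral_mul hM fun θ => (h θ).lip_H' m ν γ hγ x y
  · exact isTangent_integral (fun θ => (h θ).tangent_A m) (hA m).aestronglyMeasurable hM
      fun θ => (h θ).norm_A m
  · have hadj : Continuous fun S : E d →L[ℝ] E d => ContinuousLinearMap.adjoint S e :=
      (ContinuousLinearMap.adjoint.continuous).clm_apply continuous_const
    refine (isTangent_integral (fun θ => (h θ).tangent_H m x e)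
      (hadj.comp_stronglyMeasurable (hH' m x)).aestronglyMeasurable (hM.mul_const ‖e‖)
      fun θ y => ?_).congr fun y => (adjoint_integral_apply (iH m x y) e).symm
    refine (ContinuousLinearMap.le_opNorm _ _).trans ?_
    rw [LinearIsometryEquiv.norm_map]
    gcongr
    exact (h θ).norm_H m x y
  · obtain ⟨B, hB0, hB⟩ := hζ.exists_bound
    obtain ⟨B', hB0', hB'⟩ := hζ.fderiv.exists_bound
    have iDa : ∀ x, Integrable (fun θ => ContinuousLinearMap.adjoint (D θ m x) (ζ x)) μ :=
      fun x => by
        have hadj : Continuous fun S : E d →L[ℝ] E d => ContinuousLinearMap.adjoint S (ζ x) :=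
          (ContinuousLinearMap.adjoint.continuous).clm_apply continuous_const
        refine ((iD m x).norm.mul_const ‖ζ x‖).mono'
          (hadj.comp_aestronglyMeasurable (iD m x).aestronglyMeasurable)
          (ae_of_all _ fun θ => (ContinuousLinearMap.le_opNorm _ _).trans ?_)
        rw [LinearIsometryEquiv.norm_map]
    have hc : Continuous fun q : (E d →L[ℝ] E d) × E d × E d =>
        ContinuousLinearMap.adjoint q.1 (ζ q.2.2) +
          ContinuousLinearMap.adjoint (fderiv ℝ ζ q.2.2) q.2.1 :=
      ((ContinuousLinearMap.adjoint.continuous.comp continuous_fst).clm_apply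
        (hζ.continuous.comp (continuous_snd.comp continuous_snd))).add
        ((ContinuousLinearMap.adjoint.continuous.comp
          (hζ.fderiv.continuous.comp (continuous_snd.comp continuous_snd))).clm_apply
          (continuous_fst.comp continuous_snd))
    refine (isTangent_integral (fun θ => (h θ).tangent_D m ζ hζ)
      (hc.comp_stronglyMeasurable ((hD m).prodMk ((hA m).prodMk
        measurable_snd.stronglyMeasurable))).aestronglyMeasurable
      (hM.mul_const (B + B')) fun θ x => ?_).congr fun x => ?_
    · have h0 := (h θ).nonneg
      refine (norm_add_le _ _).trans ?_
      rw [mul_add]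
      gcongr
      · refine (ContinuousLinearMap.le_opNorm _ _).trans ?_
        rw [LinearIsometryEquiv.norm_map]
        exact mul_le_mul ((h θ).norm_D m x) (hB x) (norm_nonneg _) h0
      · refine (ContinuousLinearMap.le_opNorm _ _).trans ?_
        rw [LinearIsometryEquiv.norm_map, mul_comm]
        exact mul_le_mul ((h θ).norm_A m x) (hB' x) (norm_nonneg _) h0
    · rw [adjoint_integral_apply (iD m x), integral_add (iDa x)
        (ContinuousLinearMap.integrable_comp _ (iA m x)),
        ContinuousLinearMap.integral_comp_comm _ (iA m x)]

lemma traceLaplacian_integral (h : ∀ θ, HasUniformDerivs (U θ) (A θ) (D θ) (H θ) (M θ))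
    (hM : Integrable M μ) (m : P2 d)
    (hD : StronglyMeasurable fun p : Θ × E d => D p.1 m p.2)
    (hH : StronglyMeasurable fun p : Θ × (E d × E d) => H p.1 m p.2.1 p.2.2) (ε : ℝ) :
    traceLaplacian ε m (fun x => ∫ θ, D θ m x ∂μ) (fun x y => ∫ θ, H θ m x y ∂μ) =
      ∫ θ, traceLaplacian ε m (D θ m) (H θ m) ∂μ ∧
    Integrable (fun θ => traceLaplacian ε m (D θ m) (H θ m)) μ := by
  have key : ∀ {Z : Type} [MeasurableSpace Z] (ν : Measure Z) [IsProbabilityMeasure ν]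
      (T : Θ → Z → E d →L[ℝ] E d), StronglyMeasurable (fun p : Θ × Z => T p.1 p.2) →
      (∀ θ z, ‖T θ z‖ ≤ M θ) →
      ∫ z, opTrace d (∫ θ, T θ z ∂μ) ∂ν = ∫ θ, ∫ z, opTrace d (T θ z) ∂ν ∂μ ∧
        Integrable (fun θ => ∫ z, opTrace d (T θ z) ∂ν) μ := by
    intro Z _ ν _ T hT hb
    -- The linear functional `opTrace` is viewed as a bilinear pairing with the constant function 1.
    have := integral_bilin_integral_comm (μ := μ) (γ := ν)
      ((ContinuousLinearMap.lsmul ℝ ℝ : ℝ →L[ℝ] ℝ →L[ℝ] ℝ).comp (opTrace d)) hT hM hb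
      (integrable_const (1 : ℝ))
    simpa using this
  obtain ⟨d1, d2⟩ := key m.1 (fun θ => D θ m) hD fun θ => (h θ).norm_D m
  obtain ⟨h1, h2⟩ := key (m.1.prod m.1) (fun θ p => H θ m p.1 p.2) hH
    fun θ p => (h θ).norm_H m p.1 p.2
  simp only [traceLaplacian]
  refine ⟨?_, (d2.const_mul _).add h2⟩
  rw [d1, h1, integral_add (d2.const_mul _) h2, integral_const_mul]

end Superposition

/-! ### The functions `F^k_ξ` -/

section FourierBasis

variable {d k : ℕ}

/-- The frequencies `2π ξ_j`. -/
def freq (ξ : Fin k → E d) (j : Fin k) : E d := (2 * Real.pi) • ξ j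

lemma continuous_freq : Continuous (freq : (Fin k → E d) → Fin k → E d) := by
  unfold freq
  fun_prop

lemma exp_neg_eq_prod_wave (ξ x : Fin k → E d) :
    Complex.exp (-(2 * Real.pi * Complex.I * ((∑ j, inner ℝ (ξ j) (x j) : ℝ) : ℂ))) =
      ∏ j, wave (freq ξ j) (x j) := by
  simp only [wave, freq]
  rw [← Complex.exp_sum]
  congr 1
  rw [Finset.sum_neg_distrib, Complex.ofReal_sum, Finset.mul_sum]
  congr 1
  refine Finset.sum_congr rfl fun j _ => ?_
  rw [real_inner_smul_left]
  push_cast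
  ring

/-- For each permutation the integral factorizes into the same Fourier transforms in another order.
The k! summands are therefore equal, and the factor 1/k! cancels their number. -/
lemma F_eq (ξ : Fin k → E d) (m : P2 d) :
    F k ξ m = (1 / (k : ℂ)) * ftProd (freq ξ) Finset.univ m := by
  have h : ∀ σ : Equiv.Perm (Fin k), (fun x : Fin k → E d =>
      Complex.exp (-(2 * Real.pi * Complex.I * ((∑ j, inner ℝ (ξ (σ j)) (x j) : ℝ) : ℂ)))) =
      fun x => ∏ j, wave (freq ξ (σ j)) (x j) := fun σ =>
    funext fun x => exp_neg_eq_prod_wave (fun j => ξ (σ j)) x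
  have hi : ∀ σ : Equiv.Perm (Fin k), Integrable (fun x : Fin k → E d =>
      ∏ j, wave (freq ξ (σ j)) (x j)) (Measure.pi fun _ : Fin k => m.1) := fun σ =>
    Integrable.fintype_prod fun j => integrable_wave m.1 _
  have hk : (k.factorial : ℂ) ≠ 0 := by exact_mod_cast k.factorial_ne_zero
  unfold F
  congr 1
  unfold Phi
  rw [integral_const_mul, integral_finsetSum _ fun σ _ => by rw [h σ]; exact hi σ]
  have e : ∀ σ : Equiv.Perm (Fin k), ∫ x : Fin k → E d,
      Complex.exp (-(2 * Real.pi * Complex.I * ((∑ j, inner ℝ (ξ (σ j)) (x j) : ℝ) : ℂ)))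
        ∂(Measure.pi fun _ : Fin k => m.1) = ftProd (freq ξ) Finset.univ m := fun σ => by
    rw [h σ, integral_fintype_prod_eq_prod fun j => wave (freq ξ (σ j))]
    exact Equiv.prod_comp σ fun j => ft m (freq ξ j)
  rw [Finset.sum_congr rfl fun σ _ => e σ, Finset.sum_const, Finset.card_univ,
    Fintype.card_perm, Fintype.card_fin, nsmul_eq_mul, ← mul_assoc, one_div_mul_cancel hk, one_mul]

lemma norm_F_le (ξ : Fin k → E d) (m : P2 d) : ‖F k ξ m‖ ≤ 1 / k := by
  rw [F_eq, norm_mul, norm_div, norm_one, Complex.norm_natCast]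
  exact mul_le_of_le_one_right (by positivity) (norm_ftProd_le _ _ _)

lemma continuous_ftProd {ι : Type*} (s : Finset ι) (m : P2 d) :
    Continuous fun η : ι → E d => ftProd η s m := by
  unfold ftProd
  exact continuous_finsetProd _ fun i _ => (continuous_ft m).comp (continuous_apply i)

lemma continuous_F (m : P2 d) : Continuous fun ξ : Fin k → E d => F k ξ m := by
  simp only [F_eq]
  exact continuous_const.mul ((continuous_ftProd _ m).comp continuous_freq)

lemma lamSq_eq (ε : ℝ) (ξ : Fin k → E d) :
    lamSq k ε ξ = ‖∑ j, freq ξ j‖ ^ 2 + ε * ∑ j, ‖freq ξ j‖ ^ 2 := by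
  have h : ∀ v : E d, ‖(2 * Real.pi) • v‖ ^ 2 = 4 * Real.pi ^ 2 * ‖v‖ ^ 2 := fun v => by
    rw [norm_smul, mul_pow, Real.norm_eq_abs, sq_abs]
    ring
  simp only [freq, lamSq]
  rw [← Finset.smul_sum, h, Finset.sum_congr rfl fun j _ => h (ξ j), ← Finset.mul_sum]
  ring

lemma continuous_lamSq (ε : ℝ) : Continuous (lamSq k ε : (Fin k → E d) → ℝ) := by
  unfold lamSq
  fun_prop

lemma lamSq_nonneg {ε : ℝ} (hε : 0 ≤ ε) (ξ : Fin k → E d) : 0 ≤ lamSq k ε ξ := by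
  unfold lamSq
  positivity

lemma sum_norm_sq_le (η : Fin k → E d) : ∑ j, ‖η j‖ ^ 2 ≤ (∑ j, ‖η j‖) ^ 2 :=
  Finset.sum_sq_le_sq_sum_of_nonneg fun _ _ => norm_nonneg _

/-- λ² is of second degree in the frequencies, so the weight that controls the derivatives also
controls the coefficients of the Laplacian. -/
lemma abs_lamSq_mul_le (ε : ℝ) (c : ℂ) (ξ : Fin k → E d) :
    |lamSq k ε ξ| * ‖c‖ ≤ (1 + |ε|) * prodBound c (freq ξ) := by
  have h0 := sum_norm_nonneg (freq ξ)
  have h1 : |lamSq k ε ξ| ≤ (1 + |ε|) * (∑ j, ‖freq ξ j‖) ^ 2 := by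
    rw [lamSq_eq, add_mul, one_mul]
    refine (abs_add_le _ _).trans (add_le_add ?_ ?_)
    · rw [abs_of_nonneg (by positivity)]
      gcongr
      exact norm_sum_le _ _
    · rw [abs_mul, abs_of_nonneg (a := ∑ j, ‖freq ξ j‖ ^ 2) (by positivity)]
      gcongr
      exact sum_norm_sq_le _
  have h2 : ‖c‖ * (∑ j, ‖freq ξ j‖) ^ 2 ≤ prodBound c (freq ξ) := by
    refine le_trans ?_ (le_prodBound_two c (freq ξ))
    nlinarith [mul_nonneg (norm_nonneg c) (sq_nonneg (∑ j, ‖freq ξ j‖))]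
  calc _ ≤ (1 + |ε|) * (∑ j, ‖freq ξ j‖) ^ 2 * ‖c‖ := by gcongr
    _ = (1 + |ε|) * (‖c‖ * (∑ j, ‖freq ξ j‖) ^ 2) := by ring
    _ ≤ _ := by gcongr

lemma norm_le_prodBound (c : ℂ) (η : Fin k → E d) : ‖c‖ ≤ prodBound c η := by
  have h0 := sum_norm_nonneg η
  have : 1 ≤ (1 + ∑ j, ‖η j‖) ^ 3 := one_le_pow₀ (by linarith)
  rw [prodBound]
  nlinarith [norm_nonneg c]

end FourierBasis

/-! ### Joint continuity in coefficient, frequencies and points -/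

section ProdContinuity

variable {d k : ℕ} (m : P2 d)

lemma continuous_outer : Continuous fun p : E d × E d => outer p.1 p.2 := by
  have : (fun p : E d × E d => outer p.1 p.2) = fun p =>
      ContinuousLinearMap.smulRightL ℝ (E d) (E d) (innerSL ℝ p.2) p.1 := rfl
  rw [this]
  fun_prop

lemma continuous_prodA : Continuous fun p : (ℂ × (Fin k → E d)) × E d =>
    prodA p.1.1 p.1.2 m p.2 := by
  unfold prodA
  refine continuous_finsetSum _ fun j _ => ?_
  have h := (continuous_ftProd (Finset.univ.erase j) m).comp
    (show Continuous fun p : (ℂ × (Fin k → E d)) × E d => p.1.2 by fun_prop)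
  have hz : Continuous fun p : (ℂ × (Fin k → E d)) × E d =>
      p.1.1 * ftProd p.1.2 (Finset.univ.erase j) m * (-Complex.I * wave (p.1.2 j) p.2) :=
    ((continuous_fst.comp continuous_fst).mul h).mul
      (continuous_const.mul (Continuous.wave (by fun_prop) (by fun_prop)))
  have hv : Continuous fun p : (ℂ × (Fin k → E d)) × E d => p.1.2 j := by fun_prop
  exact (Complex.continuous_re.comp hz).smul hv

lemma continuous_prodD : Continuous fun p : (ℂ × (Fin k → E d)) × E d =>
    prodD p.1.1 p.1.2 m p.2 := by
  unfold prodD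
  refine continuous_finsetSum _ fun j _ => ?_
  have h := (continuous_ftProd (Finset.univ.erase j) m).comp
    (show Continuous fun p : (ℂ × (Fin k → E d)) × E d => p.1.2 by fun_prop)
  have hz : Continuous fun p : (ℂ × (Fin k → E d)) × E d =>
      -(p.1.1 * ftProd p.1.2 (Finset.univ.erase j) m * wave (p.1.2 j) p.2) :=
    (((continuous_fst.comp continuous_fst).mul h).mul
      (Continuous.wave (by fun_prop) (by fun_prop))).neg
  have hv : Continuous fun p : (ℂ × (Fin k → E d)) × E d => (p.1.2 j, p.1.2 j) := by fun_prop
  exact (Complex.continuous_re.comp hz).smul (continuous_outer.comp hv)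

lemma continuous_prodH : Continuous fun p : (ℂ × (Fin k → E d)) × (E d × E d) =>
    prodH p.1.1 p.1.2 m p.2.1 p.2.2 := by
  unfold prodH
  refine continuous_finsetSum _ fun j _ => continuous_finsetSum _ fun l _ => ?_
  have h := (continuous_ftProd ((Finset.univ.erase j).erase l) m).comp
    (show Continuous fun p : (ℂ × (Fin k → E d)) × (E d × E d) => p.1.2 by fun_prop)
  have hz : Continuous fun p : (ℂ × (Fin k → E d)) × (E d × E d) =>
      -(p.1.1 * ftProd p.1.2 ((Finset.univ.erase j).erase l) m * wave (p.1.2 j) p.2.1 *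
        wave (p.1.2 l) p.2.2) :=
    ((((continuous_fst.comp continuous_fst).mul h).mul
      (Continuous.wave (by fun_prop) (by fun_prop))).mul
      (Continuous.wave (by fun_prop) (by fun_prop))).neg
  have hv : Continuous fun p : (ℂ × (Fin k → E d)) × (E d × E d) => (p.1.2 j, p.1.2 l) := by
    fun_prop
  exact (Complex.continuous_re.comp hz).smul (continuous_outer.comp hv)

end ProdContinuity

/-! ### Second derivatives of Fourier series -/

section Series

variable {d : ℕ}

/-- The weighted mass of the `k`-th term of a Fourier series. -/
def weight (a : Coeff d) (k : ℕ) (ξ : Fin k → E d) : ℝ :=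
  prodBound (a k ξ / (k * k.factorial)) (freq ξ)

/-- Fourier series which can be differentiated twice, term by term. -/
structure IsSmoothCoeff (a : Coeff d) : Prop where
  measurable : ∀ k, 1 ≤ k → Measurable (a k)
  integrable : ∀ k, 1 ≤ k → Integrable (weight a k)
  summable : Summable fun n : ℕ => ∫ ξ, weight a (n + 1) ξ

lemma term_eq (a : Coeff d) (k : ℕ) (m : P2 d) : term a k m =
    ∫ ξ, a k ξ / (k * k.factorial) * ftProd (freq ξ) Finset.univ m := by
  unfold term
  rw [← integral_const_mul]
  refine integral_congr_ae (ae_of_all _ fun ξ => ?_)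
  beta_reduce
  rw [F_eq]
  simp only [div_eq_mul_inv, mul_inv]
  ring

lemma prodBound_unit_mul {ι : Type*} [Fintype ι] [DecidableEq ι] {u : ℂ} (hu : ‖u‖ = 1) (c : ℂ)
    (η : ι → E d) : prodBound (u * c) η = prodBound c η := by
  rw [prodBound, prodBound, norm_mul, hu, one_mul]

namespace IsSmoothCoeff

variable {a : Coeff d} (h : IsSmoothCoeff a)
include h

lemma integrable_coeff {k : ℕ} (hk : 1 ≤ k) :
    Integrable (fun ξ => a k ξ / (k * k.factorial)) :=
  (h.integrable k hk).mono' ((h.measurable k hk).div_const _).aestronglyMeasurable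
    (ae_of_all _ fun _ => norm_le_prodBound _ _)

lemma integrable_coeff_mul {k : ℕ} (hk : 1 ≤ k) (m : P2 d) : Integrable (fun ξ =>
    a k ξ / (k * k.factorial) * ftProd (freq ξ) Finset.univ m) :=
  (h.integrable_coeff hk).mul_bdd (c := 1)
    ((continuous_ftProd _ m).comp continuous_freq).aestronglyMeasurable
    (ae_of_all _ fun _ => norm_ftProd_le _ _ _)

lemma re_mul_term {k : ℕ} (hk : 1 ≤ k) (u : ℂ) (m : P2 d) : (u * term a k m).re =
    ∫ ξ, (u * (a k ξ / (k * k.factorial)) * ftProd (freq ξ) Finset.univ m).re := by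
  rw [term_eq, ← integral_const_mul]
  simp only [mul_assoc]
  exact (integral_re ((h.integrable_coeff_mul hk m).const_mul u)).symm

lemma norm_term_le {k : ℕ} (hk : 1 ≤ k) (m : P2 d) : ‖term a k m‖ ≤ ∫ ξ, weight a k ξ := by
  rw [term_eq]
  refine norm_integral_le_of_norm_le (h.integrable k hk) (ae_of_all _ fun ξ => ?_)
  rw [norm_mul]
  exact (mul_le_of_le_one_right (norm_nonneg _) (norm_ftProd_le _ _ _)).trans
    (norm_le_prodBound _ _)

lemma summable_term (m : P2 d) : Summable fun n : ℕ => term a (n + 1) m :=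
  Summable.of_norm_bounded h.summable fun n => h.norm_term_le (by lia) m

lemma stronglyMeasurable_comp {k : ℕ} (hk : 1 ≤ k) (u : ℂ) {Z G : Type*} [TopologicalSpace Z]
    [MeasurableSpace Z] [OpensMeasurableSpace Z] [SecondCountableTopology Z]
    [TopologicalSpace.PseudoMetrizableSpace Z] [TopologicalSpace G]
    {f : (ℂ × (Fin k → E d)) × Z → G} (hf : Continuous f) : StronglyMeasurable
      fun p : (Fin k → E d) × Z => f ((u * (a k p.1 / (k * k.factorial)), freq p.1), p.2) := by
  have hm := h.measurable k hk
  have hq : Measurable fun p : (Fin k → E d) × Z =>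
      ((u * (a k p.1 / (k * k.factorial)), freq p.1), p.2) :=
    ((measurable_const.mul ((hm.comp measurable_fst).div_const _)).prodMk
      (continuous_freq.measurable.comp measurable_fst)).prodMk measurable_snd
  exact hf.comp_stronglyMeasurable hq.stronglyMeasurable

/-- Superposition over ξ. The unit u leaves the weight unchanged and treats real and imaginary parts
together: u = 1 gives the former, u = -i the latter. -/
theorem hasUniformDerivs_term {u : ℂ} (hu : ‖u‖ = 1) {k : ℕ} (hk : 1 ≤ k) :
    HasUniformDerivs (fun m => (u * term a k m).re)
      (fun m x => ∫ ξ, prodA (u * (a k ξ / (k * k.factorial))) (freq ξ) m x)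
      (fun m x => ∫ ξ, prodD (u * (a k ξ / (k * k.factorial))) (freq ξ) m x)
      (fun m x y => ∫ ξ, prodH (u * (a k ξ / (k * k.factorial))) (freq ξ) m x y)
      (∫ ξ, weight a k ξ) := by
  simp only [h.re_mul_term hk]
  refine HasUniformDerivs.integral (fun ξ => ?_) (h.integrable k hk) (fun m => ?_)
    (fun m => h.stronglyMeasurable_comp hk u (continuous_prodA m))
    (fun m => h.stronglyMeasurable_comp hk u (continuous_prodD m))
    (fun m => h.stronglyMeasurable_comp hk u (continuous_prodH m))
  · rw [weight, ← prodBound_unit_mul hu]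
    exact hasUniformDerivs_prod _ _
  · simp only [mul_assoc]
    exact ((h.integrable_coeff_mul hk m).const_mul u).re

end IsSmoothCoeff

/-- The coefficients of the Laplacian of a Fourier series. -/
def lapCoeff (a : Coeff d) (ε : ℝ) : Coeff d := fun k ξ => -(lamSq k ε ξ : ℂ) * a k ξ

lemma norm_lapCoeff_div_le (a : Coeff d) (ε : ℝ) (k : ℕ) (ξ : Fin k → E d) :
    ‖lapCoeff a ε k ξ / (k * k.factorial)‖ ≤ (1 + |ε|) * weight a k ξ := by
  refine le_trans (le_of_eq ?_) (abs_lamSq_mul_le ε _ ξ)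
  rw [lapCoeff, mul_div_assoc, norm_mul, norm_neg, Complex.norm_real, Real.norm_eq_abs]

namespace IsSmoothCoeff

variable {a : Coeff d} (h : IsSmoothCoeff a)
include h

lemma integrable_lapCoeff (ε : ℝ) {k : ℕ} (hk : 1 ≤ k) :
    Integrable (fun ξ => lapCoeff a ε k ξ / (k * k.factorial)) := by
  refine ((h.integrable k hk).const_mul (1 + |ε|)).mono' ?_
    (ae_of_all _ fun ξ => norm_lapCoeff_div_le a ε k ξ)
  have hm := h.measurable k hk
  have := (continuous_lamSq (d := d) (k := k) ε).measurable
  unfold lapCoeff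
  fun_prop

lemma integrable_lapCoeff_mul (ε : ℝ) {k : ℕ} (hk : 1 ≤ k) (m : P2 d) : Integrable (fun ξ =>
    lapCoeff a ε k ξ / (k * k.factorial) * ftProd (freq ξ) Finset.univ m) :=
  (h.integrable_lapCoeff ε hk).mul_bdd (c := 1)
    ((continuous_ftProd _ m).comp continuous_freq).aestronglyMeasurable
    (ae_of_all _ fun _ => norm_ftProd_le _ _ _)

lemma norm_term_lapCoeff_le (ε : ℝ) {k : ℕ} (hk : 1 ≤ k) (m : P2 d) :
    ‖term (lapCoeff a ε) k m‖ ≤ (1 + |ε|) * ∫ ξ, weight a k ξ := by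
  rw [term_eq, ← integral_const_mul]
  refine norm_integral_le_of_norm_le ((h.integrable k hk).const_mul _) (ae_of_all _ fun ξ => ?_)
  rw [norm_mul]
  exact (mul_le_of_le_one_right (norm_nonneg _) (norm_ftProd_le _ _ _)).trans
    (norm_lapCoeff_div_le a ε k ξ)

lemma summable_term_lapCoeff (ε : ℝ) (m : P2 d) :
    Summable fun n : ℕ => term (lapCoeff a ε) (n + 1) m :=
  Summable.of_norm_bounded (h.summable.mul_left (1 + |ε|)) fun n =>
    h.norm_term_lapCoeff_le ε (by lia) m

lemma traceLaplacian_term {u : ℂ} (hu : ‖u‖ = 1) {k : ℕ} (hk : 1 ≤ k) (ε : ℝ) (m : P2 d) :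
    traceLaplacian ε m
      (fun x => ∫ ξ, prodD (u * (a k ξ / (k * k.factorial))) (freq ξ) m x)
      (fun x y => ∫ ξ, prodH (u * (a k ξ / (k * k.factorial))) (freq ξ) m x y) =
    (u * term (lapCoeff a ε) k m).re := by
  have hd : ∀ ξ : Fin k → E d, HasUniformDerivs
      (fun m => (u * (a k ξ / (k * k.factorial)) * ftProd (freq ξ) Finset.univ m).re)
      (prodA (u * (a k ξ / (k * k.factorial))) (freq ξ))
      (prodD (u * (a k ξ / (k * k.factorial))) (freq ξ))
      (prodH (u * (a k ξ / (k * k.factorial))) (freq ξ)) (weight a k ξ) := fun ξ => by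
    rw [weight, ← prodBound_unit_mul hu]
    exact hasUniformDerivs_prod _ _
  rw [(traceLaplacian_integral hd (h.integrable k hk) m
    (h.stronglyMeasurable_comp hk u (continuous_prodD m))
    (h.stronglyMeasurable_comp hk u (continuous_prodH m)) ε).1, term_eq, ← integral_const_mul]
  refine Eq.trans ?_ (integral_re ((h.integrable_lapCoeff_mul ε hk m).const_mul u))
  refine integral_congr_ae (ae_of_all _ fun ξ => ?_)
  beta_reduce
  rw [traceLaplacian_prod, ← lamSq_eq, ← Complex.re_ofReal_mul, RCLike.re_eq_complex_re, lapCoeff]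
  congr 1
  push_cast
  ring

end IsSmoothCoeff

lemma integral_count_nat {G : Type*} [NormedAddCommGroup G] [NormedSpace ℝ G] [CompleteSpace G]
    {f : ℕ → G} (hf : Integrable f Measure.count) : ∫ n, f n ∂Measure.count = ∑' n, f n := by
  rw [integral_countable hf]
  simp

lemma integrable_count_of_summable {f : ℕ → ℝ} (hf : Summable f) : Integrable f Measure.count :=
  integrable_count_iff.2 hf.norm

lemma stronglyMeasurable_nat_prod {Z G : Type*} [TopologicalSpace Z] [MeasurableSpace Z]
    [OpensMeasurableSpace Z] [TopologicalSpace G] [TopologicalSpace.PseudoMetrizableSpace G]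
    [SecondCountableTopology G] [MeasurableSpace G] [BorelSpace G] {f : ℕ → Z → G}
    (hf : ∀ n, Continuous (f n)) : StronglyMeasurable fun p : ℕ × Z => f p.1 p.2 :=
  (measurable_from_prod_countable_right fun n => (hf n).measurable).stronglyMeasurable

/-- A series is an integral against counting measure on ℕ, so the superposition theorem applies once
more. -/
theorem exists_hasUniformDerivs_tsum {U : ℕ → P2 d → ℝ} {A : ℕ → P2 d → E d → E d}
    {D : ℕ → P2 d → E d → E d →L[ℝ] E d} {H : ℕ → P2 d → E d → E d → E d →L[ℝ] E d} {M : ℕ → ℝ}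
    (hn : ∀ n, HasUniformDerivs (U n) (A n) (D n) (H n) (M n)) (hM : Summable M)
    (hU : ∀ m, Summable fun n => U n m) :
    ∃ A' D' H' M', HasUniformDerivs (fun m => ∑' n, U n m) A' D' H' M' ∧
      ∀ ε m, traceLaplacian ε m (D' m) (H' m) = ∑' n, traceLaplacian ε m (D n m) (H n m) := by
  have hM' := integrable_count_of_summable hM
  have hD := fun m => stronglyMeasurable_nat_prod fun n => (hn n).continuous_D m
  have hH := fun m => stronglyMeasurable_nat_prod fun n => (hn n).continuous_H m
  have key := HasUniformDerivs.integral hn hM'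
    (fun m => integrable_count_of_summable (hU m))
    (fun m => stronglyMeasurable_nat_prod fun n => (hn n).continuous_A m) hD hH
  simp only [integral_count_nat (integrable_count_of_summable (hU _))] at key
  refine ⟨_, _, _, _, key, fun ε m => ?_⟩
  obtain ⟨e1, e2⟩ := traceLaplacian_integral hn hM' m (hD m) (hH m) ε
  rw [integral_count_nat e2] at e1
  exact e1

theorem IsSmoothCoeff.exists_hasUniformDerivs {a : Coeff d} (h : IsSmoothCoeff a) {u : ℂ}
    (hu : ‖u‖ = 1) : ∃ A D H M, HasUniformDerivs (fun m => (u * series a m).re) A D H M ∧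
      ∀ ε m, traceLaplacian ε m (D m) (H m) = (u * series (lapCoeff a ε) m).re := by
  have hk : ∀ n : ℕ, 1 ≤ n + 1 := fun n => by lia
  have hn := fun n : ℕ => h.hasUniformDerivs_term hu (hk n)
  have hs : ∀ m, Summable fun n : ℕ => (u * term a (n + 1) m).re := fun m =>
    Complex.reCLM.summable ((h.summable_term m).mul_left u)
  obtain ⟨A, D, H, M, h1, h2⟩ := exists_hasUniformDerivs_tsum hn h.summable hs
  have hU : (fun m => (u * series a m).re) = fun m => ∑' n : ℕ, (u * term a (n + 1) m).re :=
    funext fun m => by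
      rw [series, ← tsum_mul_left, Complex.re_tsum ((h.summable_term m).mul_left u)]
  refine ⟨A, D, H, M, by rw [hU]; exact h1, fun ε m => (h2 ε m).trans ?_⟩
  rw [series, ← tsum_mul_left, Complex.re_tsum ((h.summable_term_lapCoeff ε m).mul_left u)]
  exact tsum_congr fun n => h.traceLaplacian_term hu (hk n) ε m

lemma re_neg_I_mul (z : ℂ) : (-Complex.I * z).re = z.im := by simp

theorem IsSmoothCoeff.isC2 {a : Coeff d} (h : IsSmoothCoeff a) : IsC2 (series a) := by
  obtain ⟨A, D, H, M, h1, -⟩ := h.exists_hasUniformDerivs (u := 1) (by simp)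
  obtain ⟨A', D', H', M', h2, -⟩ := h.exists_hasUniformDerivs (u := -Complex.I) (by simp)
  simp only [one_mul] at h1
  simp only [re_neg_I_mul] at h2
  exact ⟨h1.isC2Real, h2.isC2Real⟩

theorem IsSmoothCoeff.hasWLaplacian {a : Coeff d} (h : IsSmoothCoeff a) (ε : ℝ) (m : P2 d) :
    HasWLaplacian ε (series a) m (series (lapCoeff a ε) m) := by
  obtain ⟨A, D, H, M, h1, e1⟩ := h.exists_hasUniformDerivs (u := 1) (by simp)
  obtain ⟨A', D', H', M', h2, e2⟩ := h.exists_hasUniformDerivs (u := -Complex.I) (by simp)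
  simp only [one_mul] at h1 e1
  simp only [re_neg_I_mul] at h2 e2
  exact ⟨e1 ε m ▸ h1.hasWLaplacianReal ε m, e2 ε m ▸ h2.hasWLaplacianReal ε m⟩

/-- The trace formula for a product with c = 1/k gives the real part, and with c = -i/k the
imaginary part. -/
theorem hasWLaplacian_F (ε : ℝ) {k : ℕ} (ξ : Fin k → E d) (m : P2 d) :
    HasWLaplacian ε (F k ξ) m (-(lamSq k ε ξ : ℂ) * F k ξ m) := by
  have h1 := (hasUniformDerivs_prod (1 / (k : ℂ)) (freq ξ)).hasWLaplacianReal ε m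
  have h2 := (hasUniformDerivs_prod (-Complex.I * (1 / (k : ℂ))) (freq ξ)).hasWLaplacianReal ε m
  rw [traceLaplacian_prod, ← lamSq_eq] at h1 h2
  simp only [mul_assoc, re_neg_I_mul] at h2
  simp only [← F_eq] at h1 h2
  rw [← Complex.ofReal_neg]
  refine ⟨?_, ?_⟩
  · rw [Complex.re_ofReal_mul]
    exact h1
  · rw [Complex.im_ofReal_mul]
    exact h2

end Series

/-! ### Moment bounds for the coefficients -/

section Moments

variable {d : ℕ}

lemma integrable_and_integral_le_of_lintegral_le {α : Type*} [MeasurableSpace α] {μ : Measure α}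
    {f : α → ℝ} (hf : AEStronglyMeasurable f μ) (h0 : ∀ x, 0 ≤ f x) {R : ℝ} (hR : 0 ≤ R)
    (h : ∫⁻ x, ENNReal.ofReal (f x) ∂μ ≤ ENNReal.ofReal R) :
    Integrable f μ ∧ ∫ x, f x ∂μ ≤ R := by
  refine ⟨⟨hf, ?_⟩, ?_⟩
  · rw [hasFiniteIntegral_iff_ofReal (ae_of_all _ h0)]
    exact h.trans_lt ENNReal.ofReal_lt_top
  · rw [integral_eq_lintegral_of_nonneg_ae (ae_of_all _ h0) hf]
    exact ENNReal.toReal_le_of_le_ofReal hR h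

lemma summable_div_rpow (K : ℝ) {δ : ℝ} (hδ : 0 < δ) :
    Summable fun n : ℕ => K / ((n + 1 : ℕ) : ℝ) ^ (1 + δ) := by
  have h := (summable_nat_add_iff 1).2
    (Real.summable_one_div_nat_rpow.2 (by linarith : 1 < 1 + δ))
  simpa [div_eq_mul_inv] using h.mul_left K

lemma weight_nonneg (a : Coeff d) (k : ℕ) (ξ : Fin k → E d) : 0 ≤ weight a k ξ :=
  (norm_nonneg _).trans (norm_le_prodBound _ _)

lemma weight_eq (a : Coeff d) (k : ℕ) (ξ : Fin k → E d) : weight a k ξ =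
    3 / (k * k.factorial) * (‖a k ξ‖ * (1 + ∑ j, ‖freq ξ j‖) ^ 3) := by
  rw [weight, prodBound, norm_div, norm_mul, Complex.norm_natCast, Complex.norm_natCast]
  ring

lemma measurable_weight {a : Coeff d} {k : ℕ} (h : Measurable (a k)) : Measurable (weight a k) := by
  have h1 : Continuous fun ξ : Fin k → E d => (1 + ∑ j, ‖freq ξ j‖) ^ 3 := by
    unfold freq
    fun_prop
  have : weight a k = fun ξ => 3 / (k * k.factorial) *
      (‖a k ξ‖ * (1 + ∑ j, ‖freq ξ j‖) ^ 3) := funext (weight_eq a k)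
  rw [this]
  exact (h.norm.mul h1.measurable).const_mul _

lemma isSmoothCoeff_of_lintegral_le {a : Coeff d} (hm : ∀ k, 1 ≤ k → Measurable (a k)) {K δ : ℝ}
    (hK : 0 ≤ K) (hδ : 0 < δ) (h : ∀ k : ℕ, 1 ≤ k →
      ∫⁻ ξ, ENNReal.ofReal (weight a k ξ) ≤ ENNReal.ofReal (K / (k : ℝ) ^ (1 + δ))) :
    IsSmoothCoeff a := by
  have key : ∀ k : ℕ, 1 ≤ k → Integrable (weight a k) ∧
      ∫ ξ, weight a k ξ ≤ K / (k : ℝ) ^ (1 + δ) := fun k hk =>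
    integrable_and_integral_le_of_lintegral_le (measurable_weight (hm k hk)).aestronglyMeasurable
      (weight_nonneg a k) (by positivity) (h k hk)
  exact ⟨hm, fun k hk => (key k hk).1, Summable.of_nonneg_of_le
    (fun n => integral_nonneg (weight_nonneg a (n + 1))) (fun n => (key (n + 1) (by lia)).2)
    (summable_div_rpow K hδ)⟩

lemma IsSmoothCoeff.mono {a b : Coeff d} (h : IsSmoothCoeff a)
    (hm : ∀ k, 1 ≤ k → Measurable (b k)) (hb : ∀ k ξ, ‖b k ξ‖ ≤ ‖a k ξ‖) : IsSmoothCoeff b := by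
  have hw : ∀ k ξ, weight b k ξ ≤ weight a k ξ := fun k ξ => by
    have := sum_norm_nonneg (freq ξ)
    rw [weight_eq, weight_eq]
    gcongr
    exact hb k ξ
  have hi : ∀ k, 1 ≤ k → Integrable (weight b k) := fun k hk =>
    (h.integrable k hk).mono' (measurable_weight (hm k hk)).aestronglyMeasurable
      (ae_of_all _ fun ξ => by
        rw [Real.norm_eq_abs, abs_of_nonneg (weight_nonneg b k ξ)]
        exact hw k ξ)
  exact ⟨hm, hi, Summable.of_nonneg_of_le (fun n => integral_nonneg (weight_nonneg b (n + 1)))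
    (fun n => integral_mono (hi _ (by lia)) (h.integrable _ (by lia)) (hw (n + 1))) h.summable⟩

lemma exists_pow_mul_exp_le (n : ℕ) {c : ℝ} (hc : 0 < c) :
    ∃ K : ℝ, 0 ≤ K ∧ ∀ x : ℝ, 0 ≤ x → (1 + x) ^ n * Real.exp (-(c * x)) ≤ K := by
  -- From yⁿ/n! ≤ e^y at y = c(1 + x); the shift by 1 costs the factor e^c.
  refine ⟨n.factorial / c ^ n * Real.exp c, by positivity, fun x hx => ?_⟩
  have h := Real.pow_div_factorial_le_exp (c * (1 + x)) (by positivity) n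
  rw [mul_pow, div_le_iff₀ (by positivity)] at h
  have e : Real.exp (c * (1 + x)) * Real.exp (-(c * x)) = Real.exp c := by
    rw [← Real.exp_add]
    ring_nf
  calc (1 + x) ^ n * Real.exp (-(c * x))
      = c ^ n * (1 + x) ^ n * Real.exp (-(c * x)) / c ^ n := by field_simp
    _ ≤ Real.exp (c * (1 + x)) * n.factorial * Real.exp (-(c * x)) / c ^ n := by gcongr
    _ = n.factorial / c ^ n * (Real.exp (c * (1 + x)) * Real.exp (-(c * x))) := by ring
    _ = _ := by rw [e]

lemma lintegral_comp_perm {k : ℕ} (σ : Equiv.Perm (Fin k)) (f : (Fin k → E d) → ℝ≥0∞) :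
    ∫⁻ ξ : Fin k → E d, f (fun j => ξ (σ j)) = ∫⁻ ξ, f ξ := by
  have h := volume_measurePreserving_piCongrLeft (fun _ : Fin k => E d) σ
  rw [← h.lintegral_comp_emb (MeasurableEquiv.measurableEmbedding _)]
  refine lintegral_congr fun ξ => congrArg f (funext fun j => ?_)
  exact MeasurableEquiv.piCongrLeft_apply_apply (e := σ) (β := fun _ : Fin k => E d) ξ j

lemma exists_perm_apply_eq {α : Type*} [DecidableEq α] {i j i' j' : α} (h : i ≠ j) (h' : i' ≠ j') :
    ∃ σ : Equiv.Perm α, σ i = i' ∧ σ j = j' := by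
  -- Send i to i', then correct the image of j by a second transposition; it fixes i' because i' ≠
  -- j' and j was not sent to i'.
  refine ⟨Equiv.swap (Equiv.swap i i' j) j' * Equiv.swap i i', ?_, ?_⟩
  · rw [Equiv.Perm.mul_apply, Equiv.swap_apply_left, Equiv.swap_apply_of_ne_of_ne _ h']
    intro e
    refine h ?_
    have := congrArg (Equiv.swap i i') e
    rwa [Equiv.swap_apply_right, Equiv.swap_apply_self] at this
  · rw [Equiv.Perm.mul_apply, Equiv.swap_apply_left]

/-- Invariance under permutations of the variables. -/
def IsSymmCoeff (a : Coeff d) : Prop := ∀ k, 1 ≤ k →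
  ∀ (σ : Equiv.Perm (Fin k)) (ξ : Fin k → E d), a k (fun j => ξ (σ j)) = a k ξ

lemma IsSymmCoeff.lintegral_eq {a : Coeff d} (h : IsSymmCoeff a) {k : ℕ} (hk : 1 ≤ k)
    (σ : Equiv.Perm (Fin k)) (g : (Fin k → E d) → ℝ≥0∞) :
    ∫⁻ ξ, ‖a k ξ‖ₑ * g (fun j => ξ (σ j)) = ∫⁻ ξ, ‖a k ξ‖ₑ * g ξ := by
  rw [← lintegral_comp_perm σ fun ξ => ‖a k ξ‖ₑ * g ξ]
  simp only [h k hk σ]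

variable {a : Coeff d} {C δ : ℝ}

lemma MomentBounds.lintegral_cube_le (h : MomentBounds a C δ) (hs : IsSymmCoeff a) {k : ℕ}
    (i : Fin k) : ∫⁻ ξ, ‖a k ξ‖ₑ * ‖ξ i‖ₑ ^ 3 ≤
      ENNReal.ofReal (C * k.factorial / (k : ℝ) ^ (1 + δ)) := by
  have hk : 0 < k := i.pos
  rw [← hs.lintegral_eq hk (Equiv.swap i ⟨0, hk⟩) fun ξ => ‖ξ i‖ₑ ^ 3]
  beta_reduce
  rw [Equiv.swap_apply_left]
  exact (h.1 k ⟨0, hk⟩ rfl).2.2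

/-- The bound is given for the first two variables; the symmetry of a_k and of Lebesgue measure
transports it to any two distinct ones. -/
lemma MomentBounds.lintegral_sq_mul_le (h : MomentBounds a C δ) (hs : IsSymmCoeff a) {k : ℕ}
    {i j : Fin k} (hij : i ≠ j) : ∫⁻ ξ, ‖a k ξ‖ₑ * (‖ξ i‖ₑ ^ 2 * ‖ξ j‖ₑ) ≤
      ENNReal.ofReal (C * k.factorial / (k : ℝ) ^ (3 + δ)) := by
  have hk : 2 ≤ k := by
    by_contra hk
    exact hij (Fin.ext (by lia))
  obtain ⟨σ, hi, hj⟩ := exists_perm_apply_eq hij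
    (show (⟨0, by lia⟩ : Fin k) ≠ ⟨1, by lia⟩ by simp)
  rw [← hs.lintegral_eq (by lia) σ fun ξ => ‖ξ i‖ₑ ^ 2 * ‖ξ j‖ₑ]
  beta_reduce
  rw [hi, hj]
  simp only [← mul_assoc]
  exact (h.2 k ⟨0, by lia⟩ ⟨1, by lia⟩ rfl rfl).2

lemma ennreal_mul_le_sq_add_sq (x y : ℝ≥0∞) : x * y ≤ x ^ 2 + y ^ 2 := by
  rcases le_total x y with h | h
  · exact (mul_le_mul_left h y).trans (by rw [← sq]; exact le_add_self)
  · exact (mul_le_mul_right h x).trans (by rw [← sq]; exact le_self_add)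

lemma MomentBounds.lintegral_mul_mul_le (h : MomentBounds a C δ) (hs : IsSymmCoeff a)
    (hm : ∀ k, 1 ≤ k → Measurable (a k)) {k : ℕ} (i j l : Fin k) :
    ∫⁻ ξ, ‖a k ξ‖ₑ * (‖ξ i‖ₑ * ‖ξ j‖ₑ * ‖ξ l‖ₑ) ≤
      2 * ENNReal.ofReal (C * k.factorial / (k : ℝ) ^ (3 + δ)) +
        if i = j then if j = l then ENNReal.ofReal (C * k.factorial / (k : ℝ) ^ (1 + δ)) else 0
          else 0 := by
  have hma : Measurable (a k) := hm k i.pos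
  have h2 : ∀ i j : Fin k, i ≠ j → ∫⁻ ξ, ‖a k ξ‖ₑ * (‖ξ i‖ₑ ^ 2 * ‖ξ j‖ₑ) ≤
      2 * ENNReal.ofReal (C * k.factorial / (k : ℝ) ^ (3 + δ)) := fun i j hij =>
    (h.lintegral_sq_mul_le hs hij).trans (by rw [two_mul]; exact le_self_add)
  by_cases hij : i = j
  · subst hij
    by_cases hil : i = l
    · subst hil
      rw [if_pos rfl, if_pos rfl]
      refine le_trans (le_of_eq ?_) ((h.lintegral_cube_le hs i).trans le_add_self)
      exact lintegral_congr fun ξ => by ring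
    · rw [if_pos rfl, if_neg hil, add_zero]
      refine le_trans (le_of_eq ?_) (h2 i l hil)
      exact lintegral_congr fun ξ => by ring
  · rw [if_neg hij, add_zero]
    by_cases hil : i = l
    · subst hil
      refine le_trans (le_of_eq ?_) (h2 i j hij)
      exact lintegral_congr fun ξ => by ring
    by_cases hjl : j = l
    · subst hjl
      refine le_trans (le_of_eq ?_) (h2 j i (Ne.symm hij))
      exact lintegral_congr fun ξ => by ring
    -- Three distinct indices reduce to two by |ξ_i||ξ_j| ≤ |ξ_i|² + |ξ_j|², which is where the
    -- factor 2 arises.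
    have e : ∀ ξ : Fin k → E d, ‖a k ξ‖ₑ * (‖ξ i‖ₑ * ‖ξ j‖ₑ * ‖ξ l‖ₑ) ≤
        ‖a k ξ‖ₑ * (‖ξ i‖ₑ ^ 2 * ‖ξ l‖ₑ) + ‖a k ξ‖ₑ * (‖ξ j‖ₑ ^ 2 * ‖ξ l‖ₑ) := fun ξ => by
      rw [← mul_add, ← add_mul]
      gcongr
      exact ennreal_mul_le_sq_add_sq _ _
    refine (lintegral_mono e).trans ?_
    rw [lintegral_add_left (by fun_prop), two_mul]
    exact add_le_add (h.lintegral_sq_mul_le hs hil) (h.lintegral_sq_mul_le hs hjl)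

/-- Expand the cube. The k³ triples cost at most 2C·k!/k^{3+δ} each, and the k diagonal ones an
extra C·k!/k^{1+δ}; together 3C·k!/k^δ. -/
lemma MomentBounds.lintegral_sum_cube_le (h : MomentBounds a C δ) (hs : IsSymmCoeff a)
    (hm : ∀ k, 1 ≤ k → Measurable (a k)) (hC : 0 ≤ C) {k : ℕ} (hk : 1 ≤ k) :
    ∫⁻ ξ, ‖a k ξ‖ₑ * (∑ j, ‖ξ j‖ₑ) ^ 3 ≤
      ENNReal.ofReal (3 * C * k.factorial / (k : ℝ) ^ δ) := by
  have hma : Measurable (a k) := hm k hk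
  have hk0 : (0 : ℝ) < k := by exact_mod_cast hk
  have e : ∀ ξ : Fin k → E d, ‖a k ξ‖ₑ * (∑ j, ‖ξ j‖ₑ) ^ 3 =
      ∑ i, ∑ j, ∑ l, ‖a k ξ‖ₑ * (‖ξ i‖ₑ * ‖ξ j‖ₑ * ‖ξ l‖ₑ) := fun ξ => by
    rw [pow_succ, sq, Finset.sum_mul_sum, Finset.sum_mul, Finset.mul_sum]
    refine Finset.sum_congr rfl fun i _ => ?_
    rw [Finset.sum_mul, Finset.mul_sum]
    refine Finset.sum_congr rfl fun j _ => ?_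
    rw [Finset.mul_sum, Finset.mul_sum]
  simp only [e]
  rw [lintegral_finsetSum _ fun i _ => by fun_prop]
  have h1 : ∀ i : Fin k, ∫⁻ ξ, ∑ j, ∑ l, ‖a k ξ‖ₑ * (‖ξ i‖ₑ * ‖ξ j‖ₑ * ‖ξ l‖ₑ) ≤
      ∑ j, ∑ l, (2 * ENNReal.ofReal (C * k.factorial / (k : ℝ) ^ (3 + δ)) +
        if i = j then if j = l then ENNReal.ofReal (C * k.factorial / (k : ℝ) ^ (1 + δ)) else 0
          else 0) := fun i => by
    rw [lintegral_finsetSum _ fun j _ => by fun_prop]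
    refine Finset.sum_le_sum fun j _ => ?_
    rw [lintegral_finsetSum _ fun l _ => by fun_prop]
    exact Finset.sum_le_sum fun l _ => h.lintegral_mul_mul_le hs hm i j l
  refine (Finset.sum_le_sum fun i _ => h1 i).trans (le_of_eq ?_)
  have h2 : ∀ i : Fin k, ∑ j, ∑ l : Fin k, (if i = j then
      if j = l then ENNReal.ofReal (C * k.factorial / (k : ℝ) ^ (1 + δ)) else 0 else 0) =
      ENNReal.ofReal (C * k.factorial / (k : ℝ) ^ (1 + δ)) := fun i => by
    rw [Finset.sum_eq_single i (fun j _ hj => by simp [Ne.symm hj]) (by simp)]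
    simp
  simp only [Finset.sum_add_distrib, h2]
  simp only [Finset.sum_const, Finset.card_univ, Fintype.card_fin, nsmul_eq_mul]
  rw [← ENNReal.ofReal_natCast, ← ENNReal.ofReal_ofNat 2, ← ENNReal.ofReal_mul (by positivity),
    ← ENNReal.ofReal_mul (by positivity), ← ENNReal.ofReal_mul (by positivity),
    ← ENNReal.ofReal_mul (by positivity), ← ENNReal.ofReal_mul (by positivity),
    ← ENNReal.ofReal_add (by positivity) (by positivity)]
  congr 1
  rw [Real.rpow_add hk0, Real.rpow_add hk0, Real.rpow_one,
    show (k : ℝ) ^ (3 : ℝ) = k ^ 3 by exact_mod_cast Real.rpow_natCast (k : ℝ) 3]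
  have : (0 : ℝ) < (k : ℝ) ^ δ := by positivity
  field_simp
  ring

lemma one_add_sum_freq_le {k : ℕ} (ξ : Fin k → E d) :
    (1 + ∑ j, ‖freq ξ j‖) ^ 3 ≤ 4 * (2 * Real.pi) ^ 3 * (1 + (∑ j, ‖ξ j‖) ^ 3) := by
  have h0 : 0 ≤ ∑ j, ‖ξ j‖ := sum_norm_nonneg ξ
  have hpi := Real.pi_gt_three
  have e : ∑ j, ‖freq ξ j‖ = 2 * Real.pi * ∑ j, ‖ξ j‖ := by
    simp only [freq, norm_smul, Real.norm_eq_abs, abs_of_pos Real.two_pi_pos, ← Finset.mul_sum]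
  set T := ∑ j, ‖ξ j‖
  have h1 : (1 + T) ^ 3 ≤ 4 * (1 + T ^ 3) := by
    -- The difference is 3(1 + T)(1 - T)².
    nlinarith [mul_nonneg (add_nonneg zero_le_one h0) (sq_nonneg (1 - T))]
  calc (1 + ∑ j, ‖freq ξ j‖) ^ 3 ≤ (2 * Real.pi * (1 + T)) ^ 3 := by
        rw [e]
        gcongr
        linarith
    _ = (2 * Real.pi) ^ 3 * (1 + T) ^ 3 := mul_pow _ _ _
    _ ≤ (2 * Real.pi) ^ 3 * (4 * (1 + T ^ 3)) := by gcongr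
    _ = _ := by ring

theorem MomentBounds.isSmoothCoeff (h : MomentBounds a C δ) (hL : L1Bound a C δ)
    (hs : IsSymmCoeff a) (hm : ∀ k, 1 ≤ k → Measurable (a k)) (hC : 0 ≤ C) (hδ : 0 < δ) :
    IsSmoothCoeff a := by
  set K : ℝ := 3 * (4 * (2 * Real.pi) ^ 3) with hK
  have hK0 : 0 ≤ K := by positivity
  -- 4C is C from the L¹ bound plus 3C from the cube; in `K`, the 3 comes from `prodBound` and the
  -- rest from `one_add_sum_freq_le`. Division by k·k! turns k!/k^δ into the summable 1/k^{1+δ}.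
  refine isSmoothCoeff_of_lintegral_le (K := K * (4 * C)) hm (by positivity) hδ fun k hk => ?_
  have hk0 : (0 : ℝ) < k := by exact_mod_cast hk
  have hma := hm k hk
  have e : ∀ ξ : Fin k → E d, ENNReal.ofReal (weight a k ξ) ≤
      ENNReal.ofReal (K / (k * k.factorial)) *
        (‖a k ξ‖ₑ + ‖a k ξ‖ₑ * (∑ j, ‖ξ j‖ₑ) ^ 3) := fun ξ => by
    have h0 : 0 ≤ ∑ j, ‖ξ j‖ := sum_norm_nonneg ξ
    simp only [← ofReal_norm]
    rw [← ENNReal.ofReal_sum_of_nonneg fun j _ => norm_nonneg _, ← ENNReal.ofReal_pow h0,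
      ← ENNReal.ofReal_mul (norm_nonneg _),
      ← ENNReal.ofReal_add (norm_nonneg _) (by positivity),
      ← ENNReal.ofReal_mul (by positivity)]
    refine ENNReal.ofReal_le_ofReal ?_
    rw [weight_eq]
    calc _ ≤ 3 / (k * k.factorial) *
          (‖a k ξ‖ * (4 * (2 * Real.pi) ^ 3 * (1 + (∑ j, ‖ξ j‖) ^ 3))) := by
          gcongr
          exact one_add_sum_freq_le ξ
      _ = _ := by rw [hK]; ring
  refine (lintegral_mono e).trans ?_
  rw [lintegral_const_mul _ (by fun_prop), lintegral_add_left (by fun_prop)]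
  refine (mul_le_mul_right (add_le_add (hL k hk)
    (h.lintegral_sum_cube_le hs hm hC hk)) _).trans (le_of_eq ?_)
  rw [← ENNReal.ofReal_add (by positivity) (by positivity), ← ENNReal.ofReal_mul (by positivity)]
  congr 1
  rw [Real.rpow_add hk0, Real.rpow_one]
  have : (0 : ℝ) < (k : ℝ) ^ δ := by positivity
  field_simp
  ring

end Moments

/-! ### The evolution of the coefficients -/

section Evolve

variable {d : ℕ} {a : Coeff d} {β ε t : ℝ}

lemma norm_evolve (a : Coeff d) (β ε t : ℝ) (k : ℕ) (ξ : Fin k → E d) :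
    ‖evolve a β ε t k ξ‖ = ‖a k ξ‖ * Real.exp (-(β * lamSq k (ε / β) ξ * t)) := by
  rw [evolve, norm_mul, Complex.norm_real, Real.norm_eq_abs, abs_of_pos (Real.exp_pos _)]

lemma norm_evolve_le (hβ : 0 ≤ β) (hε : 0 ≤ ε) (ht : 0 ≤ t) (k : ℕ) (ξ : Fin k → E d) :
    ‖evolve a β ε t k ξ‖ ≤ ‖a k ξ‖ := by
  have := lamSq_nonneg (div_nonneg hε hβ) ξ
  rw [norm_evolve]
  refine mul_le_of_le_one_right (norm_nonneg _) (Real.exp_le_one_iff.2 ?_)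
  rw [neg_nonpos]
  positivity

lemma measurable_evolve {k : ℕ} (h : Measurable (a k)) : Measurable (evolve a β ε t k) := by
  have := (continuous_lamSq (d := d) (k := k) (ε / β)).measurable
  unfold evolve
  fun_prop

lemma lamSq_comp_perm {k : ℕ} (ε : ℝ) (σ : Equiv.Perm (Fin k)) (ξ : Fin k → E d) :
    lamSq k ε (fun j => ξ (σ j)) = lamSq k ε ξ := by
  rw [lamSq, lamSq, Equiv.sum_comp σ ξ, Equiv.sum_comp σ fun j => ‖ξ j‖ ^ 2]

lemma IsSymmCoeff.evolve (h : IsSymmCoeff a) : IsSymmCoeff (evolve a β ε t) :=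
  fun k hk σ ξ => by
    rw [WassersteinHeat.evolve, WassersteinHeat.evolve, h k hk σ, lamSq_comp_perm]

lemma evolve_zero : evolve a β ε 0 = a := by
  funext k ξ
  simp [evolve]

lemma evolve_add (a : Coeff d) (β ε r t : ℝ) :
    evolve (evolve a β ε r) β ε t = evolve a β ε (r + t) := by
  funext k ξ
  rw [evolve, evolve, evolve, mul_assoc, ← Complex.ofReal_mul, ← Real.exp_add]
  congr 3
  ring

/-- With Q = Σ|η_j|², the damping is at most exp(-εtQ) and absorbs (1 + Q)³. Passing from Σ|η_j| to
Q costs a factor k per power, so k³/(k·k!) against k!/k^{3+δ} leaves 1/k^{1+δ}. -/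
theorem L1Bound.isSmoothCoeff_evolve {C δ : ℝ} (h : L1Bound a C (3 + δ))
    (hm : ∀ k, 1 ≤ k → Measurable (a k)) (hC : 0 ≤ C) (hδ : 0 < δ) (hβ : 0 < β) (hε : 0 < ε)
    (ht : 0 < t) : IsSmoothCoeff (evolve a β ε t) := by
  obtain ⟨B, hB0, hB⟩ := exists_pow_mul_exp_le 3 (mul_pos hε ht)
  refine isSmoothCoeff_of_lintegral_le (K := 24 * B * C) (fun k hk => measurable_evolve (hm k hk))
    (by positivity) hδ fun k hk => ?_
  have hk0 : (0 : ℝ) < k := by exact_mod_cast hk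
  have hk1 : (1 : ℝ) ≤ k := by exact_mod_cast hk
  have hma := hm k hk
  have e : ∀ ξ : Fin k → E d, ENNReal.ofReal (weight (evolve a β ε t) k ξ) ≤
      ENNReal.ofReal (24 * B * k ^ 2 / k.factorial) * ‖a k ξ‖ₑ := fun ξ => by
    rw [← ofReal_norm, ← ENNReal.ofReal_mul (by positivity)]
    refine ENNReal.ofReal_le_ofReal ?_
    rw [weight_eq, norm_evolve]
    set Q := ∑ j, ‖freq ξ j‖ ^ 2
    have hQ : 0 ≤ Q := Finset.sum_nonneg fun _ _ => sq_nonneg _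
    have hS : ∑ j, ‖freq ξ j‖ ≤ k + Q := by
      have h1 : ∀ j, ‖freq ξ j‖ ≤ 1 + ‖freq ξ j‖ ^ 2 := fun j => by
        nlinarith [sq_nonneg (‖freq ξ j‖ - 1)]
      refine (Finset.sum_le_sum fun j _ => h1 j).trans (le_of_eq ?_)
      simp [Finset.sum_add_distrib, Q]
    -- The cube of this bound has the constant 8; with the 3 of `prodBound` it makes 24.
    have hS2 : 1 + ∑ j, ‖freq ξ j‖ ≤ 2 * k * (1 + Q) := by nlinarith
    have h0 := sum_norm_nonneg (freq ξ)
    have hl : ε * t * Q ≤ β * lamSq k (ε / β) ξ * t := by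
      rw [lamSq_eq]
      have h2 : ε / β * Q ≤ ‖∑ j, freq ξ j‖ ^ 2 + ε / β * Q := le_add_of_nonneg_left (sq_nonneg _)
      calc ε * t * Q = β * (ε / β * Q) * t := by field_simp
        _ ≤ _ := by gcongr
    have hexp : Real.exp (-(β * lamSq k (ε / β) ξ * t)) ≤ Real.exp (-(ε * t * Q)) :=
      Real.exp_le_exp.2 (neg_le_neg hl)
    calc _ ≤ 3 / (k * k.factorial) * (‖a k ξ‖ * Real.exp (-(ε * t * Q)) *
          (2 * k * (1 + Q)) ^ 3) := by gcongr
      _ = 24 * k ^ 2 / k.factorial * ‖a k ξ‖ * ((1 + Q) ^ 3 * Real.exp (-(ε * t * Q))) := by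
          field_simp
          ring
      _ ≤ 24 * k ^ 2 / k.factorial * ‖a k ξ‖ * B := by
          gcongr
          exact hB Q hQ
      _ = _ := by ring
  refine (lintegral_mono e).trans ?_
  rw [lintegral_const_mul _ (by fun_prop)]
  refine (mul_le_mul_right (h k hk) _).trans (le_of_eq ?_)
  rw [← ENNReal.ofReal_mul (by positivity)]
  congr 1
  rw [Real.rpow_add hk0, Real.rpow_add hk0, Real.rpow_one,
    show (k : ℝ) ^ (3 : ℝ) = k ^ 3 by exact_mod_cast Real.rpow_natCast (k : ℝ) 3]
  have : (0 : ℝ) < (k : ℝ) ^ δ := by positivity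
  field_simp

/-! ### Convergence of the series -/

section Convergence

variable {C δ : ℝ}

lemma L1Bound.integrable {p : ℝ} (h : L1Bound a C p) {k : ℕ} (hk : 1 ≤ k) (hm : Measurable (a k)) :
    Integrable (a k) :=
  ⟨hm.aestronglyMeasurable, (h k hk).trans_lt ENNReal.ofReal_lt_top⟩

lemma L1Bound.evolve {p : ℝ} (h : L1Bound a C p) (hβ : 0 ≤ β) (hε : 0 ≤ ε) (ht : 0 ≤ t) :
    L1Bound (evolve a β ε t) C p := fun k hk =>
  (lintegral_mono fun ξ => by
    rw [← ofReal_norm, ← ofReal_norm]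
    exact ENNReal.ofReal_le_ofReal (norm_evolve_le hβ hε ht k ξ)).trans (h k hk)

lemma L1Bound.integrable_mul_F {p : ℝ} (h : L1Bound a C p) {k : ℕ} (hk : 1 ≤ k)
    (hm : Measurable (a k)) (m : P2 d) : Integrable (fun ξ => a k ξ * F k ξ m) :=
  (h.integrable hk hm).mul_bdd (c := 1 / k) (continuous_F m).aestronglyMeasurable
    (ae_of_all _ fun ξ => norm_F_le ξ m)

/-- The factor 1/k in F^k_ξ raises the exponent from δ to 1 + δ and so makes the series summable. -/
lemma L1Bound.integral_norm_div_le (h : L1Bound a C δ) (hC : 0 ≤ C) {k : ℕ} (hk : 1 ≤ k)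
    (hm : Measurable (a k)) :
    ∫ ξ, ‖a k ξ / (k * k.factorial)‖ ≤ C / (k : ℝ) ^ (1 + δ) := by
  have hk0 : (0 : ℝ) < k := by exact_mod_cast hk
  have h1 := (integrable_and_integral_le_of_lintegral_le (h.integrable hk hm).norm.1
    (fun _ => norm_nonneg _) (R := C * k.factorial / (k : ℝ) ^ δ) (by positivity)
    (by simpa only [ofReal_norm] using h k hk)).2
  simp only [norm_div, norm_mul, Complex.norm_natCast]
  rw [integral_div, div_le_iff₀ (by positivity), Real.rpow_add hk0, Real.rpow_one]
  refine h1.trans (le_of_eq ?_)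
  have : (0 : ℝ) < (k : ℝ) ^ δ := by positivity
  field_simp

lemma L1Bound.norm_term_le (h : L1Bound a C δ) (hC : 0 ≤ C) {k : ℕ} (hk : 1 ≤ k)
    (hm : Measurable (a k)) (m : P2 d) : ‖term a k m‖ ≤ C / (k : ℝ) ^ (1 + δ) := by
  refine le_trans ?_ (h.integral_norm_div_le hC hk hm)
  rw [term_eq]
  refine norm_integral_le_of_norm_le ((h.integrable hk hm).div_const _).norm
    (ae_of_all _ fun ξ => ?_)
  rw [norm_mul]
  exact mul_le_of_le_one_right (norm_nonneg _) (norm_ftProd_le _ _ _)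

lemma partialSum_eq (a : Coeff d) (N : ℕ) (m : P2 d) :
    partialSum a N m = ∑ n ∈ Finset.range N, term a (n + 1) m := by
  induction N with
  | zero => simp [partialSum]
  | succ N ih =>
    rw [Finset.sum_range_succ, ← ih, partialSum, partialSum, Finset.sum_Icc_succ_top (by lia)]

theorem L1Bound.tendstoUniformly (h : L1Bound a C δ) (hC : 0 ≤ C) (hδ : 0 < δ)
    (hm : ∀ k, 1 ≤ k → Measurable (a k)) :
    TendstoUniformly (partialSum a) (series a) atTop := by
  have := tendstoUniformly_tsum_nat (f := fun n m => term a (n + 1) m) (summable_div_rpow C hδ)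
    fun n m => h.norm_term_le hC (k := n + 1) (by lia) (hm _ (by lia)) m
  have e : partialSum a = fun N m => ∑ n ∈ Finset.range N, term a (n + 1) m :=
    funext fun N => funext fun m => partialSum_eq a N m
  rw [e]
  exact this

/-- λ_k² is dominated by the damping exponent even for ε = 0, so an exponential in λ_k² is available
to absorb the power l. -/
lemma MemA.evolve {s : ℝ} (h : MemA s a) (hs : 0 ≤ s) (hβ : 0 < β) (hε : 0 ≤ ε) (ht : 0 < t)
    (l : ℝ) : MemA l (evolve a β ε t) := by
  refine ⟨fun k hk => ⟨measurable_evolve (h.1 k hk).1,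
    (IsSymmCoeff.evolve fun k hk => (h.1 k hk).2) k hk⟩, ?_⟩
  -- The rate is 2βt because the coefficient enters squared; the exponent l is rounded up to a
  -- natural number.
  obtain ⟨K, hK0, hK⟩ := exists_pow_mul_exp_le ⌈l⌉₊ (show 0 < 2 * β * t by positivity)
  refine lt_of_le_of_lt (b := ENNReal.ofReal K * ∑' n : ℕ,
    ENNReal.ofReal (1 / ((n + 1).factorial : ℝ)) *
    ∫⁻ ξ, ‖a (n + 1) ξ‖ₑ ^ 2 * ENNReal.ofReal ((1 + lamSq (n + 1) 0 ξ) ^ s)) ?_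
    (ENNReal.mul_lt_top ENNReal.ofReal_lt_top h.2)
  rw [← ENNReal.tsum_mul_left]
  refine ENNReal.tsum_le_tsum fun n => ?_
  rw [mul_left_comm]
  gcongr
  rw [← lintegral_const_mul' _ _ ENNReal.ofReal_ne_top]
  refine lintegral_mono fun ξ => ?_
  set x := lamSq (n + 1) 0 ξ with hx
  have hx0 : 0 ≤ x := lamSq_nonneg le_rfl ξ
  have hxl : x ≤ lamSq (n + 1) (ε / β) ξ := by
    rw [hx, lamSq, lamSq, zero_mul, add_zero]
    gcongr
    exact le_add_of_nonneg_right (by positivity)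
  simp only [← ofReal_norm]
  rw [← ENNReal.ofReal_pow (norm_nonneg _), ← ENNReal.ofReal_pow (norm_nonneg _),
    ← ENNReal.ofReal_mul (by positivity), ← ENNReal.ofReal_mul (by positivity),
    ← ENNReal.ofReal_mul hK0]
  refine ENNReal.ofReal_le_ofReal ?_
  have h1 : (1 + x) ^ l ≤ (1 + x) ^ ⌈l⌉₊ := by
    rw [← Real.rpow_natCast]
    exact Real.rpow_le_rpow_of_exponent_le (by linarith) (Nat.le_ceil l)
  have h2 : 1 ≤ (1 + x) ^ s := Real.one_le_rpow (by linarith) hs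
  have h3 : Real.exp (-(β * lamSq (n + 1) (ε / β) ξ * t)) ^ 2 ≤ Real.exp (-(2 * β * t * x)) := by
    rw [← Real.exp_nat_mul]
    refine Real.exp_le_exp.2 ?_
    have : β * x * t ≤ β * lamSq (n + 1) (ε / β) ξ * t := by gcongr
    push_cast
    linarith
  rw [norm_evolve, mul_pow]
  calc _ ≤ ‖a (n + 1) ξ‖ ^ 2 * Real.exp (-(2 * β * t * x)) * (1 + x) ^ ⌈l⌉₊ := by gcongr
    _ = ‖a (n + 1) ξ‖ ^ 2 * ((1 + x) ^ ⌈l⌉₊ * Real.exp (-(2 * β * t * x))) := by ring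
    _ ≤ ‖a (n + 1) ξ‖ ^ 2 * K := by
        gcongr
        exact hK x hx0
    _ ≤ ‖a (n + 1) ξ‖ ^ 2 * K * (1 + x) ^ s := le_mul_of_one_le_right (by positivity) h2
    _ = _ := by ring

theorem MemA.memH_series_evolve {s : ℝ} (h : MemA s a) (hL : L1Bound a C δ) (hC : 0 ≤ C)
    (hδ : 0 < δ) (hs : 0 ≤ s) (hβ : 0 < β) (hε : 0 ≤ ε) (ht : 0 < t) (l : ℝ) :
    MemH l (series (WassersteinHeat.evolve a β ε t)) := by
  have hm : ∀ k, 1 ≤ k → Measurable (WassersteinHeat.evolve a β ε t k) := fun k hk =>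
    measurable_evolve (h.1 k hk).1
  have hL' := hL.evolve hβ.le hε ht.le
  exact ⟨_, h.evolve hs hβ hε ht l, fun k hk m => hL'.integrable_mul_F hk (hm k hk) m,
    fun m => (hL'.tendstoUniformly hC hδ hm).tendsto_at m⟩

/-! ### The initial condition and the time derivative -/

/-- Dominated convergence in ξ and then in k, with the undamped coefficients as bounds. Only the L¹
bound enters, so smoothness of the initial datum plays no part. -/
theorem L1Bound.tendsto_series_evolve (h : L1Bound a C δ) (hC : 0 ≤ C) (hδ : 0 < δ)
    (hm : ∀ k, 1 ≤ k → Measurable (a k)) (hβ : 0 ≤ β) (hε : 0 ≤ ε) (m : P2 d) :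
    Tendsto (fun t => series (WassersteinHeat.evolve a β ε t) m) (𝓝[>] 0) (𝓝 (series a m)) := by
  have hpos : ∀ᶠ t : ℝ in 𝓝[>] 0, 0 < t := eventually_mem_nhdsWithin
  refine tendsto_tsum_of_dominated_convergence (summable_div_rpow C hδ) (fun n => ?_) ?_
  · simp only [term_eq]
    have hi := (h.integrable (k := n + 1) (by lia) (hm _ (by lia)))
    refine tendsto_integral_filter_of_dominated_convergence
      (fun ξ => ‖a (n + 1) ξ / ((n + 1 : ℕ) * (n + 1).factorial)‖) ?_ ?_
      (hi.div_const _).norm (ae_of_all _ fun ξ => ?_)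
    · refine Eventually.of_forall fun t => AEStronglyMeasurable.mul ?_
        ((continuous_ftProd _ m).comp continuous_freq).aestronglyMeasurable
      exact ((measurable_evolve (hm (n + 1) (by lia))).div_const _).aestronglyMeasurable
    · filter_upwards [hpos] with t ht
      refine ae_of_all _ fun ξ => ?_
      rw [norm_mul, norm_div, norm_div]
      refine (mul_le_of_le_one_right (by positivity) (norm_ftProd_le _ _ _)).trans ?_
      gcongr
      exact norm_evolve_le hβ hε ht.le _ ξ
    · have hc : Continuous fun t => WassersteinHeat.evolve a β ε t (n + 1) ξ /
          ((n + 1 : ℕ) * (n + 1).factorial) * ftProd (freq ξ) Finset.univ m := by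
        unfold WassersteinHeat.evolve
        fun_prop
      have := (hc.tendsto 0).mono_left (nhdsWithin_le_nhds (s := Ioi 0))
      rwa [evolve_zero] at this
  · filter_upwards [hpos] with t ht n
    exact (h.evolve hβ hε ht.le).norm_term_le hC (k := n + 1) (by lia)
      (measurable_evolve (hm _ (by lia))) m

end Convergence

lemma IsSmoothCoeff.hasDerivAt_term (h : IsSmoothCoeff a) (hβ : 0 < β) (hε : 0 ≤ ε) {k : ℕ}
    (hk : 1 ≤ k) (m : P2 d) (ht : 0 < t) :
    HasDerivAt (fun τ => term (evolve a β ε τ) k m)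
      (β * term (lapCoeff (evolve a β ε t) (ε / β)) k m) t := by
  simp only [term_eq]
  rw [← integral_const_mul]
  have hm := h.measurable k hk
  have hft : AEStronglyMeasurable (fun ξ : Fin k → E d => ftProd (freq ξ) Finset.univ m) :=
    ((continuous_ftProd _ m).comp continuous_freq).aestronglyMeasurable
  have hmeas : ∀ τ, AEStronglyMeasurable (fun ξ => evolve a β ε τ k ξ / (k * k.factorial) *
      ftProd (freq ξ) Finset.univ m) := fun τ =>
    ((measurable_evolve hm).div_const _).aestronglyMeasurable.mul hft
  have hlm : Measurable (lapCoeff (evolve a β ε t) (ε / β) k) := by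
    have h1 := (continuous_lamSq (d := d) (k := k) (ε / β)).measurable
    have h2 := measurable_evolve (β := β) (ε := ε) (t := t) hm
    unfold lapCoeff
    fun_prop
  refine (hasDerivAt_integral_of_dominated_loc_of_deriv_le (𝕜 := ℝ) (μ := volume)
    (F := fun τ ξ => evolve a β ε τ k ξ / (k * k.factorial) * ftProd (freq ξ) Finset.univ m)
    (F' := fun τ ξ => β * (lapCoeff (evolve a β ε τ) (ε / β) k ξ / (k * k.factorial) *
      ftProd (freq ξ) Finset.univ m)) (bound := fun ξ => β * ((1 + |ε / β|) * weight a k ξ))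
    (Ioi_mem_nhds ht) (Eventually.of_forall hmeas) ?_
    ((hlm.div_const _).aestronglyMeasurable.mul hft |>.const_mul _) ?_
    (((h.integrable k hk).const_mul _).const_mul _) ?_).2
  · refine (h.integrable_coeff_mul hk m).mono (hmeas t) (ae_of_all _ fun ξ => ?_)
    rw [norm_mul, norm_mul, norm_div, norm_div]
    gcongr
    exact norm_evolve_le hβ.le hε ht.le k ξ
  · refine ae_of_all _ fun ξ τ hτ => ?_
    rw [norm_mul, Complex.norm_real, Real.norm_eq_abs, abs_of_pos hβ]
    refine mul_le_mul_of_nonneg_left ?_ hβ.le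
    rw [norm_mul]
    refine (mul_le_of_le_one_right (norm_nonneg _) (norm_ftProd_le _ _ _)).trans ?_
    refine le_trans ?_ (norm_lapCoeff_div_le a (ε / β) k ξ)
    simp only [norm_div, lapCoeff, norm_mul]
    gcongr
    exact norm_evolve_le hβ.le hε (le_of_lt hτ) k ξ
  · refine ae_of_all _ fun ξ τ _ => ?_
    have h1 : HasDerivAt (fun τ : ℝ => -(β * lamSq k (ε / β) ξ * τ))
        (-(β * lamSq k (ε / β) ξ)) τ :=
      (((hasDerivAt_id τ).const_mul (β * lamSq k (ε / β) ξ)).neg).congr_deriv (by simp)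
    have h2 := ((((h1.exp).ofReal_comp).const_mul (a k ξ)).div_const
      ((k : ℂ) * k.factorial)).mul_const (ftProd (freq ξ) Finset.univ m)
    refine h2.congr_deriv ?_
    rw [lapCoeff, evolve]
    push_cast
    ring

/-- The time derivative produces -βλ², which is β times the Laplacian coefficient. Damping only
decreases the weights, so the derivatives of the terms have a summable bound uniform in τ > 0. -/
theorem IsSmoothCoeff.hasDerivAt_series (h : IsSmoothCoeff a) (hβ : 0 < β) (hε : 0 ≤ ε)
    (m : P2 d) (ht : 0 < t) : HasDerivAt (fun τ => series (evolve a β ε τ) m)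
      (β * series (lapCoeff (evolve a β ε t) (ε / β)) m) t := by
  have hsm : ∀ τ, 0 ≤ τ → IsSmoothCoeff (evolve a β ε τ) := fun τ hτ =>
    h.mono (fun k hk => measurable_evolve (h.measurable k hk)) (norm_evolve_le hβ.le hε hτ)
  have := hasDerivAt_tsum_of_isPreconnected (𝕜 := ℝ) (t := Ioi 0) (y₀ := t) (y := t)
    (g := fun (n : ℕ) τ => term (evolve a β ε τ) (n + 1) m)
    (g' := fun n τ => β * term (lapCoeff (evolve a β ε τ) (ε / β)) (n + 1) m)
    (u := fun n => β * ((1 + |ε / β|) * ∫ ξ, weight a (n + 1) ξ))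
    ((h.summable.mul_left _).mul_left _) isOpen_Ioi isPreconnected_Ioi
    (fun n τ hτ => h.hasDerivAt_term hβ hε (by lia) m hτ) (fun n τ hτ => ?_) ht
    ((hsm t ht.le).summable_term m) ht
  · rw [tsum_mul_left] at this
    exact this
  · have hw : ∫ ξ, weight (evolve a β ε τ) (n + 1) ξ ≤ ∫ ξ, weight a (n + 1) ξ := by
      refine integral_mono ((hsm τ (le_of_lt hτ)).integrable _ (by lia))
        (h.integrable _ (by lia)) fun ξ => ?_
      have := sum_norm_nonneg (freq ξ)
      rw [weight_eq, weight_eq]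
      gcongr
      exact norm_evolve_le hβ.le hε (le_of_lt hτ) _ ξ
    rw [norm_mul, Complex.norm_real, Real.norm_eq_abs, abs_of_pos hβ]
    gcongr
    refine ((hsm τ (le_of_lt hτ)).norm_term_lapCoeff_le (ε / β) (by lia) m).trans ?_
    gcongr

end Evolve

/-! ### Fourier transforms along the stochastic flow -/

section Flow

variable {d : ℕ}

lemma integral_wave_eq_charFun (μ : Measure (E d)) (η : E d) :
    ∫ x, wave η x ∂μ = charFun μ (-η) := by
  rw [charFun_apply]
  refine integral_congr_ae (ae_of_all _ fun x => ?_)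
  simp only [wave]
  rw [inner_neg_right, real_inner_comm]
  congr 1
  push_cast
  ring

lemma ft_conv (μ ν : P2 d) (η : E d) : ft (μ.conv ν) η = ft μ η * ft ν η := by
  rw [ft, ft, ft, integral_wave_eq_charFun, integral_wave_eq_charFun, integral_wave_eq_charFun]
  exact charFun_conv _

lemma ft_translate (m : P2 d) (w η : E d) : ft (m.translate w) η = ft m η * wave η w := by
  have h : ∫ x, wave η x ∂(m.1.map fun x => x + w) = ∫ x, wave η (x + w) ∂m.1 :=
    integral_map (by fun_prop) (by fun_prop)
  simp only [wave_add, integral_mul_const] at h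
  exact h

lemma integral_wave_gaussian {b : ℝ} (hb : 0 < b) (η : E d) :
    ∫ z : E d, Real.exp (-b * ‖z‖ ^ 2) * wave η z =
      ((Real.pi / b) ^ ((d : ℝ) / 2) : ℝ) * (Real.exp (-(‖η‖ ^ 2 / (4 * b))) : ℂ) := by
  have h := GaussianFourier.integral_cexp_neg_mul_sq_norm_add (V := E d) (b := (b : ℂ))
    (by simpa using hb) (-Complex.I) η
  rw [finrank_euclideanSpace_fin] at h
  refine Eq.trans (integral_congr_ae (ae_of_all _ fun z => ?_)) (h.trans ?_)
  · simp only [wave]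
    rw [Complex.ofReal_exp, ← Complex.exp_add]
    congr 1
    push_cast
    ring
  · rw [Complex.ofReal_cpow (by positivity), Complex.ofReal_exp, neg_sq, Complex.I_sq]
    push_cast
    congr 2
    ring

/-- At ε = 0 the Dirac mass has transform 1, in accordance with the formula; otherwise the Gaussian
integral cancels the normalization of the kernel. -/
lemma ft_heatLaw {ε t : ℝ} (hε : 0 ≤ ε) (ht : 0 < t) (η : E d) :
    ft (heatLaw d ε t) η = (Real.exp (-(ε * t * ‖η‖ ^ 2)) : ℂ) := by
  rcases hε.eq_or_lt with rfl | hε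
  · have : (heatLaw d 0 t).1 = Measure.dirac 0 :=
      congrArg Subtype.val (show heatLaw d 0 t = _ from dif_neg (by simp))
    rw [ft, this, integral_dirac]
    simp [wave]
  · have e : (heatLaw d ε t).1 =
        volume.withDensity fun z => ENNReal.ofReal (heatKernel d ε t z) :=
      congrArg Subtype.val (show heatLaw d ε t = _ from dif_pos ⟨hε, ht⟩)
    have hm : Measurable fun z : E d => ENNReal.ofReal (heatKernel d ε t z) := by
      unfold heatKernel; fun_prop
    have hb : 0 < 1 / (4 * ε * t) := by positivity
    have hp : 0 < 4 * Real.pi * ε * t := by positivity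
    rw [ft, e, integral_withDensity_eq_integral_toReal_smul hm
      (ae_of_all _ fun _ => ENNReal.ofReal_lt_top)]
    have h1 : ∀ z : E d, (ENNReal.ofReal (heatKernel d ε t z)).toReal • wave η z =
        ((1 / Real.sqrt (4 * Real.pi * ε * t) ^ d : ℝ) : ℂ) *
          (Real.exp (-(1 / (4 * ε * t)) * ‖z‖ ^ 2) * wave η z) := fun z => by
      rw [ENNReal.toReal_ofReal (by unfold heatKernel; positivity), heatKernel_eq,
        Complex.real_smul, Complex.ofReal_mul, mul_assoc]
    simp only [h1]
    rw [integral_const_mul, integral_wave_gaussian hb, ← mul_assoc, ← Complex.ofReal_mul,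
      ← Complex.ofReal_mul]
    congr 1
    have hx : Real.pi / (1 / (4 * ε * t)) = 4 * Real.pi * ε * t := by field_simp
    rw [hx, Real.sqrt_eq_rpow, ← Real.rpow_natCast, ← Real.rpow_mul hp.le,
      show (1 / 2 * (d : ℝ)) = (d : ℝ) / 2 by ring,
      one_div_mul_cancel (Real.rpow_pos_of_pos hp _).ne', one_mul]
    congr 2
    field_simp

lemma ft_sigma {β ε t : ℝ} (hε : 0 ≤ ε) (ht : 0 < t) (m : P2 d) (w η : E d) :
    ft (sigma β ε t m w) η = (Real.exp (-(ε * t * ‖η‖ ^ 2)) : ℂ) * ft m η *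
      wave (√(2 * β) • η) w := by
  rw [sigma, ft_translate, ft_conv, ft_heatLaw hε ht]
  congr 1
  simp only [wave, real_inner_smul_left, inner_smul_right]

lemma prod_wave {ι : Type*} (s : Finset ι) (η : ι → E d) (x : E d) :
    ∏ i ∈ s, wave (η i) x = wave (∑ i ∈ s, η i) x := by
  simp only [wave]
  rw [← Complex.exp_sum, sum_inner]
  push_cast
  rw [Finset.mul_sum, Finset.sum_neg_distrib]

/-- The smoothing acts on each factor separately and yields Σ|η_j|². The translation is the same for
all factors, so the noise sees only Ση_j; these are the two parts of λ². -/
lemma ftProd_sigma {β ε t : ℝ} (hε : 0 ≤ ε) (ht : 0 < t) (m : P2 d) (w : E d) {k : ℕ}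
    (η : Fin k → E d) : ftProd η Finset.univ (sigma β ε t m w) =
      (Real.exp (-(ε * t * ∑ j, ‖η j‖ ^ 2)) : ℂ) * ftProd η Finset.univ m *
        wave (√(2 * β) • ∑ j, η j) w := by
  rw [ftProd, Finset.prod_congr rfl fun j _ => ft_sigma hε ht m w (η j), Finset.prod_mul_distrib,
    Finset.prod_mul_distrib, prod_wave, ← Finset.smul_sum, ← Complex.ofReal_prod, ← Real.exp_sum,
    Finset.sum_neg_distrib, ← Finset.mul_sum, ← ftProd]

variable {Ω : Type*} [MeasurableSpace Ω] {P : Measure Ω} {W : ℝ≥0 → Ω → E d}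

lemma IsStandardBrownian.aemeasurable (hW : IsStandardBrownian W P) (t : ℝ≥0) :
    AEMeasurable (W t) P := by
  have h : AEMeasurable (fun ω i => W t ω i) P :=
    aemeasurable_pi_lambda _ fun i => (hW.1 i).toIsPreBrownianReal.aemeasurable t
  exact (MeasurableEquiv.toLp 2 (Fin d → ℝ)).measurable.comp_aemeasurable h

variable [IsProbabilityMeasure P]

/-- Independence of the coordinates factorizes the characteristic function into one-dimensional
Gaussian ones of variance t. -/
lemma IsStandardBrownian.integral_wave (hW : IsStandardBrownian W P) (t : ℝ≥0) (η : E d) :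
    ∫ w, wave η w ∂(P.map (W t)) = (Real.exp (-(t / 2 * ‖η‖ ^ 2)) : ℂ) := by
  have hi : iIndepFun (fun i ω => W t ω i) P :=
    hW.2.comp (fun _ f => f t) fun _ => measurable_pi_apply t
  have hae : ∀ i, AEMeasurable (fun ω => W t ω i) P := fun i =>
    (hW.1 i).toIsPreBrownianReal.aemeasurable t
  have h := (iIndepFun_iff_charFun_pi hae).1 hi (-η)
  have h2 : ∀ i, charFun (P.map fun ω => W t ω i) ((-η) i) =
      ((Real.exp (-(t / 2 * (η i) ^ 2)) : ℝ) : ℂ) := fun i => by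
    rw [((hW.1 i).toIsPreBrownianReal.hasLaw_eval t).map_eq, charFun_gaussianReal,
      Complex.ofReal_exp]
    congr 1
    simp only [PiLp.neg_apply]
    push_cast
    ring
  rw [integral_wave_eq_charFun]
  refine Eq.trans h ?_
  rw [Finset.prod_congr rfl fun i _ => h2 i, ← Complex.ofReal_prod, ← Real.exp_sum,
    Finset.sum_neg_distrib, ← Finset.mul_sum, EuclideanSpace.real_norm_sq_eq]

variable {a : Coeff d} {C δ β ε : ℝ}

/-- Continuity in w supplies the measurability needed to pass from the law of W_t to an expectation.
-/
lemma continuous_term_sigma {k : ℕ} (hm : Measurable (a k)) (hi : Integrable (a k))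
    (hε : 0 ≤ ε) {t : ℝ} (ht : 0 < t) (m : P2 d) :
    Continuous fun w => term a k (sigma β ε t m w) := by
  simp only [term_eq]
  refine continuous_of_dominated (bound := fun ξ => ‖a k ξ / (k * k.factorial)‖) (fun w => ?_)
    (fun w => ae_of_all _ fun ξ => ?_) (hi.div_const _).norm (ae_of_all _ fun ξ => ?_)
  · exact (hm.div_const _).aestronglyMeasurable.mul
      ((continuous_ftProd _ _).comp continuous_freq).aestronglyMeasurable
  · rw [norm_mul]
    exact mul_le_of_le_one_right (norm_nonneg _) (norm_ftProd_le _ _ _)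
  · simp only [ftProd_sigma hε ht]
    fun_prop

/-- The variance t and the scaling √(2β) give (t/2)·2β|Ση_j|² = βt|Ση_j|²; adding εtΣ|η_j|² makes
βλ²t, since β·(ε/β) = ε. -/
lemma IsStandardBrownian.integral_ftProd_sigma (hW : IsStandardBrownian W P) (hβ : 0 < β)
    (hε : 0 ≤ ε) {t : ℝ≥0} (ht : 0 < t) (m : P2 d) {k : ℕ} (ξ : Fin k → E d) :
    ∫ w, ftProd (freq ξ) Finset.univ (sigma β ε t m w) ∂(P.map (W t)) =
      (Real.exp (-(β * lamSq k (ε / β) ξ * t)) : ℂ) * ftProd (freq ξ) Finset.univ m := by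
  simp only [ftProd_sigma hε (NNReal.coe_pos.2 ht)]
  rw [integral_const_mul, hW.integral_wave, mul_right_comm, ← Complex.ofReal_mul, ← Real.exp_add,
    norm_smul, mul_pow, Real.norm_eq_abs, sq_abs, Real.sq_sqrt (by positivity), lamSq_eq]
  congr 3
  field_simp
  ring

lemma IsStandardBrownian.integral_term_sigma (hW : IsStandardBrownian W P) (hβ : 0 < β)
    (hε : 0 ≤ ε) {t : ℝ≥0} (ht : 0 < t) (m : P2 d) {k : ℕ} (hm : Measurable (a k))
    (hi : Integrable (a k)) :
    ∫ w, term a k (sigma β ε t m w) ∂(P.map (W t)) = term (evolve a β ε t) k m := by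
  have : IsProbabilityMeasure (P.map (W t)) :=
    Measure.isProbabilityMeasure_map (hW.aemeasurable t)
  have ht' : (0 : ℝ) < t := NNReal.coe_pos.2 ht
  simp only [term_eq]
  have hmeas : AEStronglyMeasurable (fun p : E d × (Fin k → E d) =>
      a k p.2 / (k * k.factorial) * ftProd (freq p.2) Finset.univ (sigma β ε t m p.1))
      ((P.map (W t)).prod volume) := by
    refine AEStronglyMeasurable.mul
      ((hm.comp measurable_snd).div_const _).aestronglyMeasurable ?_
    simp only [ftProd_sigma hε ht']
    have h1 := (continuous_ftProd Finset.univ m).comp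
      ((continuous_freq (d := d) (k := k)).comp (continuous_snd (X := E d)))
    have h2 : Continuous fun p : E d × (Fin k → E d) => freq p.2 :=
      continuous_freq.comp continuous_snd
    refine Continuous.aestronglyMeasurable (Continuous.mul (Continuous.mul ?_ h1) ?_)
    · fun_prop
    · exact Continuous.wave (by fun_prop) continuous_fst
  have hint : Integrable (fun p : E d × (Fin k → E d) =>
      a k p.2 / (k * k.factorial) * ftProd (freq p.2) Finset.univ (sigma β ε t m p.1))
      ((P.map (W t)).prod volume) := by
    refine Integrable.mono' ((hi.div_const ((k : ℂ) * k.factorial)).norm.comp_snd _) hmeas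
      (ae_of_all _ fun p => ?_)
    rw [norm_mul]
    exact mul_le_of_le_one_right (norm_nonneg _) (norm_ftProd_le _ _ _)
  rw [integral_integral_swap hint]
  refine integral_congr_ae (ae_of_all _ fun ξ => ?_)
  beta_reduce
  rw [integral_const_mul, hW.integral_ftProd_sigma hβ hε ht, evolve]
  ring

/-- The bounds C/k^{1+δ} are uniform over the Wasserstein space, so sum and expectation may be
exchanged. -/
theorem IsStandardBrownian.integral_series_sigma (hW : IsStandardBrownian W P)
    (h : L1Bound a C δ) (hm : ∀ k, 1 ≤ k → Measurable (a k)) (hC : 0 ≤ C) (hδ : 0 < δ)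
    (hβ : 0 < β) (hε : 0 ≤ ε) {t : ℝ≥0} (ht : 0 < t) (m : P2 d) :
    Integrable (fun ω => series a (sigma β ε t m (W t ω))) P ∧
      series (evolve a β ε t) m = ∫ ω, series a (sigma β ε t m (W t ω)) ∂P := by
  have hp : IsProbabilityMeasure (P.map (W t)) :=
    Measure.isProbabilityMeasure_map (hW.aemeasurable t)
  have ht' : (0 : ℝ) < t := NNReal.coe_pos.2 ht
  have hk : ∀ n : ℕ, 1 ≤ n + 1 := fun n => by lia
  have hb : ∀ (n : ℕ) w, ‖term a (n + 1) (sigma β ε t m w)‖ ≤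
      C / ((n + 1 : ℕ) : ℝ) ^ (1 + δ) := fun n w => h.norm_term_le hC (hk n) (hm _ (hk n)) _
  have hcn : ∀ n : ℕ, Continuous fun w => term a (n + 1) (sigma β ε t m w) := fun n =>
    continuous_term_sigma (hm _ (hk n)) (h.integrable (hk n) (hm _ (hk n))) hε ht' m
  have hc : Continuous fun w => series a (sigma β ε t m w) :=
    continuous_tsum hcn (summable_div_rpow C hδ) hb
  have hbd : ∀ w, ‖series a (sigma β ε t m w)‖ ≤
      ∑' n : ℕ, C / ((n + 1 : ℕ) : ℝ) ^ (1 + δ) := fun w =>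
    tsum_of_norm_bounded (summable_div_rpow C hδ).hasSum fun n => hb n w
  have hin : ∀ n : ℕ, Integrable (fun w => term a (n + 1) (sigma β ε t m w)) (P.map (W t)) :=
    fun n => Integrable.of_bound (hcn n).aestronglyMeasurable _ (ae_of_all _ (hb n))
  refine ⟨Integrable.of_bound
    (hc.comp_aestronglyMeasurable (hW.aemeasurable t).aestronglyMeasurable) _
    (ae_of_all _ fun ω => hbd (W t ω)), ?_⟩
  have hs : Summable fun n : ℕ => ∫ w, ‖term a (n + 1) (sigma β ε t m w)‖ ∂(P.map (W t)) := by
    refine Summable.of_nonneg_of_le (fun n => integral_nonneg fun w => norm_nonneg _)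
      (fun n => ?_) (summable_div_rpow C hδ)
    refine (integral_mono (hin n).norm (integrable_const _) (hb n)).trans ?_
    simp
  have key := (hasSum_integral_of_summable_integral_norm hin hs).tsum_eq
  refine Eq.trans ?_ (key.trans (integral_map (hW.aemeasurable t) hc.aestronglyMeasurable))
  exact tsum_congr fun n =>
    (hW.integral_term_sigma hβ hε ht m (hm _ (hk n)) (h.integrable (hk n) (hm _ (hk n)))).symm

end Flow

/-! ### Termwise Laplacian of a smooth series -/

section Laplacian

variable {d : ℕ} {a : Coeff d}

lemma IsSmoothCoeff.integrable_lapCoeff_mul_F (h : IsSmoothCoeff a) (ε : ℝ) {k : ℕ} (hk : 1 ≤ k)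
    (m : P2 d) : Integrable (fun ξ => lapCoeff a ε k ξ * F k ξ m) := by
  have hk0 : (k : ℂ) ≠ 0 := by exact_mod_cast (by lia : k ≠ 0)
  have hf : (k.factorial : ℂ) ≠ 0 := by exact_mod_cast k.factorial_ne_zero
  refine ((h.integrable_lapCoeff_mul ε hk m).const_mul (k.factorial : ℂ)).congr
    (ae_of_all _ fun ξ => ?_)
  beta_reduce
  rw [F_eq]
  field_simp

theorem IsSmoothCoeff.exists_hasWLaplacian (h : IsSmoothCoeff a) (β ε : ℝ) (m : P2 d) :
    HasWLaplacian ε (series a) m (series (lapCoeff a ε) m) ∧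
    (∀ k, 1 ≤ k → ∀ ξ : Fin k → E d,
      HasWLaplacian ε (F k ξ) m (-(lamSq k ε ξ : ℂ) * F k ξ m)) ∧
    (∀ k, 1 ≤ k → Integrable (fun ξ => a k ξ * (β * (-(lamSq k ε ξ : ℂ) * F k ξ m)))) ∧
    HasSum (fun n : ℕ => (1 / ((n + 1).factorial : ℂ)) *
      ∫ ξ, a (n + 1) ξ * (β * (-(lamSq (n + 1) ε ξ : ℂ) * F (n + 1) ξ m)))
      (β * series (lapCoeff a ε) m) := by
  have e : ∀ (k : ℕ) (ξ : Fin k → E d), a k ξ * (β * (-(lamSq k ε ξ : ℂ) * F k ξ m)) =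
      β * (lapCoeff a ε k ξ * F k ξ m) := fun k ξ => by
    rw [lapCoeff]
    ring
  refine ⟨h.hasWLaplacian ε m, fun k _ ξ => hasWLaplacian_F ε ξ m, fun k hk => ?_, ?_⟩
  · simp only [e]
    exact (h.integrable_lapCoeff_mul_F ε hk m).const_mul _
  · refine ((h.summable_term_lapCoeff ε m).hasSum.mul_left (β : ℂ)).congr_fun fun n => ?_
    simp only [e]
    rw [integral_const_mul, term]
    ring

end Laplacian

end

end WassersteinHeat

/-! ### The superposition theorem -/

theorem mainTheorem1 (d : ℕ) {Ω : Type*} [MeasurableSpace Ω] (P : Measure Ω)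
    [IsProbabilityMeasure P] (W : ℝ≥0 → Ω → E d) (hW : IsStandardBrownian W P)
    (s δ C β ε : ℝ) (hs : 0 < s) (hδ : 0 < δ) (hC : 0 < C) (hβ : 0 < β) (hε : 0 ≤ ε)
    (a : Coeff d) (ha : MemA s a) (hL1 : L1Bound a C δ)
    (U₀ : P2 d → ℂ) (hU₀ : U₀ = series a)
    (b : ℝ → Coeff d) (hb : b = evolve a β ε)
    (V : ℝ → P2 d → ℂ) (hV : V = fun t => series (b t)) :
    (∀ t : ℝ, 0 < t →
      TendstoUniformly (partialSum (b t)) (V t) atTop ∧ ∀ l : ℝ, 0 ≤ l → MemH l (V t)) ∧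
    (∀ t : ℝ≥0, 0 < t → ∀ m : P2 d,
      Integrable (fun ω => U₀ (sigma β ε t m (W t ω))) P ∧
      V t m = ∫ ω, U₀ (sigma β ε t m (W t ω)) ∂P) ∧
    ((ε = 0 ∧ MomentBounds a C δ) ∨ (0 < ε ∧ L1Bound a C (3 + δ)) →
      (∀ t : ℝ, 0 < t → IsC2 (V t)) ∧
      (∀ t : ℝ, 0 < t → ∀ m : P2 d, ∃ (L : ℂ) (ℓ : ∀ k : ℕ, (Fin k → E d) → ℂ),
        HasWLaplacian (ε / β) (V t) m L ∧
        (∀ k, 1 ≤ k → ∀ ξ : Fin k → E d, HasWLaplacian (ε / β) (F k ξ) m (ℓ k ξ)) ∧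
        (∀ k, 1 ≤ k → Integrable (fun ξ => b t k ξ * (β * ℓ k ξ))) ∧
        HasSum (fun n : ℕ => (1 / ((n + 1).factorial : ℂ)) *
          ∫ ξ, b t (n + 1) ξ * (β * ℓ (n + 1) ξ)) (β * L) ∧
        HasDerivAt (fun τ => V τ m) (β * L) t) ∧
      ∀ m : P2 d, V 0 m = U₀ m ∧ Tendsto (fun t => V t m) (𝓝[>] 0) (𝓝 (U₀ m))) := by
  subst hV hb hU₀
  have hm : ∀ k, 1 ≤ k → Measurable (a k) := fun k hk => (ha.1 k hk).1
  have hsym : IsSymmCoeff a := fun k hk => (ha.1 k hk).2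
  refine ⟨fun t ht => ⟨(hL1.evolve hβ.le hε ht.le).tendstoUniformly hC.le hδ
    fun k hk => measurable_evolve (hm k hk),
    fun l _ => ha.memH_series_evolve hL1 hC.le hδ hs.le hβ hε ht l⟩,
    fun t ht m => hW.integral_series_sigma hL1 hm hC.le hδ hβ hε ht m, fun h => ?_⟩
  -- Under the moment bounds the initial coefficients are already smooth and damping preserves this;
  -- in the other case smoothness appears only at positive times.
  have hsm : ∀ t, 0 < t → IsSmoothCoeff (evolve a β ε t) := fun t ht => by
    rcases h with ⟨-, hM⟩ | ⟨hε', hL⟩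
    · exact (hM.isSmoothCoeff hL1 hsym hm hC.le hδ).mono
        (fun k hk => measurable_evolve (hm k hk)) (norm_evolve_le hβ.le hε ht.le)
    · exact hL.isSmoothCoeff_evolve hm hC.le hδ hβ hε' ht
  refine ⟨fun t ht => (hsm t ht).isC2, fun t ht m => ?_, fun m => ⟨?_, ?_⟩⟩
  · obtain ⟨h1, h2, h3, h4⟩ := (hsm t ht).exists_hasWLaplacian β (ε / β) m
    refine ⟨_, fun k ξ => -(lamSq k (ε / β) ξ : ℂ) * F k ξ m, h1, h2, h3, h4, ?_⟩
    -- The evolution is restarted at time t/2, where the coefficients are smooth; the semigroup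
    -- property `evolve_add` and a time shift give the derivative at t.
    have hd := (hsm (t / 2) (half_pos ht)).hasDerivAt_series hβ hε m (half_pos ht)
    simp only [evolve_add, add_halves] at hd
    have hd' : HasDerivAt (fun τ => series (evolve a β ε (t / 2 + τ)) m)
        (β * series (lapCoeff (evolve a β ε t) (ε / β)) m) (t - t / 2) := by
      rwa [sub_half]
    simpa using hd'.comp_sub_const t (t / 2)
  · beta_reduce
    rw [evolve_zero]
  · exact hL1.tendsto_series_evolve hC.le hδ hm hβ.le hε m
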